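/- **Processes.** Let $\mathcal N$ be an infinite, linearly ordered set of names. Processes are $P ::= K\lfloor\tilde a\rfloor \mid \sum_{i\in I}\pi_i.P_i \mid \nu r.P \mid P\,|\,P$ with $I$ finite and prefixes $\pi ::= \bar a\langle b\rangle \mid a(x) \mid \tau$; $\mathbf 0$ is the empty sum; threads are processes without $|$. $\mathrm{fn}(P)$ is the set of free names and $P\sigma$ is capture-avoiding substitution. Structural congruence $\equiv$ is the least congruence containing $\alpha$-conversion of restricted and input names, reordering of summands, commutativity and associativity of $|$, $P|\mathbf 0\equiv P$, $\nu r.\mathbf 0\equiv\mathbf 0$, $\nu r.\nu s.P\equiv\nu s.\nu r.P$, and $\nu r.(P|Q)\equiv P|\nu r.Q$ for $r\notin\mathrm{fn}(P)$. Given defining equations $K(\tilde f):=S$ for finitely many identifiers $K$, the reaction relation $\to$ is the least relation that is closed under $|$, $\nu$ and $\equiv$ and contains $\tau.S+\dots\to S$, $K\lfloor\tilde a\rfloor\to S\{\tilde a/\tilde f\}$ and $(x(y).S_1+\dots)\,|\,(\bar x\langle z\rangle.S_2+\dots)\to S_1\{z/y\}\,|\,S_2$. **Specification.** Let $F=\nu\tilde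 r.(S_{init,1}\sigma_1|\dots|S_{init,n}\sigma_n)$ together with its defining equations and additional equations $K_{init,i}(\tilde f_{init,i}):=S_{init,i}$ whose identifiers are never called. Let $\mathrm{FRM}$ be the set of all formal parameters (including the $\tilde f_{init,i}$), $\mathrm{INP}$ and $\mathrm{RESTR}$ the sets of names bound by input prefixes and by restrictions (including $\tilde r$) in the specification, and $\mathrm{PUB}=\mathrm{fn}(F)$. Assume: all bodies $S$, $S_{init,i}$ are threads without $\mathbf 0$ whose calls have the right number of parameters; $\mathrm{fn}(S)=\tilde f$ for every equation, including the additional ones; in every $x(y).S$ and $\nu r.S$ occurring in a body, $y$ resp. $r$ is free in $S$; every name is bound at most once and is used at most once as a formal parameter in the whole specification; $\mathrm{RESTR}\cup\mathrm{INP}$, $\mathrm{FRM}$ and $\mathrm{PUB}$ are pairwise disjoint; different threads call (directly or indirectly) disjoint sets of identifiers; no equation $K(\tilde f):=S$ has a call of $K$ in $S$; every $S_{init,i}$ is a sum or a call; $\sigma_i:\tilde f_{init,i}\to\tilde r\cup\mathrm{PUB}$ (identity elsewhere). The transition system $\mathcal T(F)$ has as states the $\equiv$-classes $[G]$ of the processes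 $G$ reachable from $F$, transitions $[G]\to[G']$ if $G\to G'$, and initial state $[F]$. **The net $N(F)$.** Let $\mathrm{NEW}$ be a finite set, disjoint from $\mathrm{PUB}$, with $|\mathrm{NEW}|\ge|\mathrm{RESTR}|+|\mathrm{INP}|+|\mathrm{FRM}|$. A Petri net has places, transitions, a flow relation without weights and an initial marking; a transition is enabled if all places in its preset are marked. Write $V=\mathrm{INP}\cup\mathrm{FRM}\cup\mathrm{RESTR}$, and let $\mathrm{dom}(x)=\mathrm{NEW}$ for $x\in\mathrm{RESTR}$ and $\mathrm{dom}(x)=\mathrm{PUB}\cup\mathrm{NEW}$ for $x\in\mathrm{INP}\cup\mathrm{FRM}$. The substitution net has the places $[x=a]$ ($x\in V$, $a\in\mathrm{dom}(x)$), $[x\ne m]$ ($x\in\mathrm{INP}\cup\mathrm{FRM}$, $m\in\mathrm{NEW}$), $[r_*\ne m]$ ($m\in\mathrm{NEW}$) and no transitions. A marking $M$ of it is a *substitution marking* if $M[r_*\ne m]+\sum_{r\in\mathrm{RESTR}}M[r=m]=1$ for all $m\in\mathrm{NEW}$, $\sum_a M[x=a]\le1$ for all $x\in V$, and $M[x=m]+M[x\ne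 m]=1$ for all $x\in\mathrm{INP}\cup\mathrm{FRM}$, $m\in\mathrm{NEW}$. For a set of names $\tilde s$, it *corresponds* to a substitution $\sigma$ with domain $D\subseteq V$ that maps $D\cap\mathrm{RESTR}$ injectively into $\tilde s$ and the rest of $D$ into $\mathrm{PUB}\cup\tilde s$, if: $M[x=a]=0$ for $x\in V\setminus D$ and all $a$; $M[x=\sigma(x)]=1$ if $x\in D$, $\sigma(x)\in\mathrm{PUB}$; for $x\in D$ with $\sigma(x)\in\tilde s$ there is $m\in\mathrm{NEW}$ with $M[x=m]=1$; and for $x,y\in D$ with $\sigma(x),\sigma(y)\in\tilde s$: $\sigma(x)=\sigma(y)$ iff $M[x=m]=M[y=m]$ for all $m\in\mathrm{NEW}$. Pairs $(S,\lambda)$ of a thread and a list of names have the following transitions, each with a label (written first) and a set of commands, where $\lambda'$ lists in increasing order the names free in the source sum but not in $S$, where $m$ ranges over $\mathrm{NEW}$, and where $a\in\mathrm{dom}(x)$ and, for outputs and inputs, $b\in\mathrm{dom}(y)$: - $(\nu)$ $(\nu r.S,\lambda)\to(S,\lambda)$: $\tau$, $\{\mathrm{map}(r,m)\}$; - $(\tau)$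 $(\tau.S+\dots,\lambda)\to(S,\lambda\lambda')$: $\tau$, $\emptyset$; - (snd) $(\bar x\langle y\rangle.S+\dots,\lambda)\to(S,\lambda\lambda')$: $\mathit{send}(a,b)$, $\{\mathrm{test}(x,a),\mathrm{test}(y,b)\}$; - (rec) $(x(y).S+\dots,\lambda)\to(S,\lambda\lambda')$: $\mathit{rec}(a,b)$, $\{\mathrm{test}(x,a),\mathrm{map}(y,b)\}$; - (call$_1$) $(K\lfloor x_1,\dots,x_{k-1},x\rfloor,\lambda)\to(K\lfloor x_1,\dots,x_{k-1}\rfloor,\lambda'')$: $\tau$, $\{\mathrm{test}(x,a),\mathrm{map}(f_k,a)\}$, where $f_k$ is the $k$-th formal parameter of $K$, $\lambda''=\lambda$ if $x\in\lambda$, and $\lambda''=\lambda x$ otherwise; - (call$_2$) $(K\lfloor\rfloor,x\lambda)\to(K\lfloor\rfloor,\lambda)$: $\tau$, $\{\mathrm{unmap}(x,a)\}$; - (call$_3$) $(K\lfloor\rfloor,\varepsilon)\to(S,\varepsilon)$ for $K(\tilde f):=S$: $\tau$, $\emptyset$. $N(S_{init,i})$ is the net whose places are the pairs reachable from $(S_{init,i},\varepsilon)$,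 whose transitions (with one input and one output place) are the transitions between them, and which initially has one token, on $(S_{init,i},\varepsilon)$. The places of $N(F)$ are those of the substitution net together with the disjoint union of the places of the nets $N(S_{init,i})$. Its transitions are the $\tau$-labelled transitions of the $N(S_{init,i})$ and the pairs of a $\mathit{send}(a,b)$-transition of $N(S_{init,i})$ and a $\mathit{rec}(a,b)$-transition of $N(S_{init,j})$, $i\neq j$, which unite the arcs and commands of their components. Commands are implemented by the following additional arcs, where $p\in\mathrm{PUB}$, $m\in\mathrm{NEW}$, $x\in\mathrm{INP}\cup\mathrm{FRM}$, $r\in\mathrm{RESTR}$: a test of $y\in V$ for the value $a$ reads (consumes and produces) $[y=a]$; $\mathrm{map}(x,p)$ produces $[x=p]$; $\mathrm{map}(x,m)$ consumes $[x\ne m]$ and produces $[x=m]$; $\mathrm{map}(r,m)$ consumes $[r_*\ne m]$, produces $[r=m]$ and reads $[y\ne m]$ for all $y\in\mathrm{INP}\cup\mathrm{FRM}$; $\mathrm{unmap}(x,p)$ consumes $[x=p]$; $\mathrm{unmap}(x,m)$ consumes $[x=m]$ and produces $[x\ne m]$; $\mathrm{unmap}(r,m)$ consumes $[r=m]$ and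 produces $[r_*\ne m]$. The initial marking $M_0$ consists of the initial markings of the $N(S_{init,i})$ and an arbitrary fixed substitution marking that corresponds to $\sigma_1\cup\dots\cup\sigma_n$ (with $\tilde s=\tilde r$). **Stable transition system.** A place $(S,\lambda)$ is stable if $S$ is a sum or a call with full parameter list. A marking of $N(F)$ is stable if it marks a stable place of every $N(S_{init,i})$. For stable reachable markings, $M\Rightarrow M'$ if a transition sequence leads from $M$ to $M'$ in which exactly one transition is of the form $(\tau)$, a communication pair, or of the form (call$_3$). Let $\mathcal T_{st}(N(F))$ be the transition system of the reachable stable markings with $\Rightarrow$ and initial state $M_0$. **Theorem.** The net $N(F)$ is safe (no reachable marking puts more than one token on a place), $M_0$ is stable, and $\mathcal T(F)$ and $\mathcal T_{st}(N(F))$ are bisimilar via the following relation $\mathcal R$. A state $[G]$ of $\mathcal T(F)$ and a reachable stable marking $M$ are related iff there is a process $\nu\tilde s.(S_1\tau_1|\dots|S_n\tau_n)\equiv G$, with distinct non-public names $\tilde s$, and there are lists $\lambda_1,\dots,\lambda_n$, such that for all $i$: $(S_i,\lambda_i)$ is stable and can be reached from $(S,\varepsilon)$, for the right-hand side $S$ of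 some equation (possibly one of the additional ones), by zero or more of the above transitions without using (call$_3$); $\tau_i:\mathrm{fn}(S_i)\cup\lambda_i\to\tilde s\cup\mathrm{PUB}$ (identity elsewhere); $M$ puts one token on the place $(S_i,\lambda_i)$ of $N(S_{init,i})$; and the restriction of $M$ to the substitution net corresponds to $\tau_1\cup\dots\cup\tau_n$. That is, $[F]\mathrel{\mathcal R}M_0$; if $[G]\mathrel{\mathcal R}M$ and $[G]\to[G']$ then there is $M'$ with $M\Rightarrow M'$ and $[G']\mathrel{\mathcal R}M'$; and if $[G]\mathrel{\mathcal R}M$ and $M\Rightarrow M'$ then there is $[G']$ with $[G]\to[G']$ and $[G']\mathrel{\mathcal R}M'$. -/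

import Mathlib

/-! # Processes

Names are taken from an infinite linearly ordered type `𝒩`, process identifiers from a type `PID`.
-/

namespace FCP

noncomputable section

/-- The three kinds of prefixes: output `a⟨b⟩`, input `a(x)` and the silent prefix. -/
inductive Prefix (𝒩 : Type*) where
  | out (a b : 𝒩)
  | inp (a x : 𝒩)
  | tau

/-- Process terms: calls `K⌊ã⌋`, finite guarded choices `∑ i, π i . S i` (the empty choice is
the stop process), restrictions `νr.P` and parallel compositions `P | Q`. -/
inductive Proc (𝒩 PID : Type*) where
  | call (K : PID) (args : List 𝒩)
  | choice {m : ℕ} (π : Fin m → Prefix 𝒩) (S : Fin m → Proc 𝒩 PID)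
  | res (r : 𝒩) (P : Proc 𝒩 PID)
  | par (P Q : Proc 𝒩 PID)

section Terms

variable {𝒩 PID : Type*}

/-- The names bound by a prefix. -/
def Prefix.bound : Prefix 𝒩 → Multiset 𝒩
  | .inp _ x => {x}
  | _ => 0

namespace Proc

/-- The stop process. -/
def zero : Proc 𝒩 PID := .choice (m := 0) Fin.elim0 Fin.elim0

/-- Iterated parallel composition. -/
def prod : List (Proc 𝒩 PID) → Proc 𝒩 PID
  | [] => zero
  | P :: Ps => .par P (prod Ps)

/-- A sequence of restrictions `νr₁. … νr_k. P`. -/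
def resList (rs : List 𝒩) (P : Proc 𝒩 PID) : Proc 𝒩 PID := rs.foldr .res P

/-- Occurrences of names bound by restrictions. -/
def restrBound : Proc 𝒩 PID → Multiset 𝒩
  | .call _ _ => 0
  | .choice _ S => ∑ i, (S i).restrBound
  | .res r P => {r} + P.restrBound
  | .par P Q => P.restrBound + Q.restrBound

/-- Occurrences of names bound by input prefixes. -/
def inpBound : Proc 𝒩 PID → Multiset 𝒩
  | .call _ _ => 0
  | .choice π S => ∑ i, ((π i).bound + (S i).inpBound)
  | .res _ P => P.inpBound
  | .par P Q => P.inpBound + Q.inpBound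

/-- The identifiers called in a process. -/
def calls : Proc 𝒩 PID → Set PID
  | .call K _ => {K}
  | .choice _ S => ⋃ i, (S i).calls
  | .res _ P => P.calls
  | .par P Q => P.calls ∪ Q.calls

/-- Threads (sequential processes): no parallel composition. -/
def IsThread : Proc 𝒩 PID → Prop
  | .call _ _ => True
  | .choice _ S => ∀ i, (S i).IsThread
  | .res _ P => P.IsThread
  | .par _ _ => False

/-- The stop process does not occur. -/
def NoStop : Proc 𝒩 PID → Prop
  | .call _ _ => True
  | .choice (m := m) _ S => m ≠ 0 ∧ ∀ i, (S i).NoStop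
  | .res _ P => P.NoStop
  | .par P Q => P.NoStop ∧ Q.NoStop

/-- All calls have as many parameters as the identifier has according to `arity`. -/
def ArityOK (arity : PID → ℕ) : Proc 𝒩 PID → Prop
  | .call K args => args.length = arity K
  | .choice _ S => ∀ i, (S i).ArityOK arity
  | .res _ P => P.ArityOK arity
  | .par P Q => P.ArityOK arity ∧ Q.ArityOK arity

/-- The process is a choice. -/
def IsChoice (P : Proc 𝒩 PID) : Prop :=
  ∃ (m : ℕ) (π : Fin m → Prefix 𝒩) (S : Fin m → Proc 𝒩 PID), P = .choice π S

/-- The process is an identifier call. -/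
def IsCall (P : Proc 𝒩 PID) : Prop := ∃ K args, P = .call K args

variable [LinearOrder 𝒩]

/-- Free names. -/
def fn : Proc 𝒩 PID → Finset 𝒩
  | .call _ args => args.toFinset
  | .choice π S => Finset.univ.biUnion fun i =>
      match π i with
      | .out a b => {a, b} ∪ (S i).fn
      | .inp a x => {a} ∪ (S i).fn.erase x
      | .tau => (S i).fn
  | .res r P => P.fn.erase r
  | .par P Q => P.fn ∪ Q.fn

/-- Every name bound by an input prefix or a restriction occurs free in the scope of its binder. -/
def BindersUsed : Proc 𝒩 PID → Prop
  | .call _ _ => True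
  | .choice π S => ∀ i, (∀ a x, π i = .inp a x → x ∈ (S i).fn) ∧ (S i).BindersUsed
  | .res r P => r ∈ P.fn ∧ P.BindersUsed
  | .par P Q => P.BindersUsed ∧ Q.BindersUsed

end Proc

variable [LinearOrder 𝒩] [Infinite 𝒩]

/-- The binder to be used when `σ` is pushed below a binder `x` with scope of free names `A`:
`x` itself if this captures nothing, and a fresh name otherwise. -/
def newBinder (σ : 𝒩 → 𝒩) (x : 𝒩) (A : Finset 𝒩) : 𝒩 :=
  if x ∈ (A.erase x).image σ then (Infinite.exists_notMem_finset ((A.erase x).image σ)).choose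
  else x

/-- Capture-avoiding application `Pσ` of a substitution `σ`. -/
def Proc.subst : Proc 𝒩 PID → (𝒩 → 𝒩) → Proc 𝒩 PID
  | .call K args, σ => .call K (args.map σ)
  | .choice π S, σ => .choice
      (fun i => match π i with
        | .out a b => .out (σ a) (σ b)
        | .inp a x => .inp (σ a) (newBinder σ x (S i).fn)
        | .tau => .tau)
      (fun i => (S i).subst (match π i with
        | .inp _ x => Function.update σ x (newBinder σ x (S i).fn)
        | _ => σ))
  | .res r P, σ =>
      .res (newBinder σ r P.fn) (P.subst (Function.update σ r (newBinder σ r P.fn)))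
  | .par P Q, σ => .par (P.subst σ) (Q.subst σ)

/-- The substitution `{y/x}`. -/
def single (x y : 𝒩) : 𝒩 → 𝒩 := Function.update id x y

/-- The substitution `{a₁,…,a_k / x₁,…,x_k}`. -/
def listSubst : List 𝒩 → List 𝒩 → 𝒩 → 𝒩
  | x :: xs, a :: as => Function.update (listSubst xs as) x a
  | _, _ => id

/-- Structural congruence: the smallest congruence that contains α-conversion of restricted names
and of input names, the commutative monoid laws of `|` with the stop process, the laws of
restriction, and the reordering of the summands of a choice (which makes `∑ i, π i . S i`
independent of the enumeration of its finite index set). -/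
inductive SC : Proc 𝒩 PID → Proc 𝒩 PID → Prop
  | refl (P) : SC P P
  | symm {P Q} : SC P Q → SC Q P
  | trans {P Q R} : SC P Q → SC Q R → SC P R
  | choice_congr {m : ℕ} (π : Fin m → Prefix 𝒩) {S S' : Fin m → Proc 𝒩 PID} :
      (∀ i, SC (S i) (S' i)) → SC (.choice π S) (.choice π S')
  | res_congr (r) {P P'} : SC P P' → SC (.res r P) (.res r P')
  | par_congr {P P' Q Q'} : SC P P' → SC Q Q' → SC (.par P Q) (.par P' Q')
  | alpha_res (r r' P) : r' ∉ P.fn → SC (.res r P) (.res r' (P.subst (single r r')))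
  | alpha_inp {m : ℕ} (π : Fin m → Prefix 𝒩) (S : Fin m → Proc 𝒩 PID) (i : Fin m) (a x x' : 𝒩) :
      π i = .inp a x → x' ∉ (S i).fn →
      SC (.choice π S)
        (.choice (Function.update π i (.inp a x'))
          (Function.update S i ((S i).subst (single x x'))))
  | choice_reindex {m m' : ℕ} (e : Fin m' ≃ Fin m) (π : Fin m → Prefix 𝒩)
      (S : Fin m → Proc 𝒩 PID) : SC (.choice π S) (.choice (π ∘ e) (S ∘ e))
  | par_comm (P Q) : SC (.par P Q) (.par Q P)
  | par_assoc (P Q R) : SC (.par (.par P Q) R) (.par P (.par Q R))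
  | par_zero (P) : SC (.par P .zero) P
  | res_zero (r) : SC (.res r .zero) .zero
  | res_comm (r s P) : SC (.res r (.res s P)) (.res s (.res r P))
  | scope (r P Q) : r ∉ P.fn → SC (.res r (.par P Q)) (.par P (.res r Q))

/-- Structural congruence as a setoid. -/
def scSetoid (𝒩 PID : Type*) [LinearOrder 𝒩] [Infinite 𝒩] : Setoid (Proc 𝒩 PID) where
  r := SC
  iseqv := ⟨SC.refl, SC.symm, SC.trans⟩

end Terms

/-! # Specifications -/

/-- The data of a finite control process `νr̃.(S₁σ₁ | … | S_nσ_n)` with its defining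
equations `K(f̃) := S` and the additional equations `K_init,i(f̃_init,i) := S_init,i`
for the `n` initial threads, which no process calls. -/
structure Spec (𝒩 PID : Type*) (n : ℕ) where
  /-- formal parameters of an identifier -/
  formals : PID → List 𝒩
  /-- the process that implements an identifier -/
  body : PID → Proc 𝒩 PID
  /-- the initial restrictions `r̃` -/
  restr₀ : List 𝒩
  /-- formal parameters `f̃_init,i` of the initial threads -/
  formals₀ : Fin n → List 𝒩
  /-- the initial threads `S_init,i` -/
  body₀ : Fin n → Proc 𝒩 PID
  /-- the substitutions `σ_i` assigning values to `f̃_init,i` -/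
  subst₀ : Fin n → 𝒩 → 𝒩

namespace Spec

section Processes

variable {𝒩 PID : Type*} {n : ℕ} [LinearOrder 𝒩] [Infinite 𝒩]

/-- The process `νr̃.(S₁σ₁ | … | S_nσ_n)`. -/
def standardForm (rs : List 𝒩) (S : Fin n → Proc 𝒩 PID) (σ : Fin n → 𝒩 → 𝒩) : Proc 𝒩 PID :=
  .resList rs (.prod (List.ofFn fun i => (S i).subst (σ i)))

variable (F : Spec 𝒩 PID n)

/-- The initial term of the specification. -/
def proc : Proc 𝒩 PID := standardForm F.restr₀ F.body₀ F.subst₀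

/-- The reaction relation. -/
inductive React : Proc 𝒩 PID → Proc 𝒩 PID → Prop
  | tau {m : ℕ} (π : Fin m → Prefix 𝒩) (S : Fin m → Proc 𝒩 PID) (i : Fin m) :
      π i = .tau → React (.choice π S) (S i)
  | const (K : PID) (args : List 𝒩) : args.length = (F.formals K).length →
      React (.call K args) ((F.body K).subst (listSubst (F.formals K) args))
  | comm {m m' : ℕ} (π : Fin m → Prefix 𝒩) (S : Fin m → Proc 𝒩 PID)
      (π' : Fin m' → Prefix 𝒩) (S' : Fin m' → Proc 𝒩 PID) (i : Fin m) (j : Fin m') (x y z : 𝒩) :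
      π i = .inp x y → π' j = .out x z →
      React (.par (.choice π S) (.choice π' S')) (.par ((S i).subst (single y z)) (S' j))
  | par {P P' : Proc 𝒩 PID} (Q : Proc 𝒩 PID) : React P P' → React (.par P Q) (.par P' Q)
  | res (a : 𝒩) {P P' : Proc 𝒩 PID} : React P P' → React (.res a P) (.res a P')
  | struct {P Q P' Q' : Proc 𝒩 PID} : SC P P' → React P' Q' → SC Q' Q → React P Q

/-- `PUB`: the public names. As the defining equations of a process in normal form contain no
public names, these are the free names of the initial term. -/
def pub : Finset 𝒩 := F.proc.fn

/-- The identifiers called, directly or indirectly, by the `i`-th thread. -/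
inductive CalledBy (i : Fin n) : PID → Prop
  | direct {K} : K ∈ (F.body₀ i).calls → CalledBy i K
  | indirect {K L} : CalledBy i K → L ∈ (F.body K).calls → CalledBy i L

/-- The requirements on the shape of a thread in an equation with parameters `f̃`. -/
structure ThreadOK (formals : List 𝒩) (S : Proc 𝒩 PID) : Prop where
  thread : S.IsThread
  arity : S.ArityOK fun K => (F.formals K).length
  noStop : S.NoStop
  used : S.BindersUsed
  fn_eq : S.fn = formals.toFinset

variable [Fintype PID]

/-- `RESTR`: the names bound by restrictions. -/
def restr : Finset 𝒩 :=
  ((F.restr₀ : Multiset 𝒩) + ∑ i, (F.body₀ i).restrBound + ∑ K, (F.body K).restrBound).toFinset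

/-- `INP`: the names bound by input prefixes. -/
def inp : Finset 𝒩 := (∑ i, (F.body₀ i).inpBound + ∑ K, (F.body K).inpBound).toFinset

/-- All occurrences of formal parameters in parameter lists. -/
def allFormals : Multiset 𝒩 :=
  ∑ i, (F.formals₀ i : Multiset 𝒩) + ∑ K, (F.formals K : Multiset 𝒩)

/-- `FRM`: the formal parameters. -/
def frm : Finset 𝒩 := F.allFormals.toFinset

/-- All binding occurrences of names. -/
def allBound : Multiset 𝒩 :=
  (F.restr₀ : Multiset 𝒩) + ∑ i, ((F.body₀ i).restrBound + (F.body₀ i).inpBound)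
    + ∑ K, ((F.body K).restrBound + (F.body K).inpBound)

/-- The no clash and normal form assumptions. -/
structure NormalForm : Prop where
  /-- a name is bound at most once -/
  bound_nodup : F.allBound.Nodup
  /-- a name is used at most once as a formal parameter -/
  formals_nodup : F.allFormals.Nodup
  /-- bound and free names are disjoint -/
  bound_free : ∀ x ∈ F.allBound, x ∉ F.proc.fn
  /-- bound names and formal parameters are disjoint -/
  bound_formals : ∀ x ∈ F.allBound, x ∉ F.allFormals
  /-- formal parameters and free names are disjoint -/
  formals_free : ∀ x ∈ F.allFormals, x ∉ F.proc.fn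
  /-- different threads call different identifiers -/
  disjoint : ∀ i j K, i ≠ j → F.CalledBy i K → ¬ F.CalledBy j K
  /-- no defining equation calls itself -/
  no_self_call : ∀ K, K ∉ (F.body K).calls
  /-- shape of the defining equations -/
  body_ok : ∀ K, F.ThreadOK (F.formals K) (F.body K)
  /-- shape of the initial threads -/
  body₀_ok : ∀ i, F.ThreadOK (F.formals₀ i) (F.body₀ i)
  /-- the initial threads are choices or calls -/
  body₀_stable : ∀ i, (F.body₀ i).IsChoice ∨ (F.body₀ i).IsCall
  /-- `σ_i : f̃_init,i → r̃ ∪ PUB` -/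
  subst₀_mem : ∀ i, ∀ x ∈ F.formals₀ i, F.subst₀ i x ∈ F.restr₀ ∨ F.subst₀ i x ∈ F.pub
  subst₀_id : ∀ i, ∀ x ∉ F.formals₀ i, F.subst₀ i x = x

end Processes

end Spec

/-! # Transition systems, bisimulations and Petri nets -/

/-- Unlabelled transition systems with an initial state. -/
structure TransSystem (Q : Type*) where
  states : Set Q
  step : Q → Q → Prop
  init : Q

/-- `R` is a bisimulation between `A` and `B` that relates the initial states. -/
structure IsBisimulation {Q Q' : Type*} (A : TransSystem Q) (B : TransSystem Q')
    (R : Q → Q' → Prop) : Prop where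
  subset : ∀ q q', R q q' → q ∈ A.states ∧ q' ∈ B.states
  init : R A.init B.init
  forth : ∀ q q', R q q' → ∀ p ∈ A.states, A.step q p → ∃ p' ∈ B.states, B.step q' p' ∧ R p p'
  back : ∀ q q', R q q' → ∀ p' ∈ B.states, B.step q' p' → ∃ p ∈ A.states, A.step q p ∧ R p p'

/-- A Petri net with places from `α` and transitions from `β`. The flow relation is given by the
presets and postsets of the transitions. Markings are functions on `α` that vanish outside the
set of places. -/
structure PetriNet (α β : Type*) where
  P : Set α
  T : Set β
  pre : β → Set α
  post : β → Set α
  M₀ : α → ℕ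
  pre_subset : ∀ t ∈ T, pre t ⊆ P
  post_subset : ∀ t ∈ T, post t ⊆ P
  M₀_supp : ∀ p ∉ P, M₀ p = 0

namespace PetriNet

variable {α β : Type*} (N : PetriNet α β)

open Classical in
/-- The firing relation `M [t⟩ M'`. -/
def Fires (M : α → ℕ) (t : β) (M' : α → ℕ) : Prop :=
  t ∈ N.T ∧ (∀ p ∈ N.pre t, 0 < M p) ∧
    ∀ p, M' p = M p - (if p ∈ N.pre t then 1 else 0) + (if p ∈ N.post t then 1 else 0)

/-- Firing of a sequence of transitions. -/
inductive FiresSeq : (α → ℕ) → List β → (α → ℕ) → Prop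
  | nil (M) : FiresSeq M [] M
  | cons {M t M' ts M''} : N.Fires M t M' → FiresSeq M' ts M'' → FiresSeq M (t :: ts) M''

/-- Reachable markings. -/
def Reachable (M : α → ℕ) : Prop := ∃ ts, N.FiresSeq N.M₀ ts M

/-- Safe nets: no reachable marking puts more than one token on a place. -/
def Safe : Prop := ∀ M, N.Reachable M → ∀ p ∈ N.P, M p ≤ 1

end PetriNet

/-- Synchronisation labels. Values are public names (from `Pub`) or fresh names (from `ν`). -/
inductive Label (Pub ν : Type*) where
  | tau
  | send (a b : Pub ⊕ ν)
  | rcv (a b : Pub ⊕ ν)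

/-- Commands on the substitution. -/
inductive Cmd (𝒩 Pub ν : Type*) where
  | map (x : 𝒩) (b : Pub ⊕ ν)
  | unmap (x : 𝒩) (b : Pub ⊕ ν)
  | test (x : 𝒩) (b : Pub ⊕ ν)

/-- Names for the places of the substitution net: `[x=a]`, `[x≠n]` and `[r_*≠n]`. -/
inductive SubstPlace (𝒩 Pub ν : Type*) where
  | eq (x : 𝒩) (a : Pub ⊕ ν)
  | neq (x : 𝒩) (n : ν)
  | neqRestr (n : ν)

/-- A Petri net whose transitions carry a label and a set of commands. -/
structure ControlNet (α β 𝒩 Pub ν : Type*) extends PetriNet α β where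
  lab : β → Label Pub ν
  cmd : β → Set (Cmd 𝒩 Pub ν)

/-- Transitions of a parallel composition: those of the components, and pairs consisting of a
sending transition of the `i`-th and a receiving transition of the `j`-th component. -/
inductive ParTrans (ι β : Type*) where
  | single (i : ι) (t : β)
  | sync (i : ι) (t : β) (j : ι) (t' : β)

namespace ControlNet

variable {ι α β 𝒩 Pub ν : Type*}

/-- Parallel composition of a family of nets. It is the iteration of the binary operation
(synchronised transitions have label `τ` and take part in no further synchronisation). -/
def parallel (N : ι → ControlNet α β 𝒩 Pub ν) : ControlNet (ι × α) (ParTrans ι β) 𝒩 Pub ν where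
  P := {p | p.2 ∈ (N p.1).P}
  T := {u | match u with
    | .single i t => t ∈ (N i).T
    | .sync i t j t' => i ≠ j ∧ t ∈ (N i).T ∧ t' ∈ (N j).T ∧
        ∃ a b, (N i).lab t = .send a b ∧ (N j).lab t' = .rcv a b}
  pre
    | .single i t => Prod.mk i '' (N i).pre t
    | .sync i t j t' => Prod.mk i '' (N i).pre t ∪ Prod.mk j '' (N j).pre t'
  post
    | .single i t => Prod.mk i '' (N i).post t
    | .sync i t j t' => Prod.mk i '' (N i).post t ∪ Prod.mk j '' (N j).post t'
  M₀ p := (N p.1).M₀ p.2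
  pre_subset := by
    rintro (⟨i, t⟩ | ⟨i, t, j, t'⟩) h
    · rintro _ ⟨p, hp, rfl⟩
      exact (N i).pre_subset t h hp
    · rintro _ (⟨p, hp, rfl⟩ | ⟨p, hp, rfl⟩)
      · exact (N i).pre_subset t h.2.1 hp
      · exact (N j).pre_subset t' h.2.2.1 hp
  post_subset := by
    rintro (⟨i, t⟩ | ⟨i, t, j, t'⟩) h
    · rintro _ ⟨p, hp, rfl⟩
      exact (N i).post_subset t h hp
    · rintro _ (⟨p, hp, rfl⟩ | ⟨p, hp, rfl⟩)
      · exact (N i).post_subset t h.2.1 hp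
      · exact (N j).post_subset t' h.2.2.1 hp
  M₀_supp p hp := (N p.1).M₀_supp p.2 hp
  lab
    | .single i t => (N i).lab t
    | .sync _ _ _ _ => .tau
  cmd
    | .single i t => (N i).cmd t
    | .sync i t j t' => (N i).cmd t ∪ (N j).cmd t'

/-- Hiding removes the transitions whose label is not `τ`. -/
def hide (N : ControlNet α β 𝒩 Pub ν) : ControlNet α β 𝒩 Pub ν where
  P := N.P
  T := {t ∈ N.T | N.lab t = .tau}
  pre := N.pre
  post := N.post
  M₀ := N.M₀
  pre_subset t ht := N.pre_subset t ht.1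
  post_subset t ht := N.post_subset t ht.1
  M₀_supp := N.M₀_supp
  lab := N.lab
  cmd := N.cmd

end ControlNet

/-! # The translation -/

/-- Processes augmented by the list of names that have been forgotten. -/
abbrev Aug (𝒩 PID : Type*) := Proc 𝒩 PID × List 𝒩

/-- The rules of the labelled transition relation of augmented processes. -/
inductive Rule where
  | nu | tau | snd | rcv | call₁ | call₂ | call₃

/-- Transitions of control flow nets: source, label, commands, target. -/
structure CTrans (𝒩 PID Pub ν : Type*) where
  src : Aug 𝒩 PID
  lab : Label Pub ν
  cmd : Set (Cmd 𝒩 Pub ν)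
  tgt : Aug 𝒩 PID

namespace Spec

section Behaviour

open Classical in
/-- The union of substitutions `σ i` with disjoint domains `D i`. -/
def unionSubst {𝒩 : Type*} {n : ℕ} (D : Fin n → Set 𝒩) (σ : Fin n → 𝒩 → 𝒩) (x : 𝒩) : 𝒩 :=
  if h : ∃ i, x ∈ D i then σ h.choose x else x

/-- Stable places: choices, and calls with full parameter list. -/
def StablePlace {𝒩 PID : Type*} {n : ℕ} (F : Spec 𝒩 PID n) (p : Aug 𝒩 PID) : Prop :=
  p.1.IsChoice ∨ ∃ K args, p.1 = .call K args ∧ args.length = (F.formals K).length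

variable {𝒩 PID : Type*} {n : ℕ} [LinearOrder 𝒩] [Infinite 𝒩] (F : Spec 𝒩 PID n)

/-- The transition system of `F`, whose states are classes of reachable processes modulo
structural congruence. -/
def ts : TransSystem (Quotient (scSetoid 𝒩 PID)) where
  states := {q | ∃ P, Relation.ReflTransGen F.React F.proc P ∧ q = Quotient.mk _ P}
  step q q' := ∃ P P', q = Quotient.mk _ P ∧ q' = Quotient.mk _ P' ∧ F.React P P'
  init := Quotient.mk _ F.proc

/-- Places of `N(F)`. -/
abbrev NPlace (ν : Type*) := SubstPlace 𝒩 F.pub ν ⊕ Fin n × Aug 𝒩 PID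

/-- Transitions of `N(F)`. -/
abbrev NTrans (ν : Type*) := ParTrans (Fin n) (CTrans 𝒩 PID F.pub ν)

/-- Stable markings mark a stable place in every control flow net. -/
def StableMarking {ν : Type*} (M : F.NPlace ν → ℕ) : Prop :=
  ∀ i, ∃ p, F.StablePlace p ∧ 0 < M (.inr (i, p))

end Behaviour

section Translation

variable {𝒩 PID : Type*} {n : ℕ} [LinearOrder 𝒩] [Infinite 𝒩] [Fintype PID]
variable (F : Spec 𝒩 PID n) (ν : Type*)

/-- The possible values of the name `x`: restricted names are only mapped to fresh names,
all other names are mapped to public or to fresh names. -/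
def dom (x : 𝒩) : Set (F.pub ⊕ ν) := {a | x ∈ F.restr → ∃ k : ν, a = .inr k}

/-- The names that are free in `P` but not in `Q`, as a sequence. -/
def forgotten (P Q : Proc 𝒩 PID) : List 𝒩 := (P.fn \ Q.fn).sort (· ≤ ·)

/-- The labelled transition relation of augmented processes, with the rule that is applied. -/
inductive Step : Rule → Aug 𝒩 PID → Label F.pub ν → Set (Cmd 𝒩 F.pub ν) → Aug 𝒩 PID → Prop
  | nu (r S l) (k : ν) : Step .nu (.res r S, l) .tau {.map r (.inr k)} (S, l)
  | tau {m : ℕ} (π : Fin m → Prefix 𝒩) (S l) (i : Fin m) : π i = .tau →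
      Step .tau (.choice π S, l) .tau ∅ (S i, l ++ forgotten (.choice π S) (S i))
  | snd {m : ℕ} (π : Fin m → Prefix 𝒩) (S l) (i : Fin m) (x y a b) : π i = .out x y →
      a ∈ F.dom ν x → b ∈ F.dom ν y →
      Step .snd (.choice π S, l) (.send a b) {.test x a, .test y b}
        (S i, l ++ forgotten (.choice π S) (S i))
  | rcv {m : ℕ} (π : Fin m → Prefix 𝒩) (S l) (i : Fin m) (x y a b) : π i = .inp x y →
      a ∈ F.dom ν x → b ∈ F.dom ν y →
      Step .rcv (.choice π S, l) (.rcv a b) {.test x a, .map y b}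
        (S i, l ++ forgotten (.choice π S) (S i))
  | call₁ (K xs x f l a) : (F.formals K)[xs.length]? = some f →
      a ∈ F.dom ν x → a ∈ F.dom ν f →
      Step .call₁ (.call K (xs ++ [x]), l) .tau {.test x a, .map f a}
        (.call K xs, if x ∈ l then l else l ++ [x])
  | call₂ (K x l a) : a ∈ F.dom ν x →
      Step .call₂ (.call K [], x :: l) .tau {.unmap x a} (.call K [], l)
  | call₃ (K) : Step .call₃ (.call K [], []) .tau ∅ (F.body K, [])

/-- The augmented processes that are reachable from `(S_init,i, ε)`. -/
inductive CReach (i : Fin n) : Aug 𝒩 PID → Prop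
  | init : CReach i (F.body₀ i, [])
  | step {p q ρ l C} : CReach i p → F.Step ν ρ p l C q → CReach i q

open Classical in
/-- The control flow net `N(S_init,i)`. -/
def threadNet (i : Fin n) : ControlNet (Aug 𝒩 PID) (CTrans 𝒩 PID F.pub ν) 𝒩 F.pub ν where
  P := {p | F.CReach ν i p}
  T := {t | F.CReach ν i t.src ∧ ∃ ρ, F.Step ν ρ t.src t.lab t.cmd t.tgt}
  pre t := {t.src}
  post t := {t.tgt}
  M₀ p := if p = (F.body₀ i, []) then 1 else 0
  pre_subset := by
    rintro t ht _ rfl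
    exact ht.1
  post_subset := by
    rintro t ⟨h, ρ, hρ⟩ _ rfl
    exact h.step hρ
  M₀_supp := by
    intro p hp
    rw [if_neg]
    rintro rfl
    exact hp .init
  lab := CTrans.lab
  cmd := CTrans.cmd

/-- The places of the substitution net. -/
def substPlaces : Set (SubstPlace 𝒩 F.pub ν) :=
  {p | match p with
    | .eq x (.inl _) => x ∈ F.inp ∪ F.frm
    | .eq x (.inr _) => x ∈ F.inp ∪ F.frm ∪ F.restr
    | .neq x _ => x ∈ F.inp ∪ F.frm
    | .neqRestr _ => True}

/-- Substitution markings. -/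
structure IsSubstMarking [Fintype ν] (M : SubstPlace 𝒩 F.pub ν → ℕ) : Prop where
  supp : ∀ p ∉ F.substPlaces ν, M p = 0
  rest : ∀ k : ν, M (.neqRestr k) + ∑ r ∈ F.restr, M (.eq r (.inr k)) = 1
  bind : ∀ x ∈ F.inp ∪ F.frm ∪ F.restr, ∑ a : F.pub ⊕ ν, M (.eq x a) ≤ 1
  compl : ∀ x ∈ F.inp ∪ F.frm, ∀ k : ν, M (.eq x (.inr k)) + M (.neq x k) = 1

/-- `M` is a substitution marking that corresponds to the substitution `σ` with domain `D`, which
maps input names and formal parameters in `D` to `PUB ∪ r̃` and, injectively, restricted names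
in `D` to `r̃`. -/
structure Corresponds [Fintype ν] (rs : List 𝒩) (D : Set 𝒩) (σ : 𝒩 → 𝒩)
    (M : SubstPlace 𝒩 F.pub ν → ℕ) : Prop where
  marking : F.IsSubstMarking ν M
  dom_subset : D ⊆ (F.inp ∪ F.frm ∪ F.restr : Finset 𝒩)
  dom_val : ∀ x ∈ D, σ x ∈ F.pub ∨ σ x ∈ rs
  dom_restr : ∀ x ∈ D, x ∈ F.restr → σ x ∈ rs
  dom_inj : ∀ x ∈ D, ∀ y ∈ D, x ∈ F.restr → y ∈ F.restr → σ x = σ y → x = y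
  not_dom : ∀ x ∈ F.inp ∪ F.frm ∪ F.restr, x ∉ D → ∀ a, M (.eq x a) = 0
  pub : ∀ x ∈ D, ∀ h : σ x ∈ F.pub, M (.eq x (.inl ⟨σ x, h⟩)) = 1
  restr : ∀ x ∈ D, σ x ∈ rs → ∃ k : ν, M (.eq x (.inr k)) = 1
  eq : ∀ x ∈ D, ∀ y ∈ D, σ x ∈ rs → σ y ∈ rs →
    (σ x = σ y ↔ ∀ k : ν, M (.eq x (.inr k)) = M (.eq y (.inr k)))

/-- The markings of the substitution net that are admissible as initial markings: those that
correspond to `σ₁ ∪ … ∪ σ_n`. -/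
def InitialSubstMarking [Fintype ν] (M : SubstPlace 𝒩 F.pub ν → ℕ) : Prop :=
  F.Corresponds ν F.restr₀ (⋃ i, {x | x ∈ F.formals₀ i})
    (unionSubst (fun i => {x | x ∈ F.formals₀ i}) F.subst₀) M

variable {ν}

/-- The places of the substitution net from which a command consumes a token. -/
def cmdPre : Cmd 𝒩 F.pub ν → Set (SubstPlace 𝒩 F.pub ν)
  | .test x a => {.eq x a}
  | .map _ (.inl _) => ∅
  | .map x (.inr k) =>
      if x ∈ F.restr then {.neqRestr k} ∪ {p | ∃ y ∈ F.inp ∪ F.frm, p = .neq y k} else {.neq x k}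
  | .unmap x a => {.eq x a}

/-- The places of the substitution net on which a command produces a token. -/
def cmdPost : Cmd 𝒩 F.pub ν → Set (SubstPlace 𝒩 F.pub ν)
  | .test x a => {.eq x a}
  | .map x (.inl p) => {.eq x (.inl p)}
  | .map x (.inr k) =>
      if x ∈ F.restr then {.eq x (.inr k)} ∪ {p | ∃ y ∈ F.inp ∪ F.frm, p = .neq y k}
      else {.eq x (.inr k)}
  | .unmap _ (.inl _) => ∅
  | .unmap x (.inr k) => if x ∈ F.restr then {.neqRestr k} else {.neq x k}

/-- The implementation operation: the net without transitions `N₁` and the net `N₂` are put side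
by side, and the commands of `N₂` are implemented by arcs to the places of `N₁`. -/
def implement {α β γ : Type*} (N₁ : PetriNet (SubstPlace 𝒩 F.pub ν) γ)
    (N₂ : ControlNet α β 𝒩 F.pub ν) : PetriNet (SubstPlace 𝒩 F.pub ν ⊕ α) β where
  P := Sum.inl '' N₁.P ∪ Sum.inr '' N₂.P
  T := N₂.T
  pre t := Sum.inl '' (N₁.P ∩ ⋃ c ∈ N₂.cmd t, F.cmdPre c) ∪ Sum.inr '' N₂.pre t
  post t := Sum.inl '' (N₁.P ∩ ⋃ c ∈ N₂.cmd t, F.cmdPost c) ∪ Sum.inr '' N₂.post t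
  M₀ := Sum.elim N₁.M₀ N₂.M₀
  pre_subset t ht := Set.union_subset_union (Set.image_mono Set.inter_subset_left)
    (Set.image_mono (N₂.pre_subset t ht))
  post_subset t ht := Set.union_subset_union (Set.image_mono Set.inter_subset_left)
    (Set.image_mono (N₂.post_subset t ht))
  M₀_supp := by
    rintro (p | p) hp
    · exact N₁.M₀_supp p fun h => hp (.inl ⟨p, h, rfl⟩)
    · exact N₂.M₀_supp p fun h => hp (.inr ⟨p, h, rfl⟩)

/-- The transitions that reflect reactions: silent actions, communications and the transfer of
control to the body of a called identifier. -/
def IsReaction : F.NTrans ν → Prop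
  | .single _ t => F.Step ν .tau t.src t.lab t.cmd t.tgt ∨ F.Step ν .call₃ t.src t.lab t.cmd t.tgt
  | .sync _ _ _ _ => True

/-- Race free transition sequences contain exactly one reaction. -/
def RaceFree (ts : List (F.NTrans ν)) : Prop :=
  ∃ ts₁ t ts₂, ts = ts₁ ++ t :: ts₂ ∧ F.IsReaction t ∧
    (∀ u ∈ ts₁, ¬ F.IsReaction u) ∧ ∀ u ∈ ts₂, ¬ F.IsReaction u

variable (ν) in
/-- `(S', λ')` is derived from `(S, λ)`: it is reached without executing an identifier call. -/
def Derived : Aug 𝒩 PID → Aug 𝒩 PID → Prop :=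
  Relation.ReflTransGen fun p q => ∃ ρ l C, ρ ≠ Rule.call₃ ∧ F.Step ν ρ p l C q

variable [Fintype ν]

/-- The substitution net with initial marking `M`. -/
def substNet {M : SubstPlace 𝒩 F.pub ν → ℕ} (hM : F.InitialSubstMarking ν M) :
    PetriNet (SubstPlace 𝒩 F.pub ν) Empty where
  P := F.substPlaces ν
  T := ∅
  pre _ := ∅
  post _ := ∅
  M₀ := M
  pre_subset _ h := h.elim
  post_subset _ h := h.elim
  M₀_supp := hM.marking.supp

/-- The net `N(F)`. -/
def net {M : SubstPlace 𝒩 F.pub ν → ℕ} (hM : F.InitialSubstMarking ν M) :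
    PetriNet (F.NPlace ν) (F.NTrans ν) :=
  F.implement (F.substNet hM) (ControlNet.parallel (F.threadNet ν)).hide

/-! # The transition systems and the bisimulation -/

/-- The stable transition system of `N(F)`: reachable stable markings and race free transition
sequences between them. -/
def stableTS {M : SubstPlace 𝒩 F.pub ν → ℕ} (hM : F.InitialSubstMarking ν M) :
    TransSystem (F.NPlace ν → ℕ) where
  states := {M' | (F.net hM).Reachable M' ∧ F.StableMarking M'}
  step M₁ M₂ := ∃ ts, (F.net hM).FiresSeq M₁ ts M₂ ∧ F.RaceFree ts
  init := (F.net hM).M₀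

/-- The relation `ℛ` between classes of reachable processes and reachable stable markings. -/
def Rel {M : SubstPlace 𝒩 F.pub ν → ℕ} (hM : F.InitialSubstMarking ν M)
    (q : Quotient (scSetoid 𝒩 PID)) (M' : F.NPlace ν → ℕ) : Prop :=
  q ∈ F.ts.states ∧ M' ∈ (F.stableTS hM).states ∧
  ∃ (rs : List 𝒩) (S : Fin n → Proc 𝒩 PID) (l : Fin n → List 𝒩) (σ : Fin n → 𝒩 → 𝒩),
    -- the restricted names are distinct and not public
    rs.Nodup ∧ (∀ r ∈ rs, r ∉ F.pub) ∧
    -- each `S i` is a choice or a call, derived from the process of some equation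
    (∀ i, F.StablePlace (S i, l i)) ∧
    (∀ i, (∃ j, F.Derived ν (F.body₀ j, []) (S i, l i)) ∨
      ∃ K, F.Derived ν (F.body K, []) (S i, l i)) ∧
    -- `σ i` is a substitution from `fn (S i) ∪ l i` to `rs ∪ PUB`
    (∀ i x, x ∈ (S i).fn ∨ x ∈ l i → σ i x ∈ rs ∨ σ i x ∈ F.pub) ∧
    (∀ i x, ¬ (x ∈ (S i).fn ∨ x ∈ l i) → σ i x = x) ∧
    -- the process is in the class `q`
    q = Quotient.mk _ (standardForm rs S σ) ∧
    -- the marking of the substitution net corresponds to the union of the substitutions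
    F.Corresponds ν rs (⋃ i, {x | x ∈ (S i).fn ∨ x ∈ l i})
      (unionSubst (fun i => {x | x ∈ (S i).fn ∨ x ∈ l i}) σ) (fun p => M' (.inl p)) ∧
    -- the control flow marking
    ∀ i, M' (.inr (i, (S i, l i))) = 1

end Translation

end Spec

end

end FCP

/-! The proof compares both sides with one kind of state: a control state `p i` for every thread and
a partial valuation `η` giving values to names. Because every name is bound once, or is a formal
parameter once, and different threads call disjoint sets of identifiers, no two threads share a
name. So a single valuation serves all threads. The invariant `Inv` says that `p` is reachable in
the control nets, that `η` is injective on restricted names with values of the right kind, and that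
exactly the live names have a value.

Net side. `enc p η` is the 0/1 marking that such a state describes. Every substitution marking has
the form `substEnc η` (`IsSubstMarking.exists_eq_substEnc`), which covers the arbitrary initial
marking. Firing preserves the form (`Inv.of_fires`), so all reachable markings are encodings and the
net is safe. Fix an injection `g` of the fresh values into non-public names. A state then denotes
the class `sem g p η`: all names `g k`, used or not, are restricted over the parallel composition of
the instantiated threads. Opening a restriction, transferring a parameter or forgetting a name
leaves this class unchanged. The remaining transitions are reactions of it.

Process side. To simulate a reaction of `sem g p η` one has to know that it comes from one or two of
the threads, although reaction is closed under structural congruence. For this a process is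
flattened (`Flat`) into its unguarded restricted names and the multiset of its unguarded calls and
non-empty choices. Continuations are kept only up to congruence, and an input continuation is a
function of the received name, so that α-conversion becomes invisible. Congruent processes have the
same flattenings up to superfluous restricted names (`SC.flatLe`). Hence every reaction is a
reduction of the multiset (`React.flat`). All of this rests on substitution being compatible with
congruence (`SC.subst_comp`, `SC.subst`).

The relation. Among reachable stable markings, `ℛ` is the graph of `sem`: `Inv.rel` shows that the
class denoted by a marking is related to it, and `Inv.eq_sem_of_rel` that no other class is. A race
free run is a silent run, one reaction and another silent run, so it induces exactly one reaction of
classes. Conversely a reduction picks the thread or the pair of threads to be moved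
(`Inv.exists_step`). A call first transfers its parameters and forgets all old names. After the
reaction the leading restrictions are opened, and a value for each of them exists by the pigeonhole
principle (`Inv.exists_fresh`), as there are at least as many fresh values as names. -/

namespace FCP

set_option linter.unusedSectionVars false

/-! # Substitution up to structural congruence -/

section Substitution

variable {𝒩 PID : Type*} [LinearOrder 𝒩]

open Function

/-- The free names of a prefix whose continuation has the free names `A`. -/
def Prefix.scopeFn (A : Finset 𝒩) : Prefix 𝒩 → Finset 𝒩
  | .out a b => {a, b} ∪ A
  | .inp a x => {a} ∪ A.erase x
  | .tau => A

theorem Proc.fn_choice {m : ℕ} (π : Fin m → Prefix 𝒩) (S : Fin m → Proc 𝒩 PID) :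
    (Proc.choice π S).fn = Finset.univ.biUnion fun i => (π i).scopeFn (S i).fn := by
  rw [Proc.fn]
  refine congrArg _ (funext fun i => ?_)
  cases π i <;> rfl

theorem Proc.scopeFn_subset {m : ℕ} (π : Fin m → Prefix 𝒩) (S : Fin m → Proc 𝒩 PID) (i : Fin m) :
    (π i).scopeFn (S i).fn ⊆ (Proc.choice π S).fn := by
  rw [Proc.fn_choice]
  exact Finset.subset_biUnion_of_mem (fun i => (π i).scopeFn (S i).fn) (Finset.mem_univ i)

variable [Infinite 𝒩]

theorem newBinder_notMem (σ : 𝒩 → 𝒩) (x : 𝒩) (A : Finset 𝒩) :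
    newBinder σ x A ∉ (A.erase x).image σ := by
  unfold newBinder
  split_ifs with h
  · exact (Infinite.exists_notMem_finset ((A.erase x).image σ)).choose_spec
  · exact h

theorem newBinder_congr {σ τ : 𝒩 → 𝒩} {x : 𝒩} {A : Finset 𝒩}
    (h : ∀ z ∈ A.erase x, σ z = τ z) : newBinder σ x A = newBinder τ x A := by
  have : (A.erase x).image σ = (A.erase x).image τ := Finset.image_congr fun z hz => h z hz
  unfold newBinder
  simp only [this]

/-- The prefix obtained when a substitution is pushed below a prefix. -/
noncomputable def Prefix.sub (σ : 𝒩 → 𝒩) (A : Finset 𝒩) : Prefix 𝒩 → Prefix 𝒩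
  | .out a b => .out (σ a) (σ b)
  | .inp a x => .inp (σ a) (newBinder σ x A)
  | .tau => .tau

/-- The substitution that is applied to the continuation of a prefix. -/
noncomputable def Prefix.under (σ : 𝒩 → 𝒩) (A : Finset 𝒩) : Prefix 𝒩 → 𝒩 → 𝒩
  | .inp _ x => update σ x (newBinder σ x A)
  | _ => σ

theorem Proc.subst_choice {m : ℕ} (π : Fin m → Prefix 𝒩) (S : Fin m → Proc 𝒩 PID) (σ : 𝒩 → 𝒩) :
    (Proc.choice π S).subst σ = .choice (fun i => (π i).sub σ (S i).fn)
      (fun i => (S i).subst ((π i).under σ (S i).fn)) := by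
  rw [Proc.subst]
  congr 1

theorem update_eq_of_eqOn_erase {σ τ : 𝒩 → 𝒩} {x : 𝒩} {A : Finset 𝒩} (y : 𝒩)
    (h : ∀ z ∈ A.erase x, σ z = τ z) : ∀ z ∈ A, update σ x y z = update τ x y z := by
  intro z hz
  by_cases hx : z = x
  · subst hx; simp
  · rw [update_of_ne hx, update_of_ne hx, h z (Finset.mem_erase.2 ⟨hx, hz⟩)]

/-- This is a literal equality: the binder chosen by `newBinder` depends only on the values of the
substitution on the free names of the scope. -/
theorem Proc.subst_congr {P : Proc 𝒩 PID} {σ τ : 𝒩 → 𝒩} (h : ∀ x ∈ P.fn, σ x = τ x) :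
    P.subst σ = P.subst τ := by
  induction P generalizing σ τ with
  | call K args =>
    simp only [Proc.subst, Proc.call.injEq, true_and]
    exact List.map_congr_left fun x hx => h x (by simpa [Proc.fn] using hx)
  | choice π S ih =>
    rw [Proc.subst_choice, Proc.subst_choice]
    have key : ∀ i, ∀ z ∈ (π i).scopeFn (S i).fn, σ z = τ z := fun i z hz =>
      h z (Proc.scopeFn_subset π S i hz)
    congr 1
    · funext i
      have := key i
      cases hp : π i with
      | out a b =>
        rw [hp] at this
        simp only [Prefix.sub]
        rw [this a (by simp [Prefix.scopeFn]), this b (by simp [Prefix.scopeFn])]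
      | inp a x =>
        rw [hp] at this
        simp only [Prefix.sub]
        rw [this a (by simp [Prefix.scopeFn]), newBinder_congr fun z hz => this z ?_]
        simp only [Prefix.scopeFn, Finset.mem_union]
        exact .inr hz
      | tau => rfl
    · funext i
      have := key i
      refine ih i ?_
      cases hp : π i with
      | out a b =>
        rw [hp] at this
        exact fun z hz => this z (by simp [Prefix.scopeFn, hz])
      | inp a x =>
        rw [hp] at this
        have h' : ∀ z ∈ (S i).fn.erase x, σ z = τ z := fun z hz => this z
          (Finset.mem_union_right _ hz)
        simp only [Prefix.under]
        rw [newBinder_congr h']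
        exact update_eq_of_eqOn_erase _ h'
      | tau =>
        rw [hp] at this
        exact fun z hz => this z hz
  | res r P ih =>
    have h' : ∀ z ∈ P.fn.erase r, σ z = τ z := h
    simp only [Proc.subst]
    rw [newBinder_congr h']
    congr 1
    exact ih (update_eq_of_eqOn_erase _ h')
  | par P Q ihP ihQ =>
    simp only [Proc.subst]
    rw [ihP fun x hx => h x (by simp [Proc.fn, hx]), ihQ fun x hx => h x (by simp [Proc.fn, hx])]

theorem image_update_erase {σ : 𝒩 → 𝒩} {x y : 𝒩} {A : Finset 𝒩} (h : y ∉ (A.erase x).image σ) :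
    (A.image (update σ x y)).erase y = (A.erase x).image σ := by
  ext z
  simp only [Finset.mem_erase, Finset.mem_image]
  constructor
  · rintro ⟨hz, w, hw, rfl⟩
    by_cases hx : w = x
    · subst hx; simp at hz
    · exact ⟨w, ⟨hx, hw⟩, by rw [update_of_ne hx]⟩
  · rintro ⟨w, ⟨hx, hw⟩, rfl⟩
    refine ⟨?_, w, hw, by rw [update_of_ne hx]⟩
    rintro rfl
    exact h (Finset.mem_image.2 ⟨w, Finset.mem_erase.2 ⟨hx, hw⟩, rfl⟩)

theorem Proc.fn_subst (P : Proc 𝒩 PID) (σ : 𝒩 → 𝒩) : (P.subst σ).fn = P.fn.image σ := by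
  induction P generalizing σ with
  | call K args => ext; simp [Proc.subst, Proc.fn]
  | choice π S ih =>
    rw [Proc.subst_choice, Proc.fn_choice, Proc.fn_choice, Finset.biUnion_image]
    refine Finset.biUnion_congr rfl fun i _ => ?_
    rw [ih]
    cases π i with
    | out a b => simp [Prefix.sub, Prefix.under, Prefix.scopeFn, Finset.image_insert]
    | inp a x =>
      simp only [Prefix.sub, Prefix.under, Prefix.scopeFn]
      rw [image_update_erase (newBinder_notMem _ _ _), Finset.image_union, Finset.image_singleton]
    | tau => rfl
  | res r P ih =>
    simp only [Proc.subst, Proc.fn]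
    rw [ih, image_update_erase (newBinder_notMem _ _ _)]
  | par P Q ihP ihQ => simp only [Proc.subst, Proc.fn, ihP, ihQ, Finset.image_union]

theorem Proc.subst_zero (σ : 𝒩 → 𝒩) : (Proc.zero : Proc 𝒩 PID).subst σ = .zero := by
  unfold Proc.zero
  rw [Proc.subst_choice]
  congr 1 <;> exact Subsingleton.elim _ _

theorem Proc.fn_zero : (Proc.zero : Proc 𝒩 PID).fn = ∅ := by
  unfold Proc.zero
  rw [Proc.fn_choice]
  rfl

theorem single_image_erase {A : Finset 𝒩} {x x' : 𝒩} (h : x' ∉ A) :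
    (A.image (single x x')).erase x' = A.erase x := by
  unfold single
  rw [image_update_erase (by rw [Finset.image_id]; exact fun h' => h (Finset.mem_of_mem_erase h')),
    Finset.image_id]

theorem SC.fn_eq {P Q : Proc 𝒩 PID} (h : SC P Q) : P.fn = Q.fn := by
  induction h with
  | refl P => rfl
  | symm _ ih => exact ih.symm
  | trans _ _ ih₁ ih₂ => exact ih₁.trans ih₂
  | choice_congr π _ ih =>
    rw [Proc.fn_choice, Proc.fn_choice]
    exact Finset.biUnion_congr rfl fun i _ => by rw [ih i]
  | res_congr r _ ih => simp only [Proc.fn, ih]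
  | par_congr _ _ ih₁ ih₂ => simp only [Proc.fn, ih₁, ih₂]
  | alpha_res r r' P h =>
    simp only [Proc.fn]
    rw [Proc.fn_subst, single_image_erase h]
  | alpha_inp π S i a x x' hi hx =>
    rw [Proc.fn_choice, Proc.fn_choice]
    refine Finset.biUnion_congr rfl fun j _ => ?_
    by_cases hj : j = i
    · subst hj
      rw [update_self, update_self, hi, Proc.fn_subst]
      simp only [Prefix.scopeFn]
      rw [single_image_erase hx]
    · rw [update_of_ne hj, update_of_ne hj]
  | choice_reindex e π S =>
    rw [Proc.fn_choice, Proc.fn_choice]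
    ext z
    simp only [Finset.mem_biUnion, Finset.mem_univ, true_and, comp_apply]
    exact (e.surjective.exists (p := fun i => z ∈ (π i).scopeFn (S i).fn))
  | par_comm P Q => simp only [Proc.fn, Finset.union_comm]
  | par_assoc P Q R => simp only [Proc.fn, Finset.union_assoc]
  | par_zero P => simp only [Proc.fn, Proc.fn_zero, Finset.union_empty]
  | res_zero r => simp only [Proc.fn, Proc.fn_zero, Finset.erase_empty]
  | res_comm r s P => simp only [Proc.fn, Finset.erase_right_comm]
  | scope r P Q h =>
    simp only [Proc.fn]
    rw [Finset.erase_union_distrib, Finset.erase_eq_of_notMem h]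

/-- Summands that agree up to renaming of the input name and structural congruence. -/
inductive SummandEq : Prefix 𝒩 → Proc 𝒩 PID → Prefix 𝒩 → Proc 𝒩 PID → Prop
  | same (p) {S S'} : SC S S' → SummandEq p S p S'
  | inp (a) {x x' S S'} : x' ∉ S.fn → SC (S.subst (single x x')) S' →
      SummandEq (.inp a x) S (.inp a x') S'

/-- `SC.alpha_inp` converts a single summand, so the summands are replaced one after another, by
induction on the set of those already replaced. -/
theorem SC.choice_of_summandEq {m : ℕ} {π π' : Fin m → Prefix 𝒩} {S S' : Fin m → Proc 𝒩 PID}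
    (h : ∀ i, SummandEq (π i) (S i) (π' i) (S' i)) : SC (.choice π S) (.choice π' S') := by
  have key : ∀ s : Finset (Fin m),
      SC (.choice π S) (.choice (s.piecewise π' π) (s.piecewise S' S)) := by
    intro s
    induction s using Finset.induction_on with
    | empty => simpa using SC.refl _
    | insert j s hj ih =>
      refine ih.trans ?_
      rw [Finset.piecewise_insert, Finset.piecewise_insert]
      have hπ : s.piecewise π' π j = π j := by simp [hj]
      have hS : s.piecewise S' S j = S j := by simp [hj]
      generalize s.piecewise π' π = π₁ at *
      generalize s.piecewise S' S = S₁ at *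
      have congr_at : ∀ {π₂ : Fin m → Prefix 𝒩} {T : Proc 𝒩 PID}, SC T (S' j) →
          SC (.choice π₂ (update S₁ j T)) (.choice π₂ (update S₁ j (S' j))) := by
        intro π₂ T hT
        refine SC.choice_congr _ fun i => ?_
        by_cases hi : i = j
        · subst hi; simpa using hT
        · rw [update_of_ne hi, update_of_ne hi]; exact .refl _
      have hj' := h j
      rw [← hπ, ← hS] at hj'
      generalize hp' : π' j = p' at hj'
      generalize hS' : S' j = T' at hj' congr_at
      generalize hp : π₁ j = p at hj'
      generalize hT : S₁ j = T at hj'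
      cases hj' with
      | same p hsc =>
        have := congr_at (π₂ := update π₁ j (π₁ j)) hsc
        rw [← hT, update_eq_self, update_eq_self] at this
        rw [← hp, update_eq_self]
        exact this
      | inp a hx hsc =>
        exact (SC.alpha_inp π₁ S₁ j a _ _ hp (hT ▸ hx)).trans (congr_at (hT ▸ hsc))
  have := key Finset.univ
  simpa using this

theorem SummandEq.refl (p : Prefix 𝒩) (S : Proc 𝒩 PID) : SummandEq p S p S := .same p (.refl S)

theorem single_update {σ : 𝒩 → 𝒩} {x b c : 𝒩} {A : Finset 𝒩} (hb : b ∉ (A.erase x).image σ) :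
    ∀ z ∈ A, (single b c ∘ update σ x b) z = update σ x c z := by
  intro z hz
  by_cases hx : z = x
  · subst hx; simp [single]
  · have : σ z ≠ b := fun e => hb (Finset.mem_image.2 ⟨z, Finset.mem_erase.2 ⟨hx, hz⟩, e⟩)
    simp [single, update_of_ne hx, update_of_ne this]

theorem eq_of_mem_image_update {σ : 𝒩 → 𝒩} {x b c : 𝒩} {A : Finset 𝒩}
    (hc : c ∉ (A.erase x).image σ) (h : c ∈ A.image (update σ x b)) : c = b := by
  obtain ⟨z, hz, rfl⟩ := Finset.mem_image.1 h
  by_cases hx : z = x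
  · subst hx; simp
  · rw [update_of_ne hx] at hc
    exact absurd (Finset.mem_image.2 ⟨z, Finset.mem_erase.2 ⟨hx, hz⟩, rfl⟩) hc

/-- The composition law enters as a hypothesis because the lemma is needed inside the proof of that
law, where it is available for the scope `P` only, as induction hypothesis. -/
theorem SC.res_update_of_comp {P : Proc 𝒩 PID} {σ : 𝒩 → 𝒩} {r b c : 𝒩}
    (comp : ∀ σ τ : 𝒩 → 𝒩, SC ((P.subst σ).subst τ) (P.subst (τ ∘ σ)))
    (hb : b ∉ (P.fn.erase r).image σ) (hc : c ∉ (P.fn.erase r).image σ) :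
    SC (.res b (P.subst (update σ r b))) (.res c (P.subst (update σ r c))) := by
  -- Renaming `b` to `c` is an α-conversion if `c` is not free in the scope. If it is free, it can
  -- only be `b` itself.
  by_cases h : c ∈ (P.subst (update σ r b)).fn
  · rw [Proc.fn_subst] at h
    rw [eq_of_mem_image_update hc h]
    exact .refl _
  · refine (SC.alpha_res b c _ h).trans (.res_congr _ ((comp _ _).trans ?_))
    rw [Proc.subst_congr (single_update hb)]
    exact .refl _

theorem SummandEq.inp_update_of_comp {P : Proc 𝒩 PID} {σ : 𝒩 → 𝒩} {x a b c : 𝒩}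
    (comp : ∀ σ τ : 𝒩 → 𝒩, SC ((P.subst σ).subst τ) (P.subst (τ ∘ σ)))
    (hb : b ∉ (P.fn.erase x).image σ) (hc : c ∉ (P.fn.erase x).image σ) :
    SummandEq (.inp a b) (P.subst (update σ x b)) (.inp a c) (P.subst (update σ x c)) := by
  by_cases h : c ∈ (P.subst (update σ x b)).fn
  · rw [Proc.fn_subst] at h
    rw [eq_of_mem_image_update hc h]
    exact .refl _ _
  · refine .inp a h ((comp _ _).trans ?_)
    rw [Proc.subst_congr (single_update hb)]
    exact .refl _

theorem comp_update_eq {σ τ : 𝒩 → 𝒩} {x n₁ n₂ : 𝒩} {A : Finset 𝒩}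
    (h₁ : n₁ ∉ (A.erase x).image σ) :
    ∀ z ∈ A, (update τ n₁ n₂ ∘ update σ x n₁) z = update (τ ∘ σ) x n₂ z := by
  intro z hz
  by_cases hx : z = x
  · subst hx; simp
  · have : σ z ≠ n₁ := fun e => h₁ (Finset.mem_image.2 ⟨z, Finset.mem_erase.2 ⟨hx, hz⟩, e⟩)
    simp [update_of_ne hx, update_of_ne this]

theorem newBinder_subst_notMem {σ τ : 𝒩 → 𝒩} {x n₁ : 𝒩} {A : Finset 𝒩}
    (h₁ : n₁ ∉ (A.erase x).image σ) :
    newBinder τ n₁ (A.image (update σ x n₁)) ∉ (A.erase x).image (τ ∘ σ) := by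
  have := newBinder_notMem τ n₁ (A.image (update σ x n₁))
  rwa [image_update_erase h₁, Finset.image_image] at this

/-- Only a congruence: two successive substitutions may choose other fresh binders than the
composite does. Both choices avoid capture, so they differ by α-conversion. -/
theorem SC.subst_comp (P : Proc 𝒩 PID) (σ τ : 𝒩 → 𝒩) :
    SC ((P.subst σ).subst τ) (P.subst (τ ∘ σ)) := by
  induction P generalizing σ τ with
  | call K args =>
    simp only [Proc.subst, List.map_map]
    exact .refl _
  | choice π S ih =>
    rw [Proc.subst_choice, Proc.subst_choice, Proc.subst_choice]
    refine (SC.choice_congr _ fun i => ih i _ _).trans (SC.choice_of_summandEq fun i => ?_)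
    rw [Proc.fn_subst]
    cases π i with
    | out a b => exact .refl _ _
    | tau => exact .refl _ _
    | inp a x =>
      simp only [Prefix.sub, Prefix.under]
      have h₁ := newBinder_notMem σ x (S i).fn
      rw [Proc.subst_congr (comp_update_eq h₁)]
      exact SummandEq.inp_update_of_comp (ih i) (newBinder_subst_notMem h₁) (newBinder_notMem _ _ _)
  | res r P ih =>
    simp only [Proc.subst]
    rw [Proc.fn_subst]
    have h₁ := newBinder_notMem σ r P.fn
    set n₁ := newBinder σ r P.fn
    have h₂ := newBinder_subst_notMem (τ := τ) h₁
    set n₂ := newBinder τ n₁ (P.fn.image (update σ r n₁))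
    refine (SC.res_congr _ (ih _ _)).trans ?_
    rw [Proc.subst_congr (comp_update_eq h₁)]
    exact SC.res_update_of_comp ih h₂ (newBinder_notMem _ _ _)
  | par P Q ihP ihQ =>
    simp only [Proc.subst]
    exact .par_congr (ihP _ _) (ihQ _ _)

/-- `α`-conversion of a restriction below a substitution. -/
theorem SC.res_update {P : Proc 𝒩 PID} {σ : 𝒩 → 𝒩} {r b c : 𝒩}
    (hb : b ∉ (P.fn.erase r).image σ) (hc : c ∉ (P.fn.erase r).image σ) :
    SC (.res b (P.subst (update σ r b))) (.res c (P.subst (update σ r c))) :=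
  SC.res_update_of_comp (SC.subst_comp P) hb hc

theorem SC.subst_res {P : Proc 𝒩 PID} {σ : 𝒩 → 𝒩} {r b : 𝒩}
    (hb : b ∉ (P.fn.erase r).image σ) :
    SC ((Proc.res r P).subst σ) (.res b (P.subst (update σ r b))) := by
  simp only [Proc.subst]
  exact SC.res_update (newBinder_notMem _ _ _) hb

theorem SC.subst_id (P : Proc 𝒩 PID) : SC (P.subst id) P := by
  induction P with
  | call K args => simpa [Proc.subst] using SC.refl _
  | choice π S ih =>
    have hb : ∀ x A, newBinder (id : 𝒩 → 𝒩) x A = x := fun x A => by simp [newBinder]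
    rw [Proc.subst_choice]
    have h₁ : (fun i => (π i).sub id (S i).fn) = π := by
      funext i
      cases π i <;> simp [Prefix.sub, hb]
    have h₂ : ∀ i, (π i).under id (S i).fn = id := by
      intro i
      cases π i <;> simp [Prefix.under, hb]
    rw [h₁]
    exact .choice_congr _ fun i => by rw [h₂]; exact ih i
  | res r P ih =>
    refine (SC.subst_res (b := r) (by simp)).trans (.res_congr r ?_)
    rwa [show update (id : 𝒩 → 𝒩) r r = id from update_eq_self r id]
  | par P Q ihP ihQ => exact .par_congr ihP ihQ

theorem update_comp_single {σ : 𝒩 → 𝒩} {x x' b : 𝒩} {A : Finset 𝒩} (h : x' ∉ A) :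
    ∀ z ∈ A, (update σ x' b ∘ single x x') z = update σ x b z := by
  intro z hz
  by_cases hx : z = x
  · subst hx; simp [single]
  · have : z ≠ x' := fun e => h (e ▸ hz)
    simp [single, update_of_ne hx, update_of_ne this]

/-- Each law survives a substitution because `SC.subst_res` allows any uncaptured binder to be used
in place of the one chosen by `newBinder`. Both sides of a law can thus be given the same binder. -/
theorem SC.subst {P Q : Proc 𝒩 PID} (h : SC P Q) (σ : 𝒩 → 𝒩) :
    SC (P.subst σ) (Q.subst σ) := by
  induction h generalizing σ with
  | refl P => exact .refl _
  | symm _ ih => exact (ih σ).symm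
  | trans _ _ ih₁ ih₂ => exact (ih₁ σ).trans (ih₂ σ)
  | choice_congr π h ih =>
    rw [Proc.subst_choice, Proc.subst_choice]
    simp only [fun i => (h i).fn_eq]
    exact .choice_congr _ fun i => ih i _
  | @res_congr r P P' h ih =>
    simp only [Proc.subst, h.fn_eq]
    exact .res_congr _ (ih _)
  | par_congr _ _ ih₁ ih₂ => exact .par_congr (ih₁ σ) (ih₂ σ)
  | alpha_res r r' P h =>
    have hb := newBinder_notMem σ r P.fn
    refine (SC.subst_res hb).trans (SC.symm ?_)
    refine (SC.subst_res (b := newBinder σ r P.fn) ?_).trans (.res_congr _ ?_)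
    · rwa [Proc.fn_subst, single_image_erase h]
    · rw [← Proc.subst_congr (update_comp_single h)]
      exact SC.subst_comp _ _ _
  | @alpha_inp m π S i a x x' hi hx =>
    have hn := newBinder_notMem σ x' ((S i).subst (single x x')).fn
    rw [Proc.fn_subst, single_image_erase hx] at hn
    -- The converted choice is brought to a form in which the continuation is a substitution
    -- instance of the original `S i`. It then differs from the other side only by the choice of the
    -- input name.
    have hS : SC (Proc.choice ((update π i (.inp a x')))
        (update S i ((S i).subst (single x x'))) |>.subst σ)
        (.choice (update (fun j => (π j).sub σ (S j).fn) i
          (.inp (σ a) (newBinder σ x' ((S i).fn.image (single x x')))))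
          (update (fun j => (S j).subst ((π j).under σ (S j).fn)) i ((S i).subst
            (update σ x (newBinder σ x' ((S i).fn.image (single x x'))))))) := by
      rw [Proc.subst_choice]
      refine SC.choice_of_summandEq fun j => ?_
      by_cases hj : j = i
      · subst hj
        simp only [update_self, Prefix.sub, Prefix.under, Proc.fn_subst]
        refine .same _ ?_
        rw [← Proc.subst_congr (update_comp_single hx)]
        exact SC.subst_comp _ _ _
      · simp only [update_of_ne hj]
        exact .refl _ _
    refine SC.trans ?_ hS.symm
    rw [Proc.subst_choice]
    refine SC.choice_of_summandEq fun j => ?_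
    by_cases hj : j = i
    · subst hj
      simp only [update_self, hi, Prefix.sub, Prefix.under]
      exact SummandEq.inp_update_of_comp (SC.subst_comp _) (newBinder_notMem _ _ _) hn
    · simp only [update_of_ne hj]
      exact .refl _ _
  | choice_reindex e π S =>
    rw [Proc.subst_choice, Proc.subst_choice]
    exact .choice_reindex e _ _
  | par_comm P Q => exact .par_comm _ _
  | par_assoc P Q R => exact .par_assoc _ _ _
  | par_zero P =>
    simp only [Proc.subst, Proc.subst_zero]
    exact .par_zero _
  | res_zero r =>
    simp only [Proc.subst, Proc.subst_zero]
    exact .res_zero _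
  | res_comm r s P =>
    by_cases hrs : r = s
    · subst hrs; exact .refl _
    -- Two distinct names outside the whole image are legitimate binders whichever restriction is
    -- pushed down first.
    obtain ⟨b, hb⟩ := Infinite.exists_notMem_finset (P.fn.image σ)
    obtain ⟨c, hc⟩ := Infinite.exists_notMem_finset (insert b (P.fn.image σ))
    rw [Finset.mem_insert, not_or] at hc
    have key : ∀ r s b c : 𝒩, b ≠ c → b ∉ P.fn.image σ → c ∉ P.fn.image σ →
        SC ((Proc.res r (.res s P)).subst σ)
          (.res b (.res c (P.subst (update (update σ r b) s c)))) := by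
      intro r s b c hbc hb hc
      have hmem : ∀ {τ : 𝒩 → 𝒩} {A B : Finset 𝒩} {z : 𝒩}, B ⊆ A → z ∉ A.image τ → z ∉ B.image τ :=
        fun h h' h'' => h' (Finset.image_subset_image h h'')
      refine (SC.subst_res (b := b) (hmem ?_ hb)).trans
        (.res_congr _ (SC.subst_res (b := c) (hmem (Finset.erase_subset _ _) ?_)))
      · exact (Finset.erase_subset _ _).trans (Finset.erase_subset _ _)
      · intro h
        obtain ⟨z, hz, rfl⟩ := Finset.mem_image.1 h
        by_cases hr : z = r
        · subst hr; simp at hbc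
        · rw [update_of_ne hr] at hc
          exact hc (Finset.mem_image_of_mem _ hz)
    refine (key r s b c (Ne.symm hc.1) hb hc.2).trans ?_
    refine SC.trans ?_ (key s r c b hc.1 hc.2 hb).symm
    rw [update_comm hrs]
    exact .res_comm _ _ _
  | scope r P Q h =>
    obtain ⟨b, hb⟩ := Infinite.exists_notMem_finset ((P.fn ∪ Q.fn).image σ)
    have hP : P.subst (update σ r b) = P.subst σ := Proc.subst_congr fun x hx =>
      update_of_ne (by rintro rfl; exact h hx) _ _
    refine (SC.subst_res (b := b) fun h' => hb ?_).trans ?_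
    · exact Finset.image_subset_image (Finset.erase_subset _ _) h'
    · simp only [Proc.subst, hP]
      refine (SC.scope b _ _ ?_).trans (.par_congr (.refl _) (SC.subst_res ?_).symm)
      · rw [Proc.fn_subst]
        exact fun h' => hb (Finset.image_subset_image Finset.subset_union_left h')
      · exact fun h' => hb (Finset.image_subset_image
          ((Finset.erase_subset _ _).trans Finset.subset_union_right) h')

end Substitution
/-! # Processes modulo structural congruence -/

section Classes

variable {𝒩 PID : Type*} [LinearOrder 𝒩] [Infinite 𝒩]

/-- Processes modulo structural congruence. -/
abbrev Cls (𝒩 PID : Type*) [LinearOrder 𝒩] [Infinite 𝒩] := Quotient (scSetoid 𝒩 PID)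

/-- The class of a process. -/
def Proc.cls (P : Proc 𝒩 PID) : Cls 𝒩 PID := Quotient.mk _ P

theorem Proc.cls_eq {P Q : Proc 𝒩 PID} : P.cls = Q.cls ↔ SC P Q := Quotient.eq

namespace Cls

/-- Free names of a class. -/
def fn : Cls 𝒩 PID → Finset 𝒩 := Quotient.lift Proc.fn fun _ _ h => SC.fn_eq h

/-- Restriction of a class. -/
def res (r : 𝒩) : Cls 𝒩 PID → Cls 𝒩 PID := Quotient.map (.res r) fun _ _ h => SC.res_congr r h

instance : Add (Cls 𝒩 PID) :=
  ⟨Quotient.map₂ .par fun _ _ h _ _ h' => SC.par_congr h h'⟩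

instance : Zero (Cls 𝒩 PID) := ⟨Proc.zero.cls⟩

instance : AddCommMonoid (Cls 𝒩 PID) where
  add_assoc := by rintro ⟨P⟩ ⟨Q⟩ ⟨R⟩; exact Quotient.sound (.par_assoc P Q R)
  add_comm := by rintro ⟨P⟩ ⟨Q⟩; exact Quotient.sound (.par_comm P Q)
  add_zero := by rintro ⟨P⟩; exact Quotient.sound (.par_zero P)
  zero_add := by rintro ⟨P⟩; exact Quotient.sound ((SC.par_comm _ _).trans (.par_zero P))
  nsmul := nsmulRec

@[simp] theorem fn_cls (P : Proc 𝒩 PID) : P.cls.fn = P.fn := rfl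

theorem cls_par (P Q : Proc 𝒩 PID) : (Proc.par P Q).cls = P.cls + Q.cls := rfl

theorem cls_zero : (Proc.zero : Proc 𝒩 PID).cls = 0 := rfl

@[simp] theorem fn_add (p q : Cls 𝒩 PID) : (p + q).fn = p.fn ∪ q.fn := by
  induction p using Quotient.inductionOn
  induction q using Quotient.inductionOn
  rfl

@[simp] theorem fn_zero : (0 : Cls 𝒩 PID).fn = ∅ := Proc.fn_zero

@[simp] theorem fn_res (r : 𝒩) (q : Cls 𝒩 PID) : (res r q).fn = q.fn.erase r := by
  induction q using Quotient.inductionOn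
  rfl

theorem res_comm (r s : 𝒩) (q : Cls 𝒩 PID) : res r (res s q) = res s (res r q) := by
  induction q using Quotient.inductionOn
  exact Quotient.sound (SC.res_comm _ _ _)

theorem res_add {r : 𝒩} {p : Cls 𝒩 PID} (q : Cls 𝒩 PID) (h : r ∉ p.fn) :
    res r (p + q) = p + res r q := by
  induction p using Quotient.inductionOn
  induction q using Quotient.inductionOn
  exact Quotient.sound (SC.scope _ _ _ h)

theorem res_zero (r : 𝒩) : res r (0 : Cls 𝒩 PID) = 0 := Quotient.sound (SC.res_zero r)

/-- Garbage collection of a vacuous restriction is scope extrusion across the stop process. -/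
theorem res_of_notMem {r : 𝒩} {q : Cls 𝒩 PID} (h : r ∉ q.fn) : res r q = q := by
  have := res_add 0 h
  rwa [res_zero, add_zero] at this

instance : LeftCommutative (res : 𝒩 → Cls 𝒩 PID → Cls 𝒩 PID) := ⟨res_comm⟩

/-- Restriction of a finite set of names. -/
def nu (X : Finset 𝒩) (q : Cls 𝒩 PID) : Cls 𝒩 PID := X.val.foldr res q

@[simp] theorem nu_empty (q : Cls 𝒩 PID) : nu ∅ q = q := rfl

theorem nu_insert {a : 𝒩} {X : Finset 𝒩} (h : a ∉ X) (q : Cls 𝒩 PID) :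
    nu (insert a X) q = res a (nu X q) := by
  rw [nu, Finset.insert_val_of_notMem h, Multiset.foldr_cons]
  rfl

theorem nu_res (a : 𝒩) (X : Finset 𝒩) (q : Cls 𝒩 PID) : nu X (res a q) = res a (nu X q) := by
  induction X using Finset.induction_on with
  | empty => rfl
  | insert b X hb ih => rw [nu_insert hb, nu_insert hb, ih, res_comm]

/-- The inner restriction makes the outer one vacuous. `sem` restricts every name `g k` from the
start, so it can absorb the restriction that a thread opens. -/
theorem nu_res_of_mem {a : 𝒩} {X : Finset 𝒩} (h : a ∈ X) (q : Cls 𝒩 PID) :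
    nu X (res a q) = nu X q := by
  rw [← Finset.insert_erase h, nu_insert (Finset.notMem_erase a X),
    nu_insert (Finset.notMem_erase a X), nu_res, res_of_notMem]
  simp

@[simp] theorem fn_nu (X : Finset 𝒩) (q : Cls 𝒩 PID) : (nu X q).fn = q.fn \ X := by
  induction X using Finset.induction_on with
  | empty => simp
  | insert a X h ih =>
    rw [nu_insert h, fn_res, ih]
    ext; simp; tauto

theorem nu_inter_fn (X : Finset 𝒩) (q : Cls 𝒩 PID) : nu (X ∩ q.fn) q = nu X q := by
  induction X using Finset.induction_on with
  | empty => simp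
  | insert a X h ih =>
    rw [nu_insert h, ← ih]
    by_cases ha : a ∈ q.fn
    · rw [Finset.insert_inter_of_mem ha, nu_insert fun h' => h (Finset.mem_inter.1 h').1]
    · rw [Finset.insert_inter_of_notMem ha, res_of_notMem]
      simp [ha]

/-- Restrictions of names that are not free are vacuous, so only the trace on the free names counts.
-/
theorem nu_congr {X Y : Finset 𝒩} {q : Cls 𝒩 PID} (h : ∀ a ∈ q.fn, a ∈ X ↔ a ∈ Y) :
    nu X q = nu Y q := by
  rw [← nu_inter_fn X, ← nu_inter_fn Y]
  congr 1
  ext a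
  simp only [Finset.mem_inter]
  exact ⟨fun ⟨h₁, h₂⟩ => ⟨(h a h₂).1 h₁, h₂⟩, fun ⟨h₁, h₂⟩ => ⟨(h a h₂).2 h₁, h₂⟩⟩

theorem nu_add {X : Finset 𝒩} {p : Cls 𝒩 PID} (q : Cls 𝒩 PID) (h : Disjoint X p.fn) :
    nu X (p + q) = p + nu X q := by
  induction X using Finset.induction_on with
  | empty => rfl
  | insert a X ha ih =>
    rw [Finset.disjoint_insert_left] at h
    rw [nu_insert ha, nu_insert ha, ih h.2, res_add _ h.1]

theorem nu_union {X Y : Finset 𝒩} (h : Disjoint X Y) (q : Cls 𝒩 PID) :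
    nu (X ∪ Y) q = nu X (nu Y q) := by
  induction X using Finset.induction_on with
  | empty => simp
  | insert a X ha ih =>
    rw [Finset.disjoint_insert_left] at h
    rw [Finset.insert_union, nu_insert ha, nu_insert, ih h.2]
    simp [ha, h.1]

theorem nu_add_nu {X Y : Finset 𝒩} {p q : Cls 𝒩 PID} (h : Disjoint X Y) (hX : Disjoint X q.fn)
    (hY : Disjoint Y p.fn) : nu (X ∪ Y) (p + q) = nu X p + nu Y q := by
  rw [nu_union h, nu_add q hY, add_comm, nu_add, add_comm]
  rw [fn_nu]
  exact hX.mono_right Finset.sdiff_subset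

theorem fn_multiset_sum (M : Multiset (Cls 𝒩 PID)) {a : 𝒩} :
    a ∈ M.sum.fn ↔ ∃ q ∈ M, a ∈ q.fn := by
  induction M using Multiset.induction_on with
  | empty => simp
  | cons q M ih => simp [ih]

theorem fn_sum {ι : Type*} (s : Finset ι) (f : ι → Cls 𝒩 PID) {a : 𝒩} :
    a ∈ (∑ i ∈ s, f i).fn ↔ ∃ i ∈ s, a ∈ (f i).fn := by
  rw [Finset.sum, fn_multiset_sum]
  simp

end Cls

open Function

theorem Proc.cls_subst_comp (P : Proc 𝒩 PID) (σ τ : 𝒩 → 𝒩) :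
    ((P.subst σ).subst τ).cls = (P.subst (τ ∘ σ)).cls := Proc.cls_eq.2 (SC.subst_comp P σ τ)

theorem Proc.cls_subst_id (P : Proc 𝒩 PID) : (P.subst id).cls = P.cls :=
  Proc.cls_eq.2 (SC.subst_id P)

theorem Proc.cls_subst_res {P : Proc 𝒩 PID} {σ : 𝒩 → 𝒩} {r b : 𝒩}
    (hb : b ∉ (P.fn.erase r).image σ) :
    ((Proc.res r P).subst σ).cls = Cls.res b (P.subst (update σ r b)).cls :=
  Proc.cls_eq.2 (SC.subst_res hb)

theorem Proc.cls_prod (Ps : List (Proc 𝒩 PID)) : (Proc.prod Ps).cls = (Ps.map Proc.cls).sum := by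
  induction Ps with
  | nil => rfl
  | cons P Ps ih => rw [Proc.prod, Cls.cls_par, ih, List.map_cons, List.sum_cons]

theorem Proc.cls_resList {rs : List 𝒩} (h : rs.Nodup) (P : Proc 𝒩 PID) :
    (Proc.resList rs P).cls = Cls.nu rs.toFinset P.cls := by
  induction rs with
  | nil => rfl
  | cons r rs ih =>
    rw [List.nodup_cons] at h
    rw [List.toFinset_cons, Cls.nu_insert (by simpa using h.1), ← ih h.2]
    rfl

theorem Proc.cls_standardForm {n : ℕ} {rs : List 𝒩} (h : rs.Nodup) (S : Fin n → Proc 𝒩 PID)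
    (σ : Fin n → 𝒩 → 𝒩) :
    (Spec.standardForm rs S σ).cls = Cls.nu rs.toFinset (∑ i, ((S i).subst (σ i)).cls) := by
  rw [Spec.standardForm, Proc.cls_resList h, Proc.cls_prod, List.map_ofFn, List.sum_ofFn]
  rfl

end Classes

/-! # Flattening of processes -/

section Flattening

variable {𝒩 PID : Type*} [LinearOrder 𝒩] [Infinite 𝒩]

open Function

/-- Summands of a choice with continuations from `C`; the continuation of an input is a function of
the received name. -/
inductive Summand (𝒩 C : Type*) where
  | tau (q : C)
  | out (a b : 𝒩) (q : C)
  | inp (a : 𝒩) (f : 𝒩 → C)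

/-- The possible behaviours of a call or of a choice. -/
inductive Redex (𝒩 PID : Type*) [LinearOrder 𝒩] [Infinite 𝒩] where
  | call (K : PID) (args : List 𝒩)
  | choice (s : Set (Summand 𝒩 (Cls 𝒩 PID)))

/-- The summand given by a prefix and a continuation under a substitution. -/
noncomputable def Prefix.summand (S : Proc 𝒩 PID) (ρ : 𝒩 → 𝒩) : Prefix 𝒩 → Summand 𝒩 (Cls 𝒩 PID)
  | .out a b => .out (ρ a) (ρ b) (S.subst ρ).cls
  | .inp a x => .inp (ρ a) fun z => (S.subst (update ρ x z)).cls
  | .tau => .tau (S.subst ρ).cls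

/-- The behaviour of a call or of a choice under a substitution. -/
noncomputable def Proc.redex : Proc 𝒩 PID → (𝒩 → 𝒩) → Redex 𝒩 PID
  | .call K args, ρ => .call K (args.map ρ)
  | .choice π S, ρ => .choice (Set.range fun i => (π i).summand (S i) ρ)
  | _, _ => .choice ∅

/-- The class of a process under a substitution, with its behaviour. -/
noncomputable def Proc.atom (P : Proc 𝒩 PID) (ρ : 𝒩 → 𝒩) : Cls 𝒩 PID × Redex 𝒩 PID :=
  ((P.subst ρ).cls, P.redex ρ)

/-- `Flat P ρ X M`: if the unguarded restrictions of `P` are instantiated by the distinct names of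
`X` and the free names by `ρ`, then `M` are the unguarded calls and non-empty choices of `P`. -/
def Flat : Proc 𝒩 PID → (𝒩 → 𝒩) → Finset 𝒩 → Multiset (Cls 𝒩 PID × Redex 𝒩 PID) → Prop
  | .call K args, ρ, X, M => X = ∅ ∧ M = {(Proc.call K args).atom ρ}
  | .choice (m := m) π S, ρ, X, M => X = ∅ ∧ M = if m = 0 then 0 else {(Proc.choice π S).atom ρ}
  | .res r P, ρ, X, M => ∃ a Y, a ∉ Y ∧ X = insert a Y ∧ Flat P (update ρ r a) Y M
  | .par P Q, ρ, X, M => ∃ X₁ X₂ M₁ M₂, Disjoint X₁ X₂ ∧ X = X₁ ∪ X₂ ∧ M = M₁ + M₂ ∧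
      Flat P ρ X₁ M₁ ∧ Flat Q ρ X₂ M₂

theorem Prefix.summand_congr {S : Proc 𝒩 PID} {ρ ρ' : 𝒩 → 𝒩} {p : Prefix 𝒩}
    (h : ∀ x ∈ p.scopeFn S.fn, ρ x = ρ' x) : p.summand S ρ = p.summand S ρ' := by
  cases p with
  | out a b =>
    simp only [summand]
    rw [h a (by simp [scopeFn]), h b (by simp [scopeFn]),
      Proc.subst_congr fun x hx => h x (by simp [scopeFn, hx])]
  | inp a x =>
    simp only [summand]
    rw [h a (by simp [scopeFn])]
    congr 1
    funext z
    rw [Proc.subst_congr (update_eq_of_eqOn_erase z fun y hy => h y (Finset.mem_union_right _ hy))]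
  | tau =>
    simp only [summand]
    rw [Proc.subst_congr fun x hx => h x hx]

theorem Proc.atom_congr {P : Proc 𝒩 PID} {ρ ρ' : 𝒩 → 𝒩} (h : ∀ x ∈ P.fn, ρ x = ρ' x) :
    P.atom ρ = P.atom ρ' := by
  unfold atom
  rw [Proc.subst_congr h]
  congr 1
  cases P with
  | call K args =>
    simp only [redex]
    congr 1
    exact List.map_congr_left fun x hx => h x (by simpa [Proc.fn] using hx)
  | choice π S =>
    simp only [redex]
    congr 2
    funext i
    exact Prefix.summand_congr fun x hx => h x (Proc.scopeFn_subset π S i hx)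
  | _ => rfl

theorem Flat.congr {P : Proc 𝒩 PID} {ρ ρ' : 𝒩 → 𝒩} (h : ∀ x ∈ P.fn, ρ x = ρ' x) :
    Flat P ρ = Flat P ρ' := by
  induction P generalizing ρ ρ' with
  | call K args =>
    funext X M
    simp only [Flat, Proc.atom_congr h]
  | choice π S =>
    funext X M
    simp only [Flat, Proc.atom_congr h]
  | res r P ih =>
    funext X M
    simp only [Flat]
    simp only [fun a => ih (update_eq_of_eqOn_erase a h)]
  | par P Q ihP ihQ =>
    funext X M
    simp only [Flat]
    rw [ihP fun x hx => h x (by simp [Proc.fn, hx]), ihQ fun x hx => h x (by simp [Proc.fn, hx])]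

theorem Proc.atom_subst_call (K : PID) (args : List 𝒩) (σ ρ : 𝒩 → 𝒩) :
    (Proc.call K (args.map σ)).atom ρ = (Proc.call K args).atom (ρ ∘ σ) := by
  simp [atom, redex, Proc.subst]

theorem Proc.atom_subst_choice {m : ℕ} (π : Fin m → Prefix 𝒩) (S : Fin m → Proc 𝒩 PID)
    (σ ρ : 𝒩 → 𝒩) :
    ((Proc.choice π S).subst σ).atom ρ = (Proc.choice π S).atom (ρ ∘ σ) := by
  refine Prod.ext (Proc.cls_subst_comp _ _ _) ?_
  rw [Proc.subst_choice]
  simp only [atom, redex]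
  congr 2
  funext i
  cases π i with
  | out a b => simp [Prefix.sub, Prefix.under, Prefix.summand, Proc.cls_subst_comp]
  | inp a x =>
    simp only [Prefix.sub, Prefix.under, Prefix.summand]
    congr 1
    funext z
    rw [Proc.cls_subst_comp, Proc.subst_congr (comp_update_eq (newBinder_notMem _ _ _))]
  | tau => simp [Prefix.sub, Prefix.under, Prefix.summand, Proc.cls_subst_comp]

/-- `Flat` instantiates a restriction by every possible name and an input continuation by every
received name. The binders picked by the substitution therefore leave no trace, and an equality
holds where `SC.subst_comp` gives only a congruence. -/
theorem Flat.subst (P : Proc 𝒩 PID) (σ ρ : 𝒩 → 𝒩) : Flat (P.subst σ) ρ = Flat P (ρ ∘ σ) := by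
  induction P generalizing σ ρ with
  | call K args =>
    funext X M
    simp only [Proc.subst, Flat, Proc.atom_subst_call]
  | choice π S =>
    funext X M
    have := Proc.atom_subst_choice π S σ ρ
    rw [Proc.subst_choice] at this ⊢
    simp only [Flat, this]
  | res r P ih =>
    funext X M
    simp only [Proc.subst, Flat, ih]
    simp only [fun a => Flat.congr (comp_update_eq (τ := ρ) (n₂ := a) (newBinder_notMem σ r P.fn))]
  | par P Q ihP ihQ =>
    funext X M
    simp only [Proc.subst, Flat, ihP, ihQ]

theorem Flat.zero {ρ : 𝒩 → 𝒩} {X : Finset 𝒩} {M : Multiset (Cls 𝒩 PID × Redex 𝒩 PID)} :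
    Flat Proc.zero ρ X M ↔ X = ∅ ∧ M = 0 := by
  simp [Proc.zero, Flat]

/-- Every flattening of `P` gives a flattening of `Q` with the same components and with restricted
names that are the same up to names from outside of any given finite set. -/
def FlatLe (P Q : Proc 𝒩 PID) : Prop :=
  ∀ ρ X M, Flat P ρ X M → ∀ A : Finset 𝒩, ∃ Y, Flat Q ρ Y M ∧ Disjoint (Y \ X) A

theorem FlatLe.of_imp {P Q : Proc 𝒩 PID} (h : ∀ ρ X M, Flat P ρ X M → Flat Q ρ X M) :
    FlatLe P Q := fun ρ X M hP A => ⟨X, h ρ X M hP, by simp⟩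

theorem FlatLe.of_eq {P Q : Proc 𝒩 PID} (h : ∀ ρ, Flat P ρ = Flat Q ρ) :
    FlatLe P Q ∧ FlatLe Q P :=
  ⟨.of_imp fun ρ X M => by rw [h]; exact id, .of_imp fun ρ X M => by rw [h]; exact id⟩

theorem FlatLe.trans {P Q R : Proc 𝒩 PID} (h₁ : FlatLe P Q) (h₂ : FlatLe Q R) : FlatLe P R := by
  intro ρ X M hP A
  obtain ⟨Y, hY, hYX⟩ := h₁ ρ X M hP A
  obtain ⟨Z, hZ, hZY⟩ := h₂ ρ Y M hY A
  refine ⟨Z, hZ, (hZY.sup_left hYX).mono_left ?_⟩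
  intro a
  simp only [Finset.sup_eq_union, Finset.mem_union, Finset.mem_sdiff]
  tauto

theorem FlatLe.res (r : 𝒩) {P Q : Proc 𝒩 PID} (h : FlatLe P Q) : FlatLe (.res r P) (.res r Q) := by
  rintro ρ _ M ⟨a, X, ha, rfl, hP⟩ A
  -- New names must also avoid `a`, which instantiates the outer restriction.
  obtain ⟨Y, hY, hYX⟩ := h _ X M hP (insert a A)
  rw [Finset.disjoint_insert_right] at hYX
  refine ⟨insert a Y, ⟨a, Y, ?_, rfl, hY⟩, hYX.2.mono_left ?_⟩
  · simpa [ha] using hYX.1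
  · intro b
    simp only [Finset.mem_sdiff, Finset.mem_insert]
    tauto

theorem FlatLe.par {P P' Q Q' : Proc 𝒩 PID} (hP : FlatLe P P') (hQ : FlatLe Q Q') :
    FlatLe (.par P Q) (.par P' Q') := by
  rintro ρ _ _ ⟨X₁, X₂, M₁, M₂, hX, rfl, rfl, h₁, h₂⟩ A
  -- The new names on the left avoid the old names on the right, and the new names on the right
  -- avoid all names on the left. The two sets therefore remain disjoint.
  obtain ⟨Y₁, hY₁, hd₁⟩ := hP _ _ _ h₁ (A ∪ X₂)
  obtain ⟨Y₂, hY₂, hd₂⟩ := hQ _ _ _ h₂ (A ∪ Y₁)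
  rw [Finset.disjoint_left] at hd₁ hd₂ hX
  simp only [Finset.mem_sdiff, Finset.mem_union] at hd₁ hd₂
  refine ⟨_, ⟨Y₁, Y₂, M₁, M₂, ?_, rfl, rfl, hY₁, hY₂⟩, ?_⟩
  · rw [Finset.disjoint_left]
    intro a h₁ h₂
    have := @hd₁ a
    have := @hd₂ a
    have := @hX a
    tauto
  · rw [Finset.disjoint_left]
    intro a
    simp only [Finset.mem_sdiff, Finset.mem_union]
    have := @hd₁ a
    have := @hd₂ a
    tauto

theorem Flat.choice_eq_of_atom_eq {m : ℕ} {π π' : Fin m → Prefix 𝒩} {S S' : Fin m → Proc 𝒩 PID}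
    (hsc : SC (.choice π S) (.choice π' S'))
    (h : ∀ i ρ, (π i).summand (S i) ρ = (π' i).summand (S' i) ρ) (ρ : 𝒩 → 𝒩) :
    Flat (.choice π S) ρ = Flat (.choice π' S') ρ := by
  have : (Proc.choice π S).atom ρ = (Proc.choice π' S').atom ρ := by
    refine Prod.ext (Proc.cls_eq.2 (hsc.subst ρ)) ?_
    simp only [Proc.atom, Proc.redex, h]
  funext X M
  simp only [Flat, this]

/-- Every law except `νr.0 ≡ 0` preserves flattenings exactly, including the set of restricted
names. That single law is the reason why `FlatLe` tolerates a change of this set. -/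
theorem SC.flatLe {P Q : Proc 𝒩 PID} (h : SC P Q) : FlatLe P Q ∧ FlatLe Q P := by
  induction h with
  | refl P => exact FlatLe.of_eq fun _ => rfl
  | symm _ ih => exact ih.symm
  | trans _ _ ih₁ ih₂ => exact ⟨ih₁.1.trans ih₂.1, ih₂.2.trans ih₁.2⟩
  | choice_congr π h ih =>
    refine FlatLe.of_eq (Flat.choice_eq_of_atom_eq (.choice_congr _ h) fun i ρ => ?_)
    have : ∀ σ, _ := fun σ => Proc.cls_eq.2 ((h i).subst σ)
    cases π i <;> simp only [Prefix.summand, this]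
  | res_congr r _ ih => exact ⟨ih.1.res r, ih.2.res r⟩
  | par_congr _ _ ih₁ ih₂ => exact ⟨ih₁.1.par ih₂.1, ih₁.2.par ih₂.2⟩
  | alpha_res r r' P h =>
    refine FlatLe.of_eq fun ρ => ?_
    funext X M
    simp only [Flat, Flat.subst, fun a => Flat.congr (update_comp_single (σ := ρ) (b := a) (x := r) h)]
  | @alpha_inp m π S i a x x' hi hx =>
    refine FlatLe.of_eq (Flat.choice_eq_of_atom_eq (.alpha_inp π S i a x x' hi hx) fun j ρ => ?_)
    by_cases hj : j = i
    · subst hj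
      rw [update_self, update_self, hi]
      simp only [Prefix.summand]
      congr 1
      funext z
      rw [Proc.cls_subst_comp, Proc.subst_congr (update_comp_single hx)]
    · rw [update_of_ne hj, update_of_ne hj]
  | @choice_reindex m m' e π S =>
    -- Empty choices have no components, so the two choices must be known to have equally many
    -- summands. Beyond that only the range of the summands matters.
    obtain rfl : m' = m := by simpa using Fintype.card_congr e
    have : ∀ ρ, (Proc.choice π S).atom ρ = (Proc.choice (π ∘ e) (S ∘ e)).atom ρ := by
      intro ρ
      refine Prod.ext (Proc.cls_eq.2 ((SC.choice_reindex e π S).subst ρ)) ?_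
      simp only [Proc.atom, Proc.redex]
      congr 1
      exact (e.surjective.range_comp fun i => (π i).summand (S i) ρ).symm
    refine FlatLe.of_eq fun ρ => ?_
    funext X M
    simp only [Flat, this]
  | par_comm P Q =>
    have : ∀ P Q : Proc 𝒩 PID, FlatLe (.par P Q) (.par Q P) := fun P Q => .of_imp <| by
      rintro ρ _ _ ⟨X₁, X₂, M₁, M₂, hX, rfl, rfl, h₁, h₂⟩
      exact ⟨X₂, X₁, M₂, M₁, hX.symm, Finset.union_comm _ _, add_comm _ _, h₂, h₁⟩
    exact ⟨this _ _, this _ _⟩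
  | par_assoc P Q R =>
    constructor
    · refine .of_imp ?_
      rintro ρ _ _ ⟨_, X₃, _, M₃, hX, rfl, rfl, ⟨X₁, X₂, M₁, M₂, hX', rfl, rfl, h₁, h₂⟩, h₃⟩
      rw [Finset.disjoint_union_left] at hX
      exact ⟨X₁, X₂ ∪ X₃, M₁, M₂ + M₃, Finset.disjoint_union_right.2 ⟨hX', hX.1⟩,
        Finset.union_assoc _ _ _, add_assoc _ _ _, h₁, X₂, X₃, M₂, M₃, hX.2, rfl, rfl, h₂, h₃⟩
    · refine .of_imp ?_
      rintro ρ _ _ ⟨X₁, _, M₁, _, hX, rfl, rfl, h₁, X₂, X₃, M₂, M₃, hX', rfl, rfl, h₂, h₃⟩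
      rw [Finset.disjoint_union_right] at hX
      exact ⟨X₁ ∪ X₂, X₃, M₁ + M₂, M₃, Finset.disjoint_union_left.2 ⟨hX.2, hX'⟩,
        (Finset.union_assoc _ _ _).symm, (add_assoc _ _ _).symm,
        ⟨X₁, X₂, M₁, M₂, hX.1, rfl, rfl, h₁, h₂⟩, h₃⟩
  | par_zero P =>
    constructor
    · refine .of_imp ?_
      rintro ρ _ _ ⟨X₁, X₂, M₁, M₂, hX, rfl, rfl, h₁, h₂⟩
      obtain ⟨rfl, rfl⟩ := Flat.zero.1 h₂
      simpa using h₁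
    · refine .of_imp fun ρ X M h => ?_
      exact ⟨X, ∅, M, 0, by simp, by simp, by simp, h, Flat.zero.2 ⟨rfl, rfl⟩⟩
  | res_zero r =>
    constructor
    · rintro ρ _ M ⟨a, X, ha, rfl, h⟩ A
      exact ⟨∅, Flat.zero.2 ⟨rfl, (Flat.zero.1 h).2⟩, by simp⟩
    · intro ρ X M h A
      obtain ⟨rfl, rfl⟩ := Flat.zero.1 h
      -- The restriction that appears out of nothing is instantiated by a name outside the
      -- prescribed finite set.
      obtain ⟨a, ha⟩ := Infinite.exists_notMem_finset A
      exact ⟨{a}, ⟨a, ∅, by simp, rfl, Flat.zero.2 ⟨rfl, rfl⟩⟩, by simpa using ha⟩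
  | res_comm r s P =>
    have : ∀ r s : 𝒩, FlatLe (.res r (.res s P)) (.res s (.res r P)) := fun r s => by
      by_cases hrs : r = s
      · subst hrs; exact .of_imp fun _ _ _ => id
      refine .of_imp ?_
      rintro ρ _ M ⟨a, _, ha, rfl, b, X, hb, rfl, h⟩
      rw [Finset.mem_insert, not_or] at ha
      rw [update_comm hrs] at h
      refine ⟨b, insert a X, ?_, Finset.insert_comm _ _ _, a, X, ha.2, rfl, h⟩
      rw [Finset.mem_insert, not_or]
      exact ⟨Ne.symm ha.1, hb⟩
    exact ⟨this _ _, this _ _⟩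
  | scope r P Q h =>
    have hP : ∀ ρ a, Flat P (update ρ r a) = Flat P ρ := fun ρ a =>
      Flat.congr fun x hx => update_of_ne (by rintro rfl; exact h hx) _ _
    constructor
    · refine .of_imp ?_
      rintro ρ _ _ ⟨a, _, ha, rfl, X₁, X₂, M₁, M₂, hX, rfl, rfl, h₁, h₂⟩
      rw [Finset.mem_union, not_or] at ha
      exact ⟨X₁, insert a X₂, M₁, M₂, Finset.disjoint_insert_right.2 ⟨ha.1, hX⟩,
        (Finset.union_insert _ _ _).symm, rfl, hP ρ a ▸ h₁, a, X₂, ha.2, rfl, h₂⟩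
    · refine .of_imp ?_
      rintro ρ _ _ ⟨X₁, _, M₁, M₂, hX, rfl, rfl, h₁, a, X₂, ha, rfl, h₂⟩
      rw [Finset.disjoint_insert_right] at hX
      refine ⟨a, X₁ ∪ X₂, ?_, Finset.union_insert _ _ _, X₁, X₂, M₁, M₂, hX.2, rfl, rfl,
        (hP ρ a).symm ▸ h₁, h₂⟩
      rw [Finset.mem_union, not_or]
      exact ⟨hX.1, ha⟩

end Flattening

/-! # Reactions of flattened processes -/

section Reactions

variable {𝒩 PID : Type*} [LinearOrder 𝒩] [Infinite 𝒩]

open Function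

/-- The names in a summand belong to `A`. -/
def Summand.Within (A : Finset 𝒩) : Summand 𝒩 (Cls 𝒩 PID) → Prop
  | .tau q => q.fn ⊆ A
  | .out a b q => a ∈ A ∧ b ∈ A ∧ q.fn ⊆ A
  | .inp a f => a ∈ A ∧ ∀ z, (f z).fn ⊆ insert z A

/-- The names in a call or choice belong to `A`. -/
def Redex.Within (A : Finset 𝒩) : Redex 𝒩 PID → Prop
  | .call _ args => ∀ x ∈ args, x ∈ A
  | .choice s => ∀ u ∈ s, u.Within A

theorem Prefix.summand_within (p : Prefix 𝒩) (S : Proc 𝒩 PID) (ρ : 𝒩 → 𝒩) {A : Finset 𝒩}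
    (h : (p.scopeFn S.fn).image ρ ⊆ A) : (p.summand S ρ).Within A := by
  have h' : ∀ x ∈ p.scopeFn S.fn, ρ x ∈ A := fun x hx => h (Finset.mem_image_of_mem _ hx)
  cases p with
  | tau =>
    simp only [summand, Summand.Within, Cls.fn_cls, Proc.fn_subst]
    exact h
  | out a b =>
    simp only [summand, Summand.Within, Cls.fn_cls, Proc.fn_subst]
    refine ⟨h' a (by simp [scopeFn]), h' b (by simp [scopeFn]), fun y hy => ?_⟩
    obtain ⟨x, hx, rfl⟩ := Finset.mem_image.1 hy
    exact h' x (by simp [scopeFn, hx])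
  | inp a x =>
    simp only [summand, Summand.Within, Cls.fn_cls, Proc.fn_subst]
    refine ⟨h' a (by simp [scopeFn]), fun z y hy => ?_⟩
    obtain ⟨w, hw, rfl⟩ := Finset.mem_image.1 hy
    by_cases hx : w = x
    · subst hx; simp
    · rw [update_of_ne hx]
      exact Finset.mem_insert_of_mem (h' w (by simp [scopeFn, hw, hx]))

theorem Proc.redex_within (P : Proc 𝒩 PID) (ρ : 𝒩 → 𝒩) : (P.redex ρ).Within (P.fn.image ρ) := by
  cases P with
  | call K args =>
    intro x hx
    simpa [Proc.fn] using hx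
  | choice π S =>
    rintro _ ⟨i, rfl⟩
    exact Prefix.summand_within _ _ _ (Finset.image_subset_image (Proc.scopeFn_subset π S i))
  | _ => exact fun u hu => hu.elim

/-- Confines the names of the components. In a parallel composition it shows that the restricted
names of one side do not occur on the other, as `Cls.nu_add_nu` requires. -/
theorem Flat.within {P : Proc 𝒩 PID} {ρ : 𝒩 → 𝒩} {X : Finset 𝒩}
    {M : Multiset (Cls 𝒩 PID × Redex 𝒩 PID)} (h : Flat P ρ X M) :
    ∀ e ∈ M, e.2.Within e.1.fn ∧ e.1.fn ⊆ X ∪ P.fn.image ρ := by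
  have atom : ∀ (P : Proc 𝒩 PID) (ρ : 𝒩 → 𝒩), (P.atom ρ).2.Within (P.atom ρ).1.fn ∧
      (P.atom ρ).1.fn ⊆ ∅ ∪ P.fn.image ρ := by
    intro P ρ
    simp only [Proc.atom, Cls.fn_cls, Proc.fn_subst]
    exact ⟨Proc.redex_within P ρ, by simp⟩
  induction P generalizing ρ X M with
  | call K args =>
    obtain ⟨rfl, rfl⟩ := h
    rintro e he
    rw [Multiset.mem_singleton.1 he]
    exact atom _ _
  | @choice m π S ih =>
    obtain ⟨rfl, rfl⟩ := h
    rintro e he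
    split_ifs at he with hm
    · simp at he
    · rw [Multiset.mem_singleton.1 he]
      exact atom _ _
  | res r P ih =>
    obtain ⟨a, Y, ha, rfl, h⟩ := h
    intro e he
    have := ih h e he
    refine ⟨this.1, fun x hx => ?_⟩
    have := this.2 hx
    simp only [Finset.mem_union, Finset.mem_insert, Finset.mem_image, Proc.fn,
      Finset.mem_erase] at this ⊢
    rcases this with h | ⟨y, hy, rfl⟩
    · exact .inl (.inr h)
    · by_cases hyr : y = r
      · subst hyr; simp
      · exact .inr ⟨y, ⟨hyr, hy⟩, by rw [update_of_ne hyr]⟩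
  | par P Q ihP ihQ =>
    obtain ⟨X₁, X₂, M₁, M₂, hX, rfl, rfl, h₁, h₂⟩ := h
    intro e he
    rw [Proc.fn, Finset.image_union]
    rcases Multiset.mem_add.1 he with he | he
    · refine ⟨(ihP h₁ e he).1, (ihP h₁ e he).2.trans ?_⟩
      intro x; simp only [Finset.mem_union]; tauto
    · refine ⟨(ihQ h₂ e he).1, (ihQ h₂ e he).2.trans ?_⟩
      intro x; simp only [Finset.mem_union]; tauto

/-- The parallel composition of the components of a flattened process. -/
def Cls.ofFlat (M : Multiset (Cls 𝒩 PID × Redex 𝒩 PID)) : Cls 𝒩 PID := (M.map Prod.fst).sum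

theorem Cls.ofFlat_add (M N : Multiset (Cls 𝒩 PID × Redex 𝒩 PID)) :
    Cls.ofFlat (M + N) = Cls.ofFlat M + Cls.ofFlat N := by simp [Cls.ofFlat]

theorem Cls.fn_ofFlat_subset {M : Multiset (Cls 𝒩 PID × Redex 𝒩 PID)} {A : Finset 𝒩}
    (h : ∀ e ∈ M, e.1.fn ⊆ A) : (Cls.ofFlat M).fn ⊆ A := by
  intro a ha
  obtain ⟨q, hq, haq⟩ := (Cls.fn_multiset_sum _).1 ha
  obtain ⟨e, he, rfl⟩ := Multiset.mem_map.1 hq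
  exact h e he haq

theorem disjoint_image_update {Y A : Finset 𝒩} {a r : 𝒩} {ρ : 𝒩 → 𝒩} (ha : a ∉ Y)
    (h : Disjoint (insert a Y) ((A.erase r).image ρ)) : Disjoint Y (A.image (update ρ r a)) := by
  rw [Finset.disjoint_left]
  intro y hy hy'
  obtain ⟨x, hx, rfl⟩ := Finset.mem_image.1 hy'
  by_cases hxr : x = r
  · subst hxr
    rw [update_self] at hy
    exact ha hy
  · rw [update_of_ne hxr] at hy
    exact Finset.disjoint_left.1 h (Finset.mem_insert_of_mem hy)
      (Finset.mem_image_of_mem _ (Finset.mem_erase.2 ⟨hxr, hx⟩))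

/-- The disjointness hypothesis says that instantiating the restrictions by `X` captures no value of
a free name. All restrictions can then be moved to the front. -/
theorem Flat.cls {P : Proc 𝒩 PID} {ρ : 𝒩 → 𝒩} {X : Finset 𝒩}
    {M : Multiset (Cls 𝒩 PID × Redex 𝒩 PID)} (h : Flat P ρ X M)
    (hX : Disjoint X (P.fn.image ρ)) : (P.subst ρ).cls = Cls.nu X (Cls.ofFlat M) := by
  induction P generalizing ρ X M with
  | call K args =>
    obtain ⟨rfl, rfl⟩ := h
    simp [Cls.ofFlat, Proc.atom]
  | @choice m π S ih =>
    obtain ⟨rfl, rfl⟩ := h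
    split_ifs with hm
    · subst hm
      rw [Proc.subst_choice]
      simp only [Cls.ofFlat, Multiset.map_zero, Multiset.sum_zero, Cls.nu_empty]
      rw [← Cls.cls_zero, Proc.zero]
      congr 2 <;> exact Subsingleton.elim _ _
    · simp [Cls.ofFlat, Proc.atom]
  | res r P ih =>
    obtain ⟨a, Y, ha, rfl, h⟩ := h
    rw [Proc.cls_subst_res (b := a) fun h' => Finset.disjoint_left.1 hX
      (Finset.mem_insert_self _ _) h', Cls.nu_insert ha, ih h (disjoint_image_update ha hX)]
  | par P Q ihP ihQ =>
    obtain ⟨X₁, X₂, M₁, M₂, hd, rfl, rfl, h₁, h₂⟩ := h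
    simp only [Proc.fn, Finset.image_union, Finset.disjoint_union_left,
      Finset.disjoint_union_right] at hX
    rw [Cls.ofFlat_add, Cls.nu_add_nu hd, ← ihP h₁ hX.1.1, ← ihQ h₂ hX.2.2]
    · rfl
    · exact (Finset.disjoint_union_right.2 ⟨hd, hX.2.1⟩).mono_right
        (Cls.fn_ofFlat_subset fun e he => (h₂.within e he).2)
    · exact (Finset.disjoint_union_right.2 ⟨hd.symm, hX.1.2⟩).mono_right
        (Cls.fn_ofFlat_subset fun e he => (h₁.within e he).2)

variable {n : ℕ}

namespace Spec

variable (F : Spec 𝒩 PID n)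

/-- Reactions of the components `M` of a flattened process: the components that do not take part
are `R`, and the other ones become `q`. -/
inductive Reduces : Multiset (Cls 𝒩 PID × Redex 𝒩 PID) → Cls 𝒩 PID →
    Multiset (Cls 𝒩 PID × Redex 𝒩 PID) → Prop
  | tau (c s q R) : Summand.tau q ∈ s → Reduces ((c, .choice s) ::ₘ R) q R
  | call (c K args R) : args.length = (F.formals K).length → Reduces ((c, .call K args) ::ₘ R)
      ((F.body K).subst (listSubst (F.formals K) args)).cls R
  | comm (c₁ s₁ c₂ s₂ a b f q R) : Summand.inp a f ∈ s₁ → Summand.out a b q ∈ s₂ →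
      Reduces ((c₁, .choice s₁) ::ₘ (c₂, .choice s₂) ::ₘ R) (f b + q) R

variable {F}

theorem Reduces.add {M q R} (h : F.Reduces M q R) (N : Multiset (Cls 𝒩 PID × Redex 𝒩 PID)) :
    F.Reduces (M + N) q (R + N) := by
  cases h with
  | tau c s q R h =>
    rw [Multiset.cons_add]
    exact .tau _ _ _ _ h
  | call c K args R h =>
    rw [Multiset.cons_add]
    exact .call _ _ _ _ h
  | comm c₁ s₁ c₂ s₂ a b f q R h h' =>
    rw [Multiset.cons_add, Multiset.cons_add]
    exact .comm _ _ _ _ _ _ _ _ _ h h'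

theorem listSubst_mem {xs as : List 𝒩} (h : as.length = xs.length) {x : 𝒩} (hx : x ∈ xs) :
    listSubst xs as x ∈ as := by
  induction xs generalizing as with
  | nil => simp at hx
  | cons y xs ih =>
    cases as with
    | nil => simp at h
    | cons a as =>
      rw [listSubst]
      by_cases hxy : x = y
      · subst hxy; simp
      · rw [update_of_ne hxy]
        exact List.mem_cons_of_mem _ (ih (by simpa using h) (by simpa [hxy] using hx))

theorem listSubst_map {xs as : List 𝒩} (ρ : 𝒩 → 𝒩) (h : as.length = xs.length) {x : 𝒩}
    (hx : x ∈ xs) : listSubst xs (as.map ρ) x = ρ (listSubst xs as x) := by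
  induction xs generalizing as with
  | nil => simp at hx
  | cons y xs ih =>
    cases as with
    | nil => simp at h
    | cons a as =>
      simp only [List.map_cons, listSubst]
      by_cases hxy : x = y
      · subst hxy; simp
      · rw [update_of_ne hxy, update_of_ne hxy]
        exact ih (by simpa using h) (by simpa [hxy] using hx)

variable (hbody : ∀ K, (F.body K).fn ⊆ (F.formals K).toFinset)
include hbody

theorem fn_body_subst_subset {K : PID} {args : List 𝒩}
    (h : args.length = (F.formals K).length) :
    ((F.body K).subst (listSubst (F.formals K) args)).fn ⊆ args.toFinset := by
  rw [Proc.fn_subst]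
  intro y hy
  obtain ⟨x, hx, rfl⟩ := Finset.mem_image.1 hy
  exact List.mem_toFinset.2 (listSubst_mem h (List.mem_toFinset.1 (hbody K hx)))

/-- A reduction introduces no names, because the body of an equation has no free names but its
parameters. Hence restrictions can still be separated after the reduction. -/
theorem Reduces.fn_subset {M q R} (h : F.Reduces M q R) {A : Finset 𝒩}
    (hM : ∀ e ∈ M, e.2.Within e.1.fn ∧ e.1.fn ⊆ A) : q.fn ⊆ A ∧ ∀ e ∈ R, e.1.fn ⊆ A := by
  cases h with
  | tau c s q R h =>
    have := hM _ (Multiset.mem_cons_self _ _)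
    exact ⟨(this.1 _ h).trans this.2, fun e he => (hM e (Multiset.mem_cons_of_mem he)).2⟩
  | call c K args R h =>
    have := hM _ (Multiset.mem_cons_self _ _)
    refine ⟨(fn_body_subst_subset hbody h).trans fun x hx => this.2 (this.1 x ?_),
      fun e he => (hM e (Multiset.mem_cons_of_mem he)).2⟩
    exact List.mem_toFinset.1 hx
  | comm c₁ s₁ c₂ s₂ a b f q R h h' =>
    have h₁ := hM _ (Multiset.mem_cons_self _ _)
    have h₂ := hM _ (Multiset.mem_cons_of_mem (Multiset.mem_cons_self _ _))
    refine ⟨?_, fun e he =>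
      (hM e (Multiset.mem_cons_of_mem (Multiset.mem_cons_of_mem he))).2⟩
    have hf := (h₁.1 _ h).2 b
    obtain ⟨-, hb, hq⟩ := h₂.1 _ h'
    rw [Cls.fn_add]
    exact Finset.union_subset (hf.trans (Finset.insert_subset (h₂.2 hb) h₁.2)) (hq.trans h₂.2)

theorem React.fn_subset {P Q : Proc 𝒩 PID} (h : F.React P Q) : Q.fn ⊆ P.fn := by
  induction h with
  | tau π S i hi =>
    have := Proc.scopeFn_subset π S i
    rwa [hi] at this
  | const K args h => exact fn_body_subst_subset hbody h
  | comm π S π' S' i j x y z hi hj =>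
    have h₁ := Proc.scopeFn_subset π S i
    have h₂ := Proc.scopeFn_subset π' S' j
    rw [hi] at h₁
    rw [hj] at h₂
    simp only [Proc.fn, Proc.fn_subst]
    refine Finset.union_subset (fun w hw => ?_) (fun w hw => ?_)
    · obtain ⟨v, hv, rfl⟩ := Finset.mem_image.1 hw
      rw [Finset.mem_union]
      by_cases hvy : v = y
      · subst hvy
        exact .inr (h₂ (by simp [single, Prefix.scopeFn]))
      · exact .inl (h₁ (by simp [single, Prefix.scopeFn, hvy, hv]))
    · exact Finset.mem_union_right _ (h₂ (by simp [Prefix.scopeFn, hw]))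
  | par Q _ ih => exact Finset.union_subset_union_left ih
  | res a _ ih => exact Finset.erase_subset_erase _ ih
  | struct h _ h' ih => rw [h.fn_eq, ← h'.fn_eq]; exact ih

/-- Inversion of the reaction relation by induction on the derivation. The rules for contexts only
add components or restrictions, and closure under structural congruence is handled by `SC.flatLe`.
-/
theorem React.flat {P Q : Proc 𝒩 PID} (h : F.React P Q) {ρ : 𝒩 → 𝒩} {X : Finset 𝒩}
    {M : Multiset (Cls 𝒩 PID × Redex 𝒩 PID)} (hP : Flat P ρ X M)
    (hX : Disjoint X (P.fn.image ρ)) :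
    ∃ q R, F.Reduces M q R ∧ (Q.subst ρ).cls = Cls.nu X (q + Cls.ofFlat R) := by
  induction h generalizing ρ X M with
  | @tau m π S i hi =>
    obtain ⟨rfl, rfl⟩ := hP
    rw [if_neg (by rintro rfl; exact i.elim0)]
    refine ⟨_, 0, .tau _ _ ((S i).subst ρ).cls 0 ⟨i, ?_⟩, ?_⟩
    · simp only [hi]; rfl
    · simp [Cls.ofFlat]
  | const K args h =>
    obtain ⟨rfl, rfl⟩ := hP
    refine ⟨_, 0, .call _ K (args.map ρ) 0 (by simpa using h), ?_⟩
    simp only [Cls.nu_empty, Cls.ofFlat, Multiset.map_zero, Multiset.sum_zero, add_zero,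
      Proc.cls_subst_comp]
    congr 1
    exact Proc.subst_congr fun x hx =>
      (listSubst_map ρ h (List.mem_toFinset.1 (hbody K hx))).symm
  | @comm m m' π S π' S' i j x y z hi hj =>
    obtain ⟨X₁, X₂, M₁, M₂, hd, rfl, rfl, ⟨rfl, rfl⟩, rfl, rfl⟩ := hP
    rw [if_neg (by rintro rfl; exact i.elim0), if_neg (by rintro rfl; exact j.elim0)]
    refine ⟨_, 0, .comm _ _ _ _ (ρ x) (ρ z) (fun w => ((S i).subst (update ρ y w)).cls)
      ((S' j).subst ρ).cls 0 ⟨i, ?_⟩ ⟨j, ?_⟩, ?_⟩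
    · simp only [hi]; rfl
    · simp only [hj]; rfl
    · simp only [Proc.subst, Finset.union_empty, Cls.nu_empty, Cls.ofFlat, Multiset.map_zero,
        Multiset.sum_zero, add_zero, Cls.cls_par, Proc.cls_subst_comp]
      congr 2
      refine Proc.subst_congr fun w _ => ?_
      by_cases hw : w = y
      · subst hw; simp [single]
      · simp [single, hw]
  | @par P P' Q h ih =>
    obtain ⟨X₁, X₂, M₁, M₂, hd, rfl, rfl, h₁, h₂⟩ := hP
    simp only [Proc.fn, Finset.image_union, Finset.disjoint_union_left,
      Finset.disjoint_union_right] at hX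
    obtain ⟨q, R, hred, hcls⟩ := ih h₁ hX.1.1
    refine ⟨q, R + M₂, hred.add M₂, ?_⟩
    have hfn := hred.fn_subset hbody h₁.within
    rw [Cls.ofFlat_add, ← add_assoc, Cls.nu_add_nu hd, ← hcls, ← h₂.cls hX.2.2]
    · rfl
    · exact (Finset.disjoint_union_right.2 ⟨hd, hX.2.1⟩).mono_right
        (Cls.fn_ofFlat_subset fun e he => (h₂.within e he).2)
    · refine (Finset.disjoint_union_right.2 ⟨hd.symm, hX.1.2⟩).mono_right ?_
      rw [Cls.fn_add]
      exact Finset.union_subset hfn.1 (Cls.fn_ofFlat_subset hfn.2)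
  | @res r P P' h ih =>
    obtain ⟨a, Y, ha, rfl, hP⟩ := hP
    obtain ⟨q, R, hred, hcls⟩ := ih hP (disjoint_image_update ha hX)
    refine ⟨q, R, hred, ?_⟩
    rw [Proc.cls_subst_res (b := a), hcls, Cls.nu_insert ha]
    intro h'
    exact Finset.disjoint_left.1 hX (Finset.mem_insert_self _ _)
      (Finset.image_subset_image (Finset.erase_subset_erase _ (h.fn_subset hbody)) h')
  | @struct P Q P' Q' hP' h hQ' ih =>
    -- The names in `Y` that are not in `X` are kept away from the values of the free names, so `Y`
    -- is as admissible as `X`.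
    obtain ⟨Y, hY, hYX⟩ := hP'.flatLe.1 ρ X M hP (X ∪ P.fn.image ρ)
    rw [Finset.disjoint_left] at hYX hX
    have hYP : Disjoint Y (P'.fn.image ρ) := by
      rw [← hP'.fn_eq, Finset.disjoint_left]
      intro a h₁ h₂
      have := @hYX a
      have := @hX a
      simp only [Finset.mem_sdiff, Finset.mem_union] at *
      tauto
    obtain ⟨q, R, hred, hcls⟩ := ih hY hYP
    refine ⟨q, R, hred, ?_⟩
    rw [← Proc.cls_eq.2 (hQ'.subst ρ), hcls]
    have h₁ := hred.fn_subset hbody hP.within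
    have h₂ := hred.fn_subset hbody hY.within
    -- A free name of the result lies in `X` or is a value of a free name of `P`, and the same holds
    -- with `Y`. As both sets are disjoint from these values, `X` and `Y` agree on the free names of
    -- the result.
    refine Cls.nu_congr fun a ha => ?_
    have ha₁ : a ∈ X ∪ P.fn.image ρ := by
      rw [Cls.fn_add] at ha
      exact Finset.union_subset h₁.1 (Cls.fn_ofFlat_subset h₁.2) ha
    have ha₂ : a ∈ Y ∪ P'.fn.image ρ := by
      rw [Cls.fn_add] at ha
      exact Finset.union_subset h₂.1 (Cls.fn_ofFlat_subset h₂.2) ha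
    rw [← hP'.fn_eq] at ha₂
    have := @hYX a
    have := @hX a
    simp only [Finset.mem_sdiff, Finset.mem_union] at *
    tauto

end Spec

end Reactions

/-! ### Reactions between congruence classes. -/

section ClassReactions

variable {𝒩 PID : Type*} [LinearOrder 𝒩] [Infinite 𝒩] {n : ℕ}

open Function

namespace Spec

variable (F : Spec 𝒩 PID n)

/-- Reactions between classes of processes. -/
def ReactCls (q q' : Cls 𝒩 PID) : Prop := ∃ P P', q = P.cls ∧ q' = P'.cls ∧ F.React P P'

variable {F}

theorem ReactCls.react {P : Proc 𝒩 PID} {q' : Cls 𝒩 PID} (h : F.ReactCls P.cls q') :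
    ∃ P', q' = P'.cls ∧ F.React P P' := by
  obtain ⟨P₁, P', h₁, rfl, h⟩ := h
  exact ⟨P', rfl, .struct (Proc.cls_eq.1 h₁) h (.refl _)⟩

theorem ReactCls.add {q q' : Cls 𝒩 PID} (h : F.ReactCls q q') (r : Cls 𝒩 PID) :
    F.ReactCls (q + r) (q' + r) := by
  obtain ⟨P, P', rfl, rfl, h⟩ := h
  induction r using Quotient.inductionOn with | _ R =>
  exact ⟨.par P R, .par P' R, rfl, rfl, .par R h⟩

theorem ReactCls.nu {q q' : Cls 𝒩 PID} (h : F.ReactCls q q') (X : Finset 𝒩) :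
    F.ReactCls (Cls.nu X q) (Cls.nu X q') := by
  induction X using Finset.induction_on with
  | empty => exact h
  | insert a X ha ih =>
    obtain ⟨P, P', h₁, h₂, h⟩ := ih
    rw [Cls.nu_insert ha, Cls.nu_insert ha, h₁, h₂]
    exact ⟨.res a P, .res a P', rfl, rfl, .res a h⟩

theorem ReactCls.tau {m : ℕ} {π : Fin m → Prefix 𝒩} (S : Fin m → Proc 𝒩 PID) {k : Fin m}
    (h : π k = .tau) (σ : 𝒩 → 𝒩) :
    F.ReactCls ((Proc.choice π S).subst σ).cls ((S k).subst σ).cls := by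
  refine ⟨_, _, rfl, rfl, ?_⟩
  rw [Proc.subst_choice]
  have := React.tau (F := F) (fun i => (π i).sub σ (S i).fn)
    (fun i => (S i).subst ((π i).under σ (S i).fn)) k (by rw [h]; rfl)
  rwa [h] at this

theorem ReactCls.call {K : PID} {args : List 𝒩} (h : args.length = (F.formals K).length) :
    F.ReactCls (Proc.call K args).cls
      ((F.body K).subst (listSubst (F.formals K) args)).cls :=
  ⟨_, _, rfl, rfl, .const K args h⟩

/-- Substituting in the input prefix may rename its binder. Composition with the substitution of the
received name removes the new binder again, which leaves an update at `y`. -/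
theorem ReactCls.comm {m m' : ℕ} {π : Fin m → Prefix 𝒩} (S : Fin m → Proc 𝒩 PID)
    {π' : Fin m' → Prefix 𝒩} (S' : Fin m' → Proc 𝒩 PID) {i : Fin m} {j : Fin m'}
    {x x' y z : 𝒩} (hi : π i = .inp x y) (hj : π' j = .out x' z) {σ τ : 𝒩 → 𝒩}
    (h : σ x = τ x') :
    F.ReactCls (((Proc.choice π S).subst σ).cls + ((Proc.choice π' S').subst τ).cls)
      (((S i).subst (update σ y (τ z))).cls + ((S' j).subst τ).cls) := by
  refine ⟨.par ((Proc.choice π S).subst σ) ((Proc.choice π' S').subst τ),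
    .par (((S i).subst ((π i).under σ (S i).fn)).subst (single (newBinder σ y (S i).fn) (τ z)))
      ((S' j).subst ((π' j).under τ (S' j).fn)), rfl, ?_, ?_⟩
  · simp only [hi, hj, Prefix.under, Cls.cls_par, Proc.cls_subst_comp]
    rw [Proc.subst_congr (single_update (newBinder_notMem _ _ _))]
  · rw [Proc.subst_choice, Proc.subst_choice]
    refine React.comm _ _ _ _ i j (σ x) (newBinder σ y (S i).fn) (τ z) ?_ ?_
    · simp [hi, Prefix.sub]
    · simp [hj, Prefix.sub, h]

end Spec

end ClassReactions

/-! # Control states -/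

section Control

variable {𝒩 PID : Type*} [LinearOrder 𝒩] [Infinite 𝒩] {n : ℕ}

namespace Spec

variable (F : Spec 𝒩 PID n)

/-- The process of an equation; the initial threads have the additional equations. -/
def eqBody : Fin n ⊕ PID → Proc 𝒩 PID := Sum.elim F.body₀ F.body

/-- The formal parameters of an equation. -/
def eqFormals : Fin n ⊕ PID → List 𝒩 := Sum.elim F.formals₀ F.formals

/-- The formal parameters of an equation and the names bound in it. -/
def eqNames (e : Fin n ⊕ PID) : Finset 𝒩 :=
  (F.eqFormals e).toFinset ∪ ((F.eqBody e).restrBound + (F.eqBody e).inpBound).toFinset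

/-- The equations used by the `i`-th thread. -/
def Owns (i : Fin n) : Fin n ⊕ PID → Prop
  | .inl j => j = i
  | .inr K => F.CalledBy i K

/-- The names used by the `i`-th thread. -/
def threadNames (i : Fin n) : Set 𝒩 := {x | ∃ e, F.Owns i e ∧ x ∈ F.eqNames e}

/-- In a call some of whose parameters have been transferred already, these are replaced by the
formal parameters. -/
def complete : Proc 𝒩 PID → Proc 𝒩 PID
  | .call K args => .call K (args ++ (F.formals K).drop args.length)
  | S => S

/-- The names that have a value in a control state. -/
def live (p : Aug 𝒩 PID) : Finset 𝒩 := (F.complete p.1).fn ∪ p.2.toFinset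

variable {F}

theorem complete_of_arityOK {S : Proc 𝒩 PID} (h : S.ArityOK fun K => (F.formals K).length) :
    F.complete S = S := by
  cases S with
  | call K args =>
    have h : args.length = (F.formals K).length := h
    simp [complete, h]
  | _ => rfl

theorem eqBody_ok [Fintype PID] (hF : F.NormalForm) (e : Fin n ⊕ PID) :
    F.ThreadOK (F.eqFormals e) (F.eqBody e) := by
  cases e with
  | inl i => exact hF.body₀_ok i
  | inr K => exact hF.body_ok K

/-! ### Consequences of the no clash assumptions for names. -/

section Clash

variable [Fintype PID]

theorem allBound_eq : F.allBound = (F.restr₀ : Multiset 𝒩) +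
    ∑ e, ((F.eqBody e).restrBound + (F.eqBody e).inpBound) := by
  rw [Fintype.sum_sum_type, allBound, add_assoc]
  rfl

theorem allFormals_eq : F.allFormals = ∑ e, (F.eqFormals e : Multiset 𝒩) := by
  rw [Fintype.sum_sum_type]
  rfl

theorem mem_restr {x : 𝒩} :
    x ∈ F.restr ↔ x ∈ F.restr₀ ∨ ∃ e, x ∈ (F.eqBody e).restrBound := by
  rw [restr, Multiset.mem_toFinset, Multiset.mem_add, Multiset.mem_add, Multiset.mem_sum,
    Multiset.mem_sum]
  simp [eqBody, or_assoc]

theorem mem_inp {x : 𝒩} : x ∈ F.inp ↔ ∃ e, x ∈ (F.eqBody e).inpBound := by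
  rw [inp, Multiset.mem_toFinset, Multiset.mem_add, Multiset.mem_sum, Multiset.mem_sum]
  simp [eqBody]

theorem mem_frm {x : 𝒩} : x ∈ F.frm ↔ ∃ e, x ∈ F.eqFormals e := by
  rw [frm, Multiset.mem_toFinset, allFormals_eq, Multiset.mem_sum]
  simp

theorem mem_allBound {x : 𝒩} : x ∈ F.allBound ↔ x ∈ F.restr ∨ x ∈ F.inp := by
  rw [mem_restr, mem_inp, allBound_eq, Multiset.mem_add, Multiset.mem_sum]
  simp only [Finset.mem_univ, true_and, Multiset.mem_add, Multiset.mem_coe, exists_or, or_assoc]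

variable (hF : F.NormalForm)
include hF

theorem restr_disjoint_inp : Disjoint F.restr F.inp := by
  have h : F.allBound = ((F.restr₀ : Multiset 𝒩) + ∑ i, (F.body₀ i).restrBound +
      ∑ K, (F.body K).restrBound) +
      (∑ i, (F.body₀ i).inpBound + ∑ K, (F.body K).inpBound) := by
    rw [allBound, Finset.sum_add_distrib, Finset.sum_add_distrib]
    ac_rfl
  have := hF.bound_nodup
  rw [h, Multiset.nodup_add] at this
  rw [restr, inp, Finset.disjoint_left]
  intro x hx hx'
  exact Multiset.disjoint_left.1 this.2.2 (Multiset.mem_toFinset.1 hx) (Multiset.mem_toFinset.1 hx')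

theorem restr_notMem_inp_frm {x : 𝒩} (hx : x ∈ F.restr) : x ∉ F.inp ∪ F.frm := by
  rw [Finset.mem_union, not_or]
  exact ⟨Finset.disjoint_left.1 (restr_disjoint_inp hF) hx, fun h =>
    hF.bound_formals x (mem_allBound.2 (.inl hx)) (Multiset.mem_toFinset.1 h)⟩

theorem notMem_restr {x : 𝒩} (hx : x ∈ F.inp ∪ F.frm) : x ∉ F.restr :=
  fun h => restr_notMem_inp_frm hF h hx

theorem eqBody_bound_nodup (e : Fin n ⊕ PID) :
    ((F.eqBody e).restrBound + (F.eqBody e).inpBound).Nodup := by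
  refine Multiset.nodup_of_le ?_ hF.bound_nodup
  rw [allBound_eq]
  exact (Finset.single_le_sum_of_canonicallyOrdered
    (f := fun e => (F.eqBody e).restrBound + (F.eqBody e).inpBound) (Finset.mem_univ e)).trans
    (Multiset.le_add_left _ _)

theorem eqFormals_nodup (e : Fin n ⊕ PID) : (F.eqFormals e).Nodup := by
  rw [← Multiset.coe_nodup]
  refine Multiset.nodup_of_le ?_ hF.formals_nodup
  rw [allFormals_eq]
  exact Finset.single_le_sum_of_canonicallyOrdered
    (f := fun e => (F.eqFormals e : Multiset 𝒩)) (Finset.mem_univ e)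

omit hF [Infinite 𝒩] in
theorem disjoint_of_nodup_sum {ι : Type*} [Fintype ι] {f : ι → Multiset 𝒩}
    (h : (∑ i, f i).Nodup) {i j : ι} (hij : i ≠ j) : Disjoint (f i) (f j) := by
  classical
  have : f i + f j ≤ ∑ i, f i := by
    rw [← Finset.sum_pair hij]
    exact Finset.sum_le_sum_of_subset (Finset.subset_univ _)
  exact (Multiset.nodup_add.1 (Multiset.nodup_of_le this h)).2.2

theorem eqNames_disjoint {e e' : Fin n ⊕ PID} (h : e ≠ e') :
    Disjoint (F.eqNames e) (F.eqNames e') := by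
  have hb := hF.bound_nodup
  rw [allBound_eq] at hb
  have hb := disjoint_of_nodup_sum (Multiset.nodup_add.1 hb).2.1 h
  have hf := hF.formals_nodup
  rw [allFormals_eq] at hf
  have hf := disjoint_of_nodup_sum hf h
  rw [Multiset.disjoint_left] at hb hf
  have hcross : ∀ e e' x, x ∈ F.eqFormals e →
      x ∉ (F.eqBody e').restrBound + (F.eqBody e').inpBound := by
    intro e e' x hx hx'
    refine hF.bound_formals x ?_ (Multiset.mem_toFinset.1 (mem_frm.2 ⟨e, hx⟩))
    rw [allBound_eq]
    exact Multiset.mem_add.2 (.inr (Multiset.mem_sum.2 ⟨e', Finset.mem_univ _, hx'⟩))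
  rw [Finset.disjoint_left]
  intro x hx hx'
  simp only [eqNames, Finset.mem_union, List.mem_toFinset, Multiset.mem_toFinset] at hx hx'
  rcases hx with hx | hx <;> rcases hx' with hx' | hx'
  · exact hf hx hx'
  · exact hcross _ _ _ hx hx'
  · exact hcross _ _ _ hx' hx
  · exact hb hx hx'

/-- A name belongs to one equation and an equation to one thread. This is what makes one global
valuation possible. -/
theorem threadNames_disjoint {i j : Fin n} (hij : i ≠ j) {x : 𝒩} (hx : x ∈ F.threadNames i) :
    x ∉ F.threadNames j := by
  rintro ⟨e', he', hx'⟩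
  obtain ⟨e, he, hx⟩ := hx
  have : e = e' := by
    by_contra h
    exact Finset.disjoint_left.1 (eqNames_disjoint hF h) hx hx'
  subst this
  cases e with
  | inl k => exact hij (he.symm.trans he')
  | inr K => exact hF.disjoint i j K hij he he'

end Clash

/-- The part `S` of the process of the equation `e` is executed. -/
structure InBody (F : Spec 𝒩 PID n) (e : Fin n ⊕ PID) (S : Proc 𝒩 PID) (l : List 𝒩) : Prop where
  thread : S.IsThread
  arity : S.ArityOK fun K => (F.formals K).length
  noStop : S.NoStop
  used : S.BindersUsed
  restr_le : S.restrBound ≤ (F.eqBody e).restrBound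
  inp_le : S.inpBound ≤ (F.eqBody e).inpBound
  calls : S.calls ⊆ (F.eqBody e).calls
  names : ∀ x, x ∈ S.fn ∨ x ∈ l → x ∈ F.eqNames e
  fresh : ∀ x, x ∈ S.fn ∨ x ∈ l → x ∉ S.restrBound ∧ x ∉ S.inpBound
  nodup : l.Nodup
  disj : ∀ x ∈ S.fn, x ∉ l

/-- A call from the process of the equation `e` is executed. -/
structure InCall (F : Spec 𝒩 PID n) (e : Fin n ⊕ PID) (K : PID) (args l : List 𝒩) : Prop where
  mem : K ∈ (F.eqBody e).calls
  len : args.length ≤ (F.formals K).length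
  names : ∀ x, x ∈ args ∨ x ∈ l → x ∈ F.eqNames e
  nodup : l.Nodup

/-- The control states of the `i`-th thread. -/
def Typed (F : Spec 𝒩 PID n) (i : Fin n) (p : Aug 𝒩 PID) : Prop :=
  ∃ e, F.Owns i e ∧ (F.InBody e p.1 p.2 ∨ ∃ K args, p.1 = .call K args ∧ F.InCall e K args p.2)

theorem InBody.inCall {e : Fin n ⊕ PID} {K : PID} {args l : List 𝒩}
    (h : F.InBody e (.call K args) l) : F.InCall e K args l where
  mem := h.calls rfl
  len := le_of_eq h.arity
  names x hx := h.names x (by simpa [Proc.fn] using hx)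
  nodup := h.nodup

theorem Typed.call {i : Fin n} {K : PID} {args l : List 𝒩} (h : F.Typed i (.call K args, l)) :
    ∃ e, F.Owns i e ∧ F.InCall e K args l := by
  obtain ⟨e, he, h | ⟨K', args', h, hc⟩⟩ := h
  · exact ⟨e, he, h.inCall⟩
  · cases h
    exact ⟨e, he, hc⟩

theorem Typed.inBody {i : Fin n} {S : Proc 𝒩 PID} {l : List 𝒩} (h : F.Typed i (S, l))
    (hS : ¬ S.IsCall) : ∃ e, F.Owns i e ∧ F.InBody e S l := by
  obtain ⟨e, he, h | ⟨K', args', h, hc⟩⟩ := h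
  · exact ⟨e, he, h⟩
  · exact absurd ⟨K', args', h⟩ hS

theorem InCall.owns {i : Fin n} {e : Fin n ⊕ PID} {K : PID} {args l : List 𝒩}
    (h : F.InCall e K args l) (he : F.Owns i e) : F.CalledBy i K := by
  cases e with
  | inl j =>
    cases he
    exact .direct h.mem
  | inr L => exact .indirect he h.mem

/-! ### Control states are preserved by restrictions, choices and calls. -/

section Clash

variable [Fintype PID] (hF : F.NormalForm)
include hF

/-- The place where the absence of direct self-calls is used: the formal parameters that a call
assigns are never names still in use by the caller. -/
theorem InCall.ne {e : Fin n ⊕ PID} {K : PID} {args l : List 𝒩}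
    (h : F.InCall e K args l) : e ≠ .inr K := by
  rintro rfl
  exact hF.no_self_call K h.mem

theorem InCall.notMem_formals {e : Fin n ⊕ PID} {K : PID} {args l : List 𝒩}
    (h : F.InCall e K args l) {x : 𝒩} (hx : x ∈ args ∨ x ∈ l) : x ∉ F.formals K := by
  intro hx'
  refine Finset.disjoint_left.1 (eqNames_disjoint hF (h.ne hF)) (h.names x hx) ?_
  exact Finset.mem_union_left _ (List.mem_toFinset.2 hx')

theorem Typed.live_subset {i : Fin n} {p : Aug 𝒩 PID} (h : F.Typed i p) {x : 𝒩}
    (hx : x ∈ F.live p) : x ∈ F.threadNames i := by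
  obtain ⟨S, l⟩ := p
  by_cases hS : S.IsCall
  · obtain ⟨K, args, rfl⟩ := hS
    obtain ⟨e, he, h⟩ := h.call
    simp only [live, complete, Proc.fn, Finset.mem_union, List.mem_toFinset, List.mem_append] at hx
    by_cases hx' : x ∈ args ∨ x ∈ l
    · exact ⟨e, he, h.names x hx'⟩
    · have : x ∈ F.formals K := List.mem_of_mem_drop (by tauto)
      exact ⟨.inr K, h.owns he, Finset.mem_union_left _ (List.mem_toFinset.2 this)⟩
  · obtain ⟨e, he, h⟩ := h.inBody hS
    rw [live, complete_of_arityOK h.arity] at hx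
    exact ⟨e, he, h.names x (by simpa using hx)⟩

theorem inBody_body (e : Fin n ⊕ PID) : F.InBody e (F.eqBody e) [] := by
  have h := eqBody_ok hF e
  refine ⟨h.thread, h.arity, h.noStop, h.used, le_rfl, le_rfl, subset_rfl, ?_, ?_, List.nodup_nil,
    fun x _ => List.not_mem_nil⟩
  · intro x hx
    rw [h.fn_eq] at hx
    exact Finset.mem_union_left _ (by simpa using hx)
  · intro x hx
    have hx : x ∈ F.eqFormals e := by simpa [h.fn_eq] using hx
    have hb := mt (hF.bound_formals x) (not_not.2 (Multiset.mem_toFinset.1 (mem_frm.2 ⟨e, hx⟩)))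
    rw [mem_allBound, not_or, mem_restr, mem_inp] at hb
    exact ⟨fun h => hb.1 (.inr ⟨e, h⟩), fun h => hb.2 ⟨e, h⟩⟩

/-- The name `r` becomes free. Being bound only once in the equation, it is not bound again in the
scope; and it is not in `l`, since names in `l` are never bound in the current process. -/
theorem InBody.res {e : Fin n ⊕ PID} {r : 𝒩} {S : Proc 𝒩 PID} {l : List 𝒩}
    (h : F.InBody e (.res r S) l) : F.InBody e S l where
  thread := h.thread
  arity := h.arity
  noStop := h.noStop
  used := h.used.2
  restr_le := (Multiset.le_add_left _ _).trans h.restr_le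
  inp_le := h.inp_le
  calls := h.calls
  names x hx := by
    by_cases hxr : x = r
    · subst hxr
      refine Finset.mem_union_right _ (Multiset.mem_toFinset.2 (Multiset.mem_add.2 (.inl ?_)))
      exact Multiset.mem_of_le h.restr_le (by simp [Proc.restrBound])
    · exact h.names x (by simpa [Proc.fn, hxr] using hx)
  fresh x hx := by
    by_cases hxr : x = r
    · subst hxr
      have hn := eqBody_bound_nodup hF e
      rw [Multiset.nodup_add] at hn
      have h₁ : x ∈ (Proc.res x S).restrBound := by simp [Proc.restrBound]
      refine ⟨fun h' => ?_, fun h' => ?_⟩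
      · have := Multiset.nodup_of_le h.restr_le hn.1
        rw [Proc.restrBound, Multiset.singleton_add, Multiset.nodup_cons] at this
        exact this.1 h'
      · exact Multiset.disjoint_left.1 hn.2.2 (Multiset.mem_of_le h.restr_le h₁)
          (Multiset.mem_of_le h.inp_le h')
    · have := h.fresh x (by simpa [Proc.fn, hxr] using hx)
      exact ⟨fun h' => this.1 (Multiset.mem_add.2 (.inr h')), this.2⟩
  nodup := h.nodup
  disj x hx hl := by
    by_cases hxr : x = r
    · subst hxr
      exact (h.fresh x (.inr hl)).1 (by simp [Proc.restrBound])
    · exact h.disj x (by simp [Proc.fn, hxr, hx]) hl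

omit hF [Fintype PID] in
theorem mem_forgotten {P Q : Proc 𝒩 PID} {x : 𝒩} : x ∈ forgotten P Q ↔ x ∈ P.fn ∧ x ∉ Q.fn := by
  simp [forgotten]

omit hF [Fintype PID] in
theorem mem_fn_of_mem_continuation {m : ℕ} {π : Fin m → Prefix 𝒩} {S : Fin m → Proc 𝒩 PID}
    {k : Fin m} {x : 𝒩} (hx : x ∈ (S k).fn) (hb : ∀ a, π k ≠ .inp a x) :
    x ∈ (Proc.choice π S).fn := by
  refine Proc.scopeFn_subset π S k ?_
  cases hp : π k with
  | inp a y =>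
    have : x ≠ y := by rintro rfl; exact hb a hp
    simp [Prefix.scopeFn, hx, this]
  | _ => simp [Prefix.scopeFn, hx]

theorem InBody.choice {e : Fin n ⊕ PID} {m : ℕ} {π : Fin m → Prefix 𝒩} {S : Fin m → Proc 𝒩 PID}
    {l : List 𝒩} (h : F.InBody e (.choice π S) l) (k : Fin m) :
    F.InBody e (S k) (l ++ forgotten (.choice π S) (S k)) := by
  have hr : (S k).restrBound ≤ (Proc.choice π S).restrBound :=
    Finset.single_le_sum_of_canonicallyOrdered (f := fun i => (S i).restrBound) (Finset.mem_univ k)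
  have hi : (π k).bound + (S k).inpBound ≤ (Proc.choice π S).inpBound :=
    Finset.single_le_sum_of_canonicallyOrdered (f := fun i => (π i).bound + (S i).inpBound)
      (Finset.mem_univ k)
  have hn := Multiset.nodup_add.1 (eqBody_bound_nodup hF e)
  -- Apart from the input name nothing new occurs: a name of the next state is a name of the current
  -- one.
  have hmem : ∀ x, x ∈ (S k).fn ∨ x ∈ l ++ forgotten (.choice π S) (S k) →
      (x ∈ (Proc.choice π S).fn ∨ x ∈ l) ∨ x ∈ (π k).bound := by
    intro x hx
    rw [List.mem_append, mem_forgotten] at hx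
    by_cases hb : ∃ a, π k = .inp a x
    · obtain ⟨a, hb⟩ := hb
      exact .inr (by simp [hb, Prefix.bound])
    · rcases hx with hx | hx | hx
      · exact .inl (.inl (mem_fn_of_mem_continuation hx fun a ha => hb ⟨a, ha⟩))
      · exact .inl (.inr hx)
      · exact .inl (.inl hx.1)
  have hbound : ∀ x ∈ (π k).bound, x ∈ (F.eqBody e).inpBound := fun x hx =>
    Multiset.mem_of_le (hi.trans h.inp_le) (Multiset.mem_add.2 (.inl hx))
  refine ⟨h.thread k, h.arity k, h.noStop.2 k, (h.used k).2, hr.trans h.restr_le,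
    (Multiset.le_add_left _ _).trans (hi.trans h.inp_le), ?_, ?_, ?_, ?_, ?_⟩
  · exact (Set.subset_iUnion (fun i => (S i).calls) k).trans h.calls
  · intro x hx
    rcases hmem x hx with hx | hx
    · exact h.names x hx
    · exact Finset.mem_union_right _ (Multiset.mem_toFinset.2
        (Multiset.mem_add.2 (.inr (hbound x hx))))
  · intro x hx
    rcases hmem x hx with hx | hx
    · have := h.fresh x hx
      exact ⟨fun h' => this.1 (Multiset.mem_of_le hr h'),
        fun h' => this.2 (Multiset.mem_of_le hi (Multiset.mem_add.2 (.inr h')))⟩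
    · refine ⟨fun h' => ?_, fun h' => ?_⟩
      · exact Multiset.disjoint_left.1 hn.2.2
          (Multiset.mem_of_le (hr.trans h.restr_le) h') (hbound x hx)
      · have := Multiset.nodup_of_le (hi.trans h.inp_le) hn.2.1
        exact Multiset.disjoint_left.1 (Multiset.nodup_add.1 this).2.2 hx h'
  -- The appended names are free in the choice, and such names are not yet in `l`.
  · rw [List.nodup_append]
    refine ⟨h.nodup, Finset.sort_nodup _ _, ?_⟩
    rintro x hx _ hy rfl
    exact h.disj x (mem_forgotten.1 hy).1 hx
  · intro x hx
    rw [List.mem_append, mem_forgotten, not_or, not_and, not_not]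
    refine ⟨fun hl => ?_, fun _ => hx⟩
    by_cases hb : ∃ a, π k = .inp a x
    · obtain ⟨a, hb⟩ := hb
      refine (h.fresh x (.inr hl)).2 (Multiset.mem_of_le hi (Multiset.mem_add.2 (.inl ?_)))
      simp [hb, Prefix.bound]
    · exact h.disj x (mem_fn_of_mem_continuation hx fun a ha => hb ⟨a, ha⟩) hl

end Clash

end Spec

end Control

/-! ### The effect of the rules on live names. -/

section ControlSteps

variable {𝒩 PID : Type*} [LinearOrder 𝒩] [Infinite 𝒩] {n : ℕ}

namespace Spec

variable {F : Spec 𝒩 PID n} [Fintype PID] (hF : F.NormalForm) {i : Fin n}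
include hF

theorem mem_live_iff_of_inBody {e : Fin n ⊕ PID} {S : Proc 𝒩 PID} {l : List 𝒩}
    (h : F.InBody e S l) {x : 𝒩} : x ∈ F.live (S, l) ↔ x ∈ S.fn ∨ x ∈ l := by
  simp [live, complete_of_arityOK h.arity]

/-- The effect of the rule for restrictions. -/
theorem Typed.nu {r : 𝒩} {S : Proc 𝒩 PID} {l : List 𝒩} (h : F.Typed i (.res r S, l)) :
    F.Typed i (S, l) ∧ F.complete S = S ∧ r ∈ F.restr ∧ r ∈ F.threadNames i ∧
      r ∉ F.live (.res r S, l) ∧ F.live (S, l) = insert r (F.live (.res r S, l)) := by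
  obtain ⟨e, he, h⟩ := h.inBody (by rintro ⟨K, args, h⟩; cases h)
  have hr : r ∈ (F.eqBody e).restrBound := Multiset.mem_of_le h.restr_le (by simp [Proc.restrBound])
  refine ⟨⟨e, he, .inl (h.res hF)⟩, complete_of_arityOK (h.res hF).arity, mem_restr.2 (.inr ⟨e, hr⟩),
    ⟨e, he, (h.res hF).names r (.inl h.used.1)⟩, ?_, ?_⟩
  · rw [mem_live_iff_of_inBody hF h]
    exact fun h' => (h.fresh r h').1 (by simp [Proc.restrBound])
  · ext x
    rw [Finset.mem_insert, mem_live_iff_of_inBody hF h, mem_live_iff_of_inBody hF (h.res hF)]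
    by_cases hx : x = r
    · subst hx
      simp [h.used.1]
    · simp [Proc.fn, hx]

theorem Typed.choice {m : ℕ} {π : Fin m → Prefix 𝒩} {S : Fin m → Proc 𝒩 PID} {l : List 𝒩}
    (h : F.Typed i (.choice π S, l)) (k : Fin m) :
    F.Typed i (S k, l ++ forgotten (.choice π S) (S k)) ∧ F.complete (S k) = S k := by
  obtain ⟨e, he, h⟩ := h.inBody (by rintro ⟨K, args, h⟩; cases h)
  exact ⟨⟨e, he, .inl (h.choice hF k)⟩, complete_of_arityOK (h.choice hF k).arity⟩

omit hF in
theorem subset_live_choice {m : ℕ} {π : Fin m → Prefix 𝒩} {S : Fin m → Proc 𝒩 PID} {l : List 𝒩}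
    (k : Fin m) : (π k).scopeFn (S k).fn ⊆ F.live (.choice π S, l) :=
  (Proc.scopeFn_subset π S k).trans Finset.subset_union_left

/-- Prefixes other than inputs bind nothing, and the names that cease to be free are exactly those
appended to the list. -/
theorem Typed.live_choice {m : ℕ} {π : Fin m → Prefix 𝒩} {S : Fin m → Proc 𝒩 PID} {l : List 𝒩}
    (h : F.Typed i (.choice π S, l)) {k : Fin m} (hk : ∀ a x, π k ≠ .inp a x) :
    F.live (S k, l ++ forgotten (.choice π S) (S k)) = F.live (.choice π S, l) := by
  obtain ⟨e, he, h⟩ := h.inBody (by rintro ⟨K, args, h⟩; cases h)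
  ext x
  rw [mem_live_iff_of_inBody hF h, mem_live_iff_of_inBody hF (h.choice hF k), List.mem_append,
    mem_forgotten]
  have := fun hx : x ∈ (S k).fn => mem_fn_of_mem_continuation hx fun a => hk a x
  tauto

/-- The effect of an input. -/
theorem Typed.live_inp {m : ℕ} {π : Fin m → Prefix 𝒩} {S : Fin m → Proc 𝒩 PID} {l : List 𝒩}
    (h : F.Typed i (.choice π S, l)) {k : Fin m} {a y : 𝒩} (hk : π k = .inp a y) :
    y ∈ F.inp ∧ y ∈ F.threadNames i ∧ y ∉ F.live (.choice π S, l) ∧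
    F.live (S k, l ++ forgotten (.choice π S) (S k)) = insert y (F.live (.choice π S, l)) := by
  obtain ⟨e, he, h⟩ := h.inBody (by rintro ⟨K, args, h⟩; cases h)
  have hy : y ∈ (S k).fn := (h.used k).1 a y hk
  have hb : y ∈ (Proc.choice π S).inpBound :=
    Multiset.mem_sum.2 ⟨k, Finset.mem_univ k, Multiset.mem_add.2 (.inl (by simp [hk, Prefix.bound]))⟩
  refine ⟨mem_inp.2 ⟨e, Multiset.mem_of_le h.inp_le hb⟩,
    ⟨e, he, (h.choice hF k).names y (.inl hy)⟩, ?_, ?_⟩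
  · rw [mem_live_iff_of_inBody hF h]
    exact fun h' => (h.fresh y h').2 hb
  · ext x
    rw [Finset.mem_insert, mem_live_iff_of_inBody hF h, mem_live_iff_of_inBody hF (h.choice hF k),
      List.mem_append, mem_forgotten]
    by_cases hx : x = y
    · subst hx
      simp [hy]
    · have := fun hx' : x ∈ (S k).fn => mem_fn_of_mem_continuation (π := π) hx' fun a h' => by
        rw [hk] at h'
        exact hx (Prefix.inp.inj h').2.symm
      tauto

/-- The effect of the transfer of a parameter. -/
theorem Typed.call₁ {K : PID} {xs l : List 𝒩} {x f : 𝒩} (h : F.Typed i (.call K (xs ++ [x]), l))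
    (hf : (F.formals K)[xs.length]? = some f) :
    F.Typed i (.call K xs, if x ∈ l then l else l ++ [x]) ∧
      F.complete (.call K xs) = .call K (xs ++ f :: (F.formals K).drop (xs.length + 1)) ∧
      x ∈ F.live (.call K (xs ++ [x]), l) ∧ f ∈ F.frm ∧
      f ∈ F.threadNames i ∧ f ∉ F.live (.call K (xs ++ [x]), l) ∧
      F.live (.call K xs, if x ∈ l then l else l ++ [x]) =
        insert f (F.live (.call K (xs ++ [x]), l)) := by
  obtain ⟨e, he, h⟩ := h.call
  obtain ⟨hlen, rfl⟩ := List.getElem?_eq_some_iff.1 hf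
  have hmem : (F.formals K)[xs.length] ∈ F.formals K := List.getElem_mem hlen
  have hdrop : (F.formals K).drop xs.length =
      (F.formals K)[xs.length] :: (F.formals K).drop (xs.length + 1) :=
    List.drop_eq_getElem_cons hlen
  -- The case distinction only avoids duplicates. As a set, the list always gains `x`.
  have hl : ∀ y, y ∈ (if x ∈ l then l else l ++ [x]) ↔ y ∈ l ∨ y = x := by
    intro y
    split_ifs with hx
    · exact ⟨.inl, fun h => h.elim id fun h => h ▸ hx⟩
    · simp
  refine ⟨⟨e, he, .inr ⟨K, xs, rfl, h.mem, ?_, ?_, ?_⟩⟩, by rw [complete, hdrop], ?_,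
    mem_frm.2 ⟨.inr K, hmem⟩, ?_, ?_, ?_⟩
  · have := h.len
    rw [List.length_append] at this
    omega
  · intro y hy
    rw [hl] at hy
    refine h.names y ?_
    simp only [List.mem_append, List.mem_singleton]
    tauto
  · split_ifs with hx
    · exact h.nodup
    · rw [List.nodup_append]
      refine ⟨h.nodup, List.nodup_singleton x, ?_⟩
      rintro y hy z hz rfl
      exact hx (List.mem_singleton.1 hz ▸ hy)
  · simp [live, complete, Proc.fn]
  · exact ⟨.inr K, h.owns he, Finset.mem_union_left _ (List.mem_toFinset.2 hmem)⟩
  -- The next formal parameter has no value yet: it is no name of the caller, and it differs from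
  -- the later formal parameters, which have replaced the arguments already transferred.
  · have hnd : (F.formals K).Nodup := eqFormals_nodup hF (.inr K)
    have h₁ : ¬ ((F.formals K)[xs.length] ∈ xs ++ [x] ∨ (F.formals K)[xs.length] ∈ l) :=
      fun h' => h.notMem_formals hF h' hmem
    have h₂ : (F.formals K)[xs.length] ∉ (F.formals K).drop (xs.length + 1) := by
      have := hnd.sublist (List.drop_sublist xs.length _)
      rw [hdrop, List.nodup_cons] at this
      exact this.1
    simp only [live, complete, Proc.fn, Finset.mem_union, List.mem_toFinset, List.mem_append,
      List.length_append, List.length_singleton] at h₁ ⊢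
    tauto
  · ext y
    rw [live, complete, hdrop]
    simp only [live, complete, Proc.fn, Finset.mem_union, List.mem_toFinset, List.mem_append,
      List.mem_cons, Finset.mem_insert, hl, List.length_append, List.length_singleton,
      List.not_mem_nil, or_false]
    tauto

/-- The effect of forgetting a name. -/
theorem Typed.call₂ {K : PID} {l : List 𝒩} {x : 𝒩} (h : F.Typed i (.call K [], x :: l)) :
    F.Typed i (.call K [], l) ∧ x ∈ F.live (.call K [], x :: l) ∧ x ∉ F.formals K ∧
      F.live (.call K [], l) = (F.live (.call K [], x :: l)).erase x := by
  obtain ⟨e, he, h⟩ := h.call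
  have hx := h.notMem_formals hF (x := x) (.inr (by simp))
  refine ⟨⟨e, he, .inr ⟨K, [], rfl, h.mem, h.len, ?_, (List.nodup_cons.1 h.nodup).2⟩⟩,
    by simp [live], hx, ?_⟩
  · intro y hy
    exact h.names y (hy.imp id (List.mem_cons_of_mem _))
  · ext y
    simp only [live, complete, Proc.fn, Finset.mem_union, List.mem_toFinset, List.length_nil,
      List.drop_zero, List.nil_append, Finset.mem_erase, List.mem_cons]
    by_cases hy : y = x
    · subst hy
      simpa using ⟨hx, (List.nodup_cons.1 h.nodup).1⟩
    · simp [hy]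

/-- The effect of the transfer of control. -/
theorem Typed.call₃ {K : PID} (h : F.Typed i (.call K [], [])) :
    F.Typed i (F.body K, []) ∧ F.complete (F.body K) = F.body K ∧
      F.live (F.body K, []) = F.live (.call K [], []) := by
  obtain ⟨e, he, h⟩ := h.call
  have hb : F.InBody (.inr K) (F.body K) [] := inBody_body hF (.inr K)
  refine ⟨⟨.inr K, h.owns he, .inl hb⟩, complete_of_arityOK hb.arity, ?_⟩
  rw [live, complete_of_arityOK hb.arity, (hF.body_ok K).fn_eq]
  simp [live, complete, Proc.fn]

theorem CReach.typed {ν : Type*} {p : Aug 𝒩 PID} (h : F.CReach ν i p) : F.Typed i p := by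
  induction h with
  | init => exact ⟨.inl i, rfl, .inl (inBody_body hF (.inl i))⟩
  | step _ hs ih =>
    cases hs with
    | nu => exact (ih.nu hF).1
    | tau π S l k => exact (ih.choice hF k).1
    | snd π S l k => exact (ih.choice hF k).1
    | rcv π S l k => exact (ih.choice hF k).1
    | call₁ K xs x f l a hf => exact (ih.call₁ hF hf).1
    | call₂ => exact (ih.call₂ hF).1
    | call₃ => exact (ih.call₃ hF).1

end Spec

end ControlSteps

/-! # Markings that encode control states and values -/

section Encoding

variable {𝒩 PID : Type*} [LinearOrder 𝒩] [Infinite 𝒩] {n : ℕ}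

open Function

/-- Firing is deterministic once the transition is given. To determine the successor it therefore
suffices to exhibit one. -/
theorem PetriNet.Fires.unique {α β : Type*} {N : PetriNet α β} {M M₁ M₂ : α → ℕ} {t : β}
    (h₁ : N.Fires M t M₁) (h₂ : N.Fires M t M₂) : M₁ = M₂ :=
  funext fun p => (h₁.2.2 p).trans (h₂.2.2 p).symm

theorem PetriNet.FiresSeq.append {α β : Type*} {N : PetriNet α β} {M₁ M₂ M₃ : α → ℕ}
    {ts ts' : List β} (h : N.FiresSeq M₁ ts M₂) (h' : N.FiresSeq M₂ ts' M₃) :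
    N.FiresSeq M₁ (ts ++ ts') M₃ := by
  induction h with
  | nil => exact h'
  | cons hf _ ih => exact .cons hf (ih h')

namespace Spec

variable {ν : Type*}

section

variable (F : Spec 𝒩 PID n)

open Classical in
/-- The marking of the substitution net for the values `η`. -/
noncomputable def substEnc [Fintype PID] (η : 𝒩 → Option (F.pub ⊕ ν)) : SubstPlace 𝒩 F.pub ν → ℕ
  | .eq x a => if η x = some a then 1 else 0
  | .neq x k => if x ∈ F.inp ∪ F.frm ∧ η x ≠ some (.inr k) then 1 else 0
  | .neqRestr k => if ∃ r ∈ F.restr, η r = some (.inr k) then 0 else 1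

open Classical in
/-- The marking for the control states `p` and the values `η`. -/
noncomputable def enc [Fintype PID] (p : Fin n → Aug 𝒩 PID) (η : 𝒩 → Option (F.pub ⊕ ν)) : F.NPlace ν → ℕ
  | .inl s => F.substEnc η s
  | .inr (i, q) => if q = p i then 1 else 0

/-- The places of the substitution net from which a set of commands consumes tokens. -/
def cmdsPre [Fintype PID] (C : Set (Cmd 𝒩 F.pub ν)) : Set (SubstPlace 𝒩 F.pub ν) :=
  F.substPlaces ν ∩ ⋃ c ∈ C, F.cmdPre c

/-- The places of the substitution net on which a set of commands produces tokens. -/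
def cmdsPost [Fintype PID] (C : Set (Cmd 𝒩 F.pub ν)) : Set (SubstPlace 𝒩 F.pub ν) :=
  F.substPlaces ν ∩ ⋃ c ∈ C, F.cmdPost c

/-- The commands `C` are enabled for the values `η`. -/
def Enabled [Fintype PID] (η : 𝒩 → Option (F.pub ⊕ ν)) (C : Set (Cmd 𝒩 F.pub ν)) : Prop :=
  ∀ s ∈ F.cmdsPre C, 0 < F.substEnc η s

open Classical in
/-- The commands `C` change the values `η` to `η'`. -/
structure Effect [Fintype PID] (η : 𝒩 → Option (F.pub ⊕ ν)) (C : Set (Cmd 𝒩 F.pub ν))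
    (η' : 𝒩 → Option (F.pub ⊕ ν)) : Prop where
  enabled : F.Enabled η C
  eq : ∀ s, F.substEnc η' s = F.substEnc η s - (if s ∈ F.cmdsPre C then 1 else 0) +
    (if s ∈ F.cmdsPost C then 1 else 0)

end

variable {F : Spec 𝒩 PID n} [Fintype PID]

/-! ### Firing on encoded states: control part and substitution part. -/

section Net

variable [Fintype ν] {M : SubstPlace 𝒩 F.pub ν → ℕ} {hM : F.InitialSubstMarking ν M}
  {p : Fin n → Aug 𝒩 PID} {η η' : 𝒩 → Option (F.pub ⊕ ν)}

theorem inl_mem_net_pre {u : F.NTrans ν} {s : SubstPlace 𝒩 F.pub ν} :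
    .inl s ∈ (F.net hM).pre u ↔ s ∈ F.cmdsPre ((ControlNet.parallel (F.threadNet ν)).cmd u) := by
  change .inl s ∈ Sum.inl '' _ ∪ Sum.inr '' _ ↔ _
  simp only [Set.mem_union, Set.mem_image, Sum.inl.injEq, exists_eq_right, reduceCtorEq, and_false,
    exists_false, or_false]
  rfl

theorem inl_mem_net_post {u : F.NTrans ν} {s : SubstPlace 𝒩 F.pub ν} :
    .inl s ∈ (F.net hM).post u ↔
      s ∈ F.cmdsPost ((ControlNet.parallel (F.threadNet ν)).cmd u) := by
  change .inl s ∈ Sum.inl '' _ ∪ Sum.inr '' _ ↔ _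
  simp only [Set.mem_union, Set.mem_image, Sum.inl.injEq, exists_eq_right, reduceCtorEq, and_false,
    exists_false, or_false]
  rfl

theorem inr_mem_net_pre {u : F.NTrans ν} {q : Fin n × Aug 𝒩 PID} :
    .inr q ∈ (F.net hM).pre u ↔ q ∈ (ControlNet.parallel (F.threadNet ν)).pre u := by
  change .inr q ∈ Sum.inl '' _ ∪ Sum.inr '' _ ↔ _
  simp only [Set.mem_union, Set.mem_image, Sum.inr.injEq, exists_eq_right, reduceCtorEq, and_false,
    exists_false, false_or]
  rfl

theorem inr_mem_net_post {u : F.NTrans ν} {q : Fin n × Aug 𝒩 PID} :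
    .inr q ∈ (F.net hM).post u ↔ q ∈ (ControlNet.parallel (F.threadNet ν)).post u := by
  change .inr q ∈ Sum.inl '' _ ∪ Sum.inr '' _ ↔ _
  simp only [Set.mem_union, Set.mem_image, Sum.inr.injEq, exists_eq_right, reduceCtorEq, and_false,
    exists_false, false_or]
  rfl

theorem mem_parallel_pre_single {i j : Fin n} {t : CTrans 𝒩 PID F.pub ν} {q : Aug 𝒩 PID} :
    (j, q) ∈ (ControlNet.parallel (F.threadNet ν)).pre (.single i t) ↔ j = i ∧ q = t.src := by
  change (j, q) ∈ Prod.mk i '' {t.src} ↔ _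
  simp [eq_comm]

theorem mem_parallel_post_single {i j : Fin n} {t : CTrans 𝒩 PID F.pub ν} {q : Aug 𝒩 PID} :
    (j, q) ∈ (ControlNet.parallel (F.threadNet ν)).post (.single i t) ↔ j = i ∧ q = t.tgt := by
  change (j, q) ∈ Prod.mk i '' {t.tgt} ↔ _
  simp [eq_comm]

theorem mem_parallel_pre_sync {i i' j : Fin n} {t t' : CTrans 𝒩 PID F.pub ν} {q : Aug 𝒩 PID} :
    (j, q) ∈ (ControlNet.parallel (F.threadNet ν)).pre (.sync i t i' t') ↔
      (j = i ∧ q = t.src) ∨ (j = i' ∧ q = t'.src) := by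
  change (j, q) ∈ Prod.mk i '' {t.src} ∪ Prod.mk i' '' {t'.src} ↔ _
  simp [eq_comm, or_comm]

theorem mem_parallel_post_sync {i i' j : Fin n} {t t' : CTrans 𝒩 PID F.pub ν} {q : Aug 𝒩 PID} :
    (j, q) ∈ (ControlNet.parallel (F.threadNet ν)).post (.sync i t i' t') ↔
      (j = i ∧ q = t.tgt) ∨ (j = i' ∧ q = t'.tgt) := by
  change (j, q) ∈ Prod.mk i '' {t.tgt} ∪ Prod.mk i' '' {t'.tgt} ↔ _
  simp [eq_comm, or_comm]

theorem fires_single {i : Fin n} {t : CTrans 𝒩 PID F.pub ν} (hr : F.CReach ν i t.src)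
    (ht : ∃ ρ, F.Step ν ρ t.src t.lab t.cmd t.tgt) (hl : t.lab = .tau) (hp : p i = t.src)
    (he : F.Effect η t.cmd η') :
    (F.net hM).Fires (F.enc p η) (.single i t) (F.enc (update p i t.tgt) η') := by
  classical
  refine ⟨⟨⟨hr, ht⟩, hl⟩, ?_, ?_⟩
  · rintro (s | ⟨j, q⟩) hs
    · exact he.enabled s (inl_mem_net_pre.1 hs)
    · obtain ⟨rfl, rfl⟩ := mem_parallel_pre_single.1 (inr_mem_net_pre.1 hs)
      simp [enc, hp]
  · rintro (s | ⟨j, q⟩)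
    · simp only [inl_mem_net_pre, inl_mem_net_post]
      exact he.eq s
    · simp only [inr_mem_net_pre, inr_mem_net_post, mem_parallel_pre_single,
        mem_parallel_post_single, enc]
      by_cases hj : j = i
      · subst hj
        simp [hp]
      · simp [hj]

/-- The arcs of the two commands sets are united, so the effect has to be given for the union. The
control parts are independent because `i ≠ j`. -/
theorem fires_sync {i j : Fin n} {t t' : CTrans 𝒩 PID F.pub ν} (hij : i ≠ j)
    (hr : F.CReach ν i t.src) (hr' : F.CReach ν j t'.src)
    (ht : ∃ ρ, F.Step ν ρ t.src t.lab t.cmd t.tgt)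
    (ht' : ∃ ρ, F.Step ν ρ t'.src t'.lab t'.cmd t'.tgt)
    (hl : ∃ a b, t.lab = .send a b ∧ t'.lab = .rcv a b) (hp : p i = t.src) (hp' : p j = t'.src)
    (he : F.Effect η (t.cmd ∪ t'.cmd) η') :
    (F.net hM).Fires (F.enc p η) (.sync i t j t')
      (F.enc (update (update p i t.tgt) j t'.tgt) η') := by
  classical
  have h₁ : t ∈ (F.threadNet ν i).T := ⟨hr, ht⟩
  have h₂ : t' ∈ (F.threadNet ν j).T := ⟨hr', ht'⟩
  have hT : ParTrans.sync i t j t' ∈ (ControlNet.parallel (F.threadNet ν)).T := ⟨hij, h₁, h₂, hl⟩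
  have hcmd : (ControlNet.parallel (F.threadNet ν)).cmd (.sync i t j t') = t.cmd ∪ t'.cmd := rfl
  refine ⟨⟨hT, rfl⟩, ?_, ?_⟩
  · rintro (s | ⟨k, q⟩) hs
    · rw [inl_mem_net_pre, hcmd] at hs
      exact he.enabled s hs
    · rcases mem_parallel_pre_sync.1 (inr_mem_net_pre.1 hs) with ⟨rfl, rfl⟩ | ⟨rfl, rfl⟩
      · simp [enc, hp]
      · simp [enc, hp']
  · rintro (s | ⟨k, q⟩)
    · simp only [inl_mem_net_pre, inl_mem_net_post, hcmd]
      exact he.eq s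
    · simp only [inr_mem_net_pre, inr_mem_net_post, mem_parallel_pre_sync,
        mem_parallel_post_sync, enc]
      by_cases hj : k = j
      · subst hj
        simp [hp', hij.symm]
      · by_cases hi : k = i
        · subst hi
          simp [hp, hij]
        · simp [hi, hj]

end Net

/-- The values `η` respect the domains, and they are injective on restricted names. -/
structure Valid (F : Spec 𝒩 PID n) (η : 𝒩 → Option (F.pub ⊕ ν)) : Prop where
  supp : ∀ x, η x ≠ none → x ∈ F.inp ∪ F.frm ∪ F.restr
  restr : ∀ x ∈ F.restr, ∀ a, η x = some a → ∃ k, a = .inr k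
  inj : ∀ x ∈ F.restr, ∀ y ∈ F.restr, η x ≠ none → η x = η y → x = y

theorem mem_substPlaces_eq {x : 𝒩} {a : F.pub ⊕ ν} (hF : F.NormalForm) :
    .eq x a ∈ F.substPlaces ν ↔ x ∈ F.inp ∪ F.frm ∪ F.restr ∧ a ∈ F.dom ν x := by
  cases a with
  | inl v =>
    simp only [substPlaces, Set.mem_ofPred_eq, dom, reduceCtorEq, exists_false, imp_false]
    rw [Finset.mem_union (t := F.restr)]
    have := notMem_restr hF (x := x)
    tauto
  | inr k => simp [substPlaces, dom]

theorem Valid.mem_dom {η : 𝒩 → Option (F.pub ⊕ ν)} (h : F.Valid η) {x : 𝒩} {a : F.pub ⊕ ν}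
    (hx : η x = some a) : a ∈ F.dom ν x := fun hr => h.restr x hr a hx

theorem Valid.mem_substPlaces {η : 𝒩 → Option (F.pub ⊕ ν)} (hF : F.NormalForm) (h : F.Valid η)
    {x : 𝒩} {a : F.pub ⊕ ν} (hx : η x = some a) : .eq x a ∈ F.substPlaces ν :=
  (mem_substPlaces_eq hF).2 ⟨h.supp x (by simp [hx]), h.mem_dom hx⟩

/-! ### Enabledness and effect of commands. -/

section Effects

variable {η : 𝒩 → Option (F.pub ⊕ ν)}

theorem mem_cmdsPre {C : Set (Cmd 𝒩 F.pub ν)} {s : SubstPlace 𝒩 F.pub ν} :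
    s ∈ F.cmdsPre C ↔ s ∈ F.substPlaces ν ∧ ∃ c ∈ C, s ∈ F.cmdPre c := by
  simp [cmdsPre]

theorem mem_cmdsPost {C : Set (Cmd 𝒩 F.pub ν)} {s : SubstPlace 𝒩 F.pub ν} :
    s ∈ F.cmdsPost C ↔ s ∈ F.substPlaces ν ∧ ∃ c ∈ C, s ∈ F.cmdPost c := by
  simp [cmdsPost]

theorem effect_empty : F.Effect η ∅ η := by
  constructor
  · intro s hs
    simp [cmdsPre] at hs
  · intro s
    simp [cmdsPre, cmdsPost]

theorem substEnc_eq_pos {x : 𝒩} {a : F.pub ⊕ ν} : 0 < F.substEnc η (.eq x a) ↔ η x = some a := by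
  simp only [substEnc]
  split_ifs <;> simp_all

theorem Enabled.test {C : Set (Cmd 𝒩 F.pub ν)} (h : F.Enabled η C) (hF : F.NormalForm) {x : 𝒩}
    {a : F.pub ⊕ ν} (hC : .test x a ∈ C) (hx : x ∈ F.inp ∪ F.frm ∪ F.restr) (ha : a ∈ F.dom ν x) :
    η x = some a :=
  substEnc_eq_pos.1 (h _ (mem_cmdsPre.2 ⟨(mem_substPlaces_eq hF).2 ⟨hx, ha⟩, _, hC, rfl⟩))

theorem Enabled.unmap {C : Set (Cmd 𝒩 F.pub ν)} (h : F.Enabled η C) (hF : F.NormalForm) {x : 𝒩}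
    {a : F.pub ⊕ ν} (hC : .unmap x a ∈ C) (hx : x ∈ F.inp ∪ F.frm ∪ F.restr)
    (ha : a ∈ F.dom ν x) : η x = some a :=
  substEnc_eq_pos.1 (h _ (mem_cmdsPre.2 ⟨(mem_substPlaces_eq hF).2 ⟨hx, ha⟩, _, hC, rfl⟩))

/-- The token on `[x≠k]` excludes that an input name or formal parameter has the value `k`, and the
token on `[r_*≠k]` excludes it for restricted names. -/
theorem Enabled.map_restr {C : Set (Cmd 𝒩 F.pub ν)} (h : F.Enabled η C) (hv : F.Valid η) {r : 𝒩}
    {k : ν} (hC : .map r (.inr k) ∈ C) (hr : r ∈ F.restr) (x : 𝒩) : η x ≠ some (.inr k) := by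
  intro hx
  have hV := hv.supp x (by simp [hx])
  rw [Finset.mem_union] at hV
  rcases hV with hV | hV
  · have hmem : SubstPlace.neq x k ∈ F.cmdPre (.map r (.inr k)) := by
      simp only [cmdPre, hr, if_true]
      exact .inr ⟨x, hV, rfl⟩
    have := h (.neq x k) (mem_cmdsPre.2 ⟨hV, _, hC, hmem⟩)
    simp [substEnc, hx] at this
  · have := h (.neqRestr k) (mem_cmdsPre.2 ⟨trivial, _, hC, by simp [cmdPre, hr]⟩)
    simp only [substEnc] at this
    rw [if_pos ⟨x, hV, hx⟩] at this
    exact lt_irrefl _ this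

theorem effect_map_restr (hF : F.NormalForm) {r : 𝒩} {k : ν} (hr : r ∈ F.restr) (hn : η r = none)
    (hk : ∀ x, η x ≠ some (.inr k)) :
    F.Effect η {.map r (.inr k)} (update η r (some (.inr k))) := by
  classical
  have hpre : ∀ s, s ∈ F.cmdsPre {Cmd.map r (.inr k)} ↔
      s = .neqRestr k ∨ ∃ y ∈ F.inp ∪ F.frm, s = .neq y k := by
    intro s
    rw [mem_cmdsPre]
    simp only [Set.mem_singleton_iff, exists_eq_left, cmdPre, hr, if_true, Set.mem_union,
      Set.mem_ofPred_eq]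
    refine and_iff_right_of_imp ?_
    rintro (rfl | ⟨y, hy, rfl⟩)
    · trivial
    · exact hy
  have hpost : ∀ s, s ∈ F.cmdsPost {Cmd.map r (.inr k)} ↔
      s = .eq r (.inr k) ∨ ∃ y ∈ F.inp ∪ F.frm, s = .neq y k := by
    intro s
    rw [mem_cmdsPost]
    simp only [Set.mem_singleton_iff, exists_eq_left, cmdPost, hr, if_true, Set.mem_union,
      Set.mem_ofPred_eq]
    refine and_iff_right_of_imp ?_
    rintro (rfl | ⟨y, hy, rfl⟩)
    · exact Finset.mem_union_right _ hr
    · exact hy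
  constructor
  · intro s hs
    rcases (hpre s).1 hs with rfl | ⟨y, hy, rfl⟩
    · simp [substEnc, hk]
    · simp only [substEnc]
      rw [if_pos ⟨hy, hk y⟩]
      exact one_pos
  · intro s
    simp only [hpre, hpost]
    cases s with
    | eq x a =>
      simp only [reduceCtorEq, and_false, exists_false, or_false, SubstPlace.eq.injEq, substEnc]
      by_cases hx : x = r
      · subst hx
        simp [hn, eq_comm]
      · simp [hx]
    | neq x k' =>
      simp only [reduceCtorEq, false_or, SubstPlace.neq.injEq, substEnc]
      have hne : x ∈ F.inp ∪ F.frm → x ≠ r := by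
        rintro h rfl
        exact notMem_restr hF h hr
      by_cases hx : x ∈ F.inp ∪ F.frm
      · by_cases hkk : k' = k
        · subst hkk
          -- The place `[x≠k]` is only read: the consumed token is produced again.
          have : ∃ y ∈ F.inp ∪ F.frm, x = y ∧ k' = k' := ⟨x, hx, rfl, rfl⟩
          rw [update_of_ne (hne hx), if_pos this, if_pos ⟨hx, hk x⟩]
        · rw [update_of_ne (hne hx)]
          simp [hkk]
      · have : ¬ ∃ y ∈ F.inp ∪ F.frm, x = y ∧ k' = k := by
          rintro ⟨y, hy, rfl, -⟩
          exact hx hy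
        rw [if_neg this]
        simp only [hx, false_and, if_false]
    | neqRestr k' =>
      simp only [reduceCtorEq, and_false, exists_false, or_false, SubstPlace.neqRestr.injEq,
        substEnc]
      by_cases hkk : k' = k
      · subst hkk
        rw [if_pos ⟨r, hr, by simp⟩]
        simp [hk]
      · have : (∃ x ∈ F.restr, update η r (some (.inr k)) x = some (.inr k')) ↔
            ∃ x ∈ F.restr, η x = some (.inr k') := by
          refine exists_congr fun x => and_congr_right fun _ => ?_
          by_cases hx : x = r
          · subst hx
            simp [hn, Ne.symm hkk]
          · simp [hx]
        simp only [this]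
        simp [hkk]

/-- An arbitrary set `T` of satisfied tests is admitted so that parameter transfer and communication
are both covered. Tests do not interfere with the assignment, since `y` has no value and so none of
them concerns `y`. -/
theorem effect_map (hF : F.NormalForm) (hv : F.Valid η) {T : Set (Cmd 𝒩 F.pub ν)} {y : 𝒩}
    {b : F.pub ⊕ ν} (hy : y ∈ F.inp ∪ F.frm) (hn : η y = none)
    (hT : ∀ c ∈ T, ∃ x a, c = .test x a ∧ η x = some a) :
    F.Effect η (insert (.map y b) T) (update η y (some b)) := by
  have hr := notMem_restr hF hy
  classical
  have hpre : ∀ s, s ∈ F.cmdsPre (insert (.map y b) T) ↔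
      (∃ x a, .test x a ∈ T ∧ s = .eq x a) ∨ ∃ k, b = .inr k ∧ s = .neq y k := by
    intro s
    rw [mem_cmdsPre]
    constructor
    · rintro ⟨hs, c, rfl | hc, hsc⟩
      · cases b with
        | inl v => exact hsc.elim
        | inr k =>
          simp only [cmdPre, hr, if_false] at hsc
          exact .inr ⟨k, rfl, hsc⟩
      · obtain ⟨x, a, rfl, hx⟩ := hT c hc
        exact .inl ⟨x, a, hc, hsc⟩
    · rintro (⟨x, a, hc, rfl⟩ | ⟨k, rfl, rfl⟩)
      · obtain ⟨x', a', h, hx⟩ := hT _ hc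
        cases h
        exact ⟨hv.mem_substPlaces hF hx, _, .inr hc, rfl⟩
      · exact ⟨hy, _, .inl rfl, by simp [cmdPre, hr]⟩
  have hpost : ∀ s, s ∈ F.cmdsPost (insert (.map y b) T) ↔
      (∃ x a, .test x a ∈ T ∧ s = .eq x a) ∨ s = .eq y b := by
    intro s
    rw [mem_cmdsPost]
    constructor
    · rintro ⟨hs, c, rfl | hc, hsc⟩
      · cases b with
        | inl v => exact .inr hsc
        | inr k =>
          simp only [cmdPost, hr, if_false] at hsc
          exact .inr hsc
      · obtain ⟨x, a, rfl, hx⟩ := hT c hc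
        exact .inl ⟨x, a, hc, hsc⟩
    · rintro (⟨x, a, hc, rfl⟩ | rfl)
      · obtain ⟨x', a', h, hx⟩ := hT _ hc
        cases h
        exact ⟨hv.mem_substPlaces hF hx, _, .inr hc, rfl⟩
      · refine ⟨(mem_substPlaces_eq hF).2 ⟨Finset.mem_union_left _ hy, fun h => absurd h hr⟩, _,
          .inl rfl, ?_⟩
        cases b with
        | inl v => rfl
        | inr k => simp [cmdPost, hr]
  constructor
  · intro s hs
    rcases (hpre s).1 hs with ⟨x, a, hc, rfl⟩ | ⟨k, rfl, rfl⟩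
    · obtain ⟨x', a', h, hx⟩ := hT _ hc
      cases h
      exact substEnc_eq_pos.2 hx
    · simp only [substEnc]
      rw [if_pos ⟨hy, by simp [hn]⟩]
      exact one_pos
  · intro s
    simp only [hpre, hpost]
    cases s with
    | eq x a =>
      simp only [reduceCtorEq, and_false, exists_false, or_false, SubstPlace.eq.injEq, substEnc]
      have htest : (∃ x' a', Cmd.test x' a' ∈ T ∧ x = x' ∧ a = a') → η x = some a := by
        rintro ⟨_, _, hc, rfl, rfl⟩
        obtain ⟨x', a', h, hx⟩ := hT _ hc
        cases h
        exact hx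
      by_cases hx : x = y
      · subst hx
        have : ¬ ∃ x' a', Cmd.test x' a' ∈ T ∧ x = x' ∧ a = a' := fun h => by
          have := htest h
          simp [hn] at this
        rw [if_neg this]
        simp only [this, false_or, update_self, hn]
        simp [eq_comm]
      · rw [update_of_ne hx]
        simp only [hx, false_and, or_false]
        split_ifs with h₁ h₂ h₂
        · rfl
        · rfl
        · exact absurd (htest h₂) h₁
        · rfl
    | neq x k' =>
      simp only [reduceCtorEq, false_or, SubstPlace.neq.injEq, substEnc, and_false, exists_false]
      by_cases hx : x = y
      · subst hx
        simp only [update_self, hy, true_and, hn]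
        by_cases hb : b = .inr k'
        · subst hb
          simp
        · have : ¬ ∃ k, b = .inr k ∧ k' = k := by
            rintro ⟨k, rfl, rfl⟩
            exact hb rfl
          rw [if_neg this]
          simp [hb]
      · rw [update_of_ne hx]
        simp [hx]
    | neqRestr k' =>
      simp only [reduceCtorEq, and_false, exists_false, or_false, substEnc]
      have : (∃ x ∈ F.restr, update η y (some b) x = some (.inr k')) ↔
            ∃ x ∈ F.restr, η x = some (.inr k') := by
        refine exists_congr fun x => and_congr_right fun hx => ?_
        rw [update_of_ne (by rintro rfl; exact hr hx)]
      simp only [this]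
      simp

theorem effect_unmap (hF : F.NormalForm) (hv : F.Valid η) {x : 𝒩} {a : F.pub ⊕ ν}
    (hx : η x = some a) : F.Effect η {.unmap x a} (update η x none) := by
  have hV := hv.supp x (by simp [hx])
  classical
  have hpre : ∀ s, s ∈ F.cmdsPre {Cmd.unmap x a} ↔ s = .eq x a := by
    intro s
    rw [mem_cmdsPre]
    simp only [Set.mem_singleton_iff, exists_eq_left, cmdPre]
    refine and_iff_right_of_imp ?_
    rintro rfl
    exact hv.mem_substPlaces hF hx
  have hpost : ∀ s, s ∈ F.cmdsPost {Cmd.unmap x a} ↔ ∃ k, a = .inr k ∧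
      ((x ∈ F.restr ∧ s = .neqRestr k) ∨ (x ∈ F.inp ∪ F.frm ∧ s = .neq x k)) := by
    intro s
    rw [mem_cmdsPost]
    simp only [Set.mem_singleton_iff, exists_eq_left]
    cases a with
    | inl v => simp [cmdPost]
    | inr k =>
      simp only [cmdPost, Sum.inr.injEq]
      by_cases hr : x ∈ F.restr
      · have := restr_notMem_inp_frm hF hr
        simp only [hr, if_true, Set.mem_singleton_iff, true_and, this, false_and, or_false,
          exists_eq_left']
        exact and_iff_right_of_imp (by rintro rfl; trivial)
      · have : x ∈ F.inp ∪ F.frm := (Finset.mem_union.1 hV).resolve_right hr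
        simp only [hr, if_false, Set.mem_singleton_iff, false_and, this, true_and, false_or,
          exists_eq_left']
        exact and_iff_right_of_imp (by rintro rfl; exact this)
  constructor
  · intro s hs
    rw [(hpre s).1 hs]
    exact substEnc_eq_pos.2 hx
  · intro s
    simp only [hpre, hpost]
    cases s with
    | eq x' a' =>
      simp only [reduceCtorEq, and_false, exists_false, or_false, SubstPlace.eq.injEq, substEnc]
      by_cases hxx : x' = x
      · subst hxx
        simp [hx, eq_comm]
      · simp [hxx]
    | neq x' k =>
      simp only [reduceCtorEq, and_false, false_or, SubstPlace.neq.injEq, substEnc]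
      by_cases hxx : x' = x
      · subst hxx
        by_cases hV' : x' ∈ F.inp ∪ F.frm
        · simp only [update_self, hV', hx, true_and]
          by_cases hk : a = .inr k
          · subst hk; simp
          · simp [hk]
        · simp only [hV', false_and, and_false, exists_false, if_false]
      · simp [hxx]
    | neqRestr k =>
      simp only [reduceCtorEq, and_false, or_false, SubstPlace.neqRestr.injEq, substEnc, if_false,
        Nat.sub_zero]
      by_cases hk : x ∈ F.restr ∧ a = .inr k
      · obtain ⟨hr, rfl⟩ := hk
        -- Injectivity on restricted names: after `x` is forgotten no other restricted name has the
        -- value `k`, so the token belongs on `[r_*≠k]`.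
        have h₁ : ¬ ∃ y ∈ F.restr, update η x none y = some (.inr k) := by
          rintro ⟨y, hy, h⟩
          by_cases hyx : y = x
          · subst hyx; simp at h
          · rw [update_of_ne hyx] at h
            exact hyx (hv.inj y hy x hr (by simp [h]) (h.trans hx.symm))
        rw [if_neg h₁, if_pos ⟨x, hr, hx⟩, if_pos ⟨k, rfl, hr, rfl⟩]
      · have h₁ : ¬ ∃ k', a = .inr k' ∧ x ∈ F.restr ∧ k = k' := by
          rintro ⟨k', rfl, hr, rfl⟩
          exact hk ⟨hr, rfl⟩
        have h₂ : (∃ y ∈ F.restr, update η x none y = some (.inr k)) ↔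
            ∃ y ∈ F.restr, η y = some (.inr k) := by
          refine exists_congr fun y => and_congr_right fun hy => ?_
          by_cases hyx : y = x
          · subst hyx
            simp only [update_self, hx, reduceCtorEq, Option.some.injEq, false_iff]
            exact fun h => hk ⟨hy, h⟩
          · rw [update_of_ne hyx]
        simp only [h₁, h₂, if_false, Nat.add_zero]

end Effects

end Spec

end Encoding

/-! # The process of a state -/

section States

variable {𝒩 PID : Type*} [LinearOrder 𝒩] [Infinite 𝒩] {n : ℕ}

open Function

namespace Spec

variable {ν : Type*} {F : Spec 𝒩 PID n}

/-- The name that is denoted by `x` if fresh names are interpreted by `g`. -/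
def val (g : ν → 𝒩) (η : 𝒩 → Option (F.pub ⊕ ν)) (x : 𝒩) : 𝒩 :=
  (η x).elim x (Sum.elim Subtype.val g)

theorem val_update (g : ν → 𝒩) (η : 𝒩 → Option (F.pub ⊕ ν)) (y : 𝒩) (b : F.pub ⊕ ν) :
    val g (update η y (some b)) = update (val g η) y (Sum.elim Subtype.val g b) := by
  funext x
  by_cases hx : x = y
  · subst hx; simp [val]
  · simp [val, hx]

theorem val_of_eq {g : ν → 𝒩} {η : 𝒩 → Option (F.pub ⊕ ν)} {x : 𝒩} {a : F.pub ⊕ ν}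
    (h : η x = some a) : val g η x = Sum.elim Subtype.val g a := by simp [val, h]

/-- The class of the process of a control state. -/
noncomputable def comp (g : ν → 𝒩) (η : 𝒩 → Option (F.pub ⊕ ν)) (q : Aug 𝒩 PID) : Cls 𝒩 PID :=
  ((F.complete q.1).subst (val g η)).cls

theorem comp_congr {g : ν → 𝒩} {η η' : 𝒩 → Option (F.pub ⊕ ν)} {q : Aug 𝒩 PID}
    (h : ∀ x ∈ F.live q, η x = η' x) : comp g η q = comp g η' q := by
  refine congrArg Proc.cls (Proc.subst_congr fun x hx => ?_)
  rw [val, val, h x (Finset.mem_union_left _ hx)]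

/-- The class of the process of a state. -/
noncomputable def sem [Fintype ν] (g : ν → 𝒩) (p : Fin n → Aug 𝒩 PID)
    (η : 𝒩 → Option (F.pub ⊕ ν)) : Cls 𝒩 PID :=
  Cls.nu (Finset.univ.image g) (∑ i, comp g η (p i))

variable [Fintype PID]

/-- The states that occur in reachable markings: exactly the live names have values. -/
structure Inv (F : Spec 𝒩 PID n) (p : Fin n → Aug 𝒩 PID) (η : 𝒩 → Option (F.pub ⊕ ν)) :
    Prop where
  reach : ∀ i, F.CReach ν i (p i)
  valid : F.Valid η
  live : ∀ x, η x ≠ none ↔ ∃ i, x ∈ F.live (p i)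

/-! ### Preservation of the invariant under control steps and assignments. -/

section Updates

variable {p : Fin n → Aug 𝒩 PID} {η : 𝒩 → Option (F.pub ⊕ ν)} {i : Fin n} {q : Aug 𝒩 PID}

theorem Inv.exists_eq (h : F.Inv p η) {x : 𝒩} (hx : x ∈ F.live (p i)) : ∃ a, η x = some a :=
  Option.ne_none_iff_exists'.1 ((h.live x).2 ⟨i, hx⟩)

theorem Inv.mem_names (h : F.Inv p η) {x : 𝒩} (hx : x ∈ F.live (p i)) :
    x ∈ F.inp ∪ F.frm ∪ F.restr := h.valid.supp x ((h.live x).2 ⟨i, hx⟩)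

theorem Inv.notMem_live (hF : F.NormalForm) (h : F.Inv p η) {y : 𝒩} (hy : y ∈ F.threadNames i)
    {j : Fin n} (hj : j ≠ i) : y ∉ F.live (p j) := fun h' =>
  threadNames_disjoint hF hj.symm hy (((h.reach j).typed hF).live_subset hF h')

theorem Inv.eq_none (hF : F.NormalForm) (h : F.Inv p η) {y : 𝒩} (hy : y ∈ F.threadNames i)
    (hy' : y ∉ F.live (p i)) : η y = none := by
  by_contra hn
  obtain ⟨j, hj⟩ := (h.live y).1 hn
  by_cases hji : j = i
  · exact hy' (hji ▸ hj)
  · exact h.notMem_live hF hy hji hj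

theorem Inv.control (h : F.Inv p η) (hq : F.CReach ν i q) (hl : F.live q = F.live (p i)) :
    F.Inv (update p i q) η where
  reach j := by
    by_cases hj : j = i
    · subst hj; simpa using hq
    · simpa [hj] using h.reach j
  valid := h.valid
  live x := by
    rw [h.live]
    refine exists_congr fun j => ?_
    by_cases hj : j = i
    · subst hj; simp [hl]
    · simp [hj]

theorem Inv.assign (h : F.Inv p η) (hq : F.CReach ν i q) {y : 𝒩} {b : F.pub ⊕ ν}
    (hv : F.Valid (update η y (some b))) (hl : F.live q = insert y (F.live (p i))) :
    F.Inv (update p i q) (update η y (some b)) where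
  reach j := by
    by_cases hj : j = i
    · subst hj; simpa using hq
    · simpa [hj] using h.reach j
  valid := hv
  live x := by
    by_cases hx : x = y
    · subst hx
      simp only [update_self, ne_eq, reduceCtorEq, not_false_eq_true, true_iff]
      exact ⟨i, by simp [hl]⟩
    · rw [update_of_ne hx, h.live]
      refine exists_congr fun j => ?_
      by_cases hj : j = i
      · subst hj; simp [hl, hx]
      · simp [hj]

theorem Inv.forget (hF : F.NormalForm) (h : F.Inv p η) (hq : F.CReach ν i q) {y : 𝒩}
    (hv : F.Valid (update η y none)) (hy : y ∈ F.live (p i))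
    (hl : F.live q = (F.live (p i)).erase y) : F.Inv (update p i q) (update η y none) where
  reach j := by
    by_cases hj : j = i
    · subst hj; simpa using hq
    · simpa [hj] using h.reach j
  valid := hv
  live x := by
    by_cases hx : x = y
    · subst hx
      simp only [update_self, ne_eq, not_true_eq_false, false_iff, not_exists]
      intro j
      by_cases hj : j = i
      · subst hj; simp [hl]
      · rw [update_of_ne hj]
        exact h.notMem_live hF (((h.reach i).typed hF).live_subset hF hy) hj
    · rw [update_of_ne hx, h.live]
      refine exists_congr fun j => ?_
      by_cases hj : j = i
      · subst hj; simp [hl, hx]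
      · simp [hj]

theorem Valid.assign (hF : F.NormalForm) (h : F.Valid η) {y : 𝒩} (hy : y ∈ F.inp ∪ F.frm)
    (b : F.pub ⊕ ν) : F.Valid (update η y (some b)) where
  supp x hx := by
    by_cases hxy : x = y
    · subst hxy; exact Finset.mem_union_left _ hy
    · rw [update_of_ne hxy] at hx; exact h.supp x hx
  restr x hx a ha := by
    have hxy : x ≠ y := by rintro rfl; exact notMem_restr hF hy hx
    rw [update_of_ne hxy] at ha
    exact h.restr x hx a ha
  inj x hx z hz hn he := by
    have hxy : x ≠ y := by rintro rfl; exact notMem_restr hF hy hx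
    have hzy : z ≠ y := by rintro rfl; exact notMem_restr hF hy hz
    rw [update_of_ne hxy] at hn he
    rw [update_of_ne hzy] at he
    exact h.inj x hx z hz hn he

theorem Valid.assign_restr (h : F.Valid η) {r : 𝒩} (hr : r ∈ F.restr) {k : ν}
    (hk : ∀ x, η x ≠ some (.inr k)) : F.Valid (update η r (some (.inr k))) where
  supp x hx := by
    by_cases hxr : x = r
    · subst hxr; exact Finset.mem_union_right _ hr
    · rw [update_of_ne hxr] at hx; exact h.supp x hx
  restr x hx a ha := by
    by_cases hxr : x = r
    · subst hxr
      rw [update_self] at ha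
      exact ⟨k, (Option.some.inj ha).symm⟩
    · rw [update_of_ne hxr] at ha
      exact h.restr x hx a ha
  inj x hx z hz hn he := by
    by_cases hxr : x = r <;> by_cases hzr : z = r
    · rw [hxr, hzr]
    · subst hxr
      rw [update_self, update_of_ne hzr] at he
      exact absurd he.symm (hk z)
    · subst hzr
      rw [update_self, update_of_ne hxr] at he
      exact absurd he (hk x)
    · rw [update_of_ne hxr] at hn he
      rw [update_of_ne hzr] at he
      exact h.inj x hx z hz hn he

theorem Valid.forget (h : F.Valid η) (y : 𝒩) : F.Valid (update η y none) where
  supp x hx := by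
    by_cases hxy : x = y
    · subst hxy; simp at hx
    · rw [update_of_ne hxy] at hx; exact h.supp x hx
  restr x hx a ha := by
    by_cases hxy : x = y
    · subst hxy; simp at ha
    · rw [update_of_ne hxy] at ha; exact h.restr x hx a ha
  inj x hx z hz hn he := by
    by_cases hxy : x = y
    · subst hxy; simp at hn
    · rw [update_of_ne hxy] at hn he
      by_cases hzy : z = y
      · subst hzy
        rw [update_self] at he
        exact absurd he hn
      · rw [update_of_ne hzy] at he
        exact h.inj x hx z hz hn he

variable {g : ν → 𝒩}

theorem sum_comp_update {η' : 𝒩 → Option (F.pub ⊕ ν)}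
    (h : ∀ j ≠ i, ∀ x ∈ F.live (p j), η' x = η x) :
    ∑ j, comp g η' (update p i q j) =
      comp g η' q + ∑ j ∈ Finset.univ.erase i, comp g η (p j) := by
  rw [← Finset.add_sum_erase _ _ (Finset.mem_univ i), update_self]
  congr 1
  refine Finset.sum_congr rfl fun j hj => ?_
  rw [update_of_ne (Finset.ne_of_mem_erase hj)]
  exact comp_congr (h j (Finset.ne_of_mem_erase hj))

theorem Inv.update_eq (hF : F.NormalForm) (h : F.Inv p η) {y : 𝒩} (hy : y ∈ F.threadNames i)
    (o : Option (F.pub ⊕ ν)) : ∀ j ≠ i, ∀ x ∈ F.live (p j), update η y o x = η x := by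
  intro j hj x hx
  refine update_of_ne ?_ _ _
  rintro rfl
  exact h.notMem_live hF hy hj hx

theorem sum_comp_eq (i : Fin n) : ∑ j, comp g η (p j) =
    comp g η (p i) + ∑ j ∈ Finset.univ.erase i, comp g η (p j) :=
  (Finset.add_sum_erase _ _ (Finset.mem_univ i)).symm

end Updates

/-! ### The rules acting on states and on the classes these denote. -/

section Rules

variable [Fintype ν] {p : Fin n → Aug 𝒩 PID} {η : 𝒩 → Option (F.pub ⊕ ν)} {i : Fin n}
  {g : ν → 𝒩} (hF : F.NormalForm) (h : F.Inv p η)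
include hF h

/-- The restriction of the thread is instantiated by `g k`, extruded across the other threads and
absorbed by the restrictions that `sem` carries anyway. -/
theorem Inv.nu {r : 𝒩} {S : Proc 𝒩 PID} {l : List 𝒩} (hp : p i = (.res r S, l)) {k : ν}
    (hk : ∀ x, η x ≠ some (.inr k)) (hg : Injective g) (hpub : ∀ k, g k ∉ F.pub) :
    F.Effect η {.map r (.inr k)} (update η r (some (.inr k))) ∧
      F.Inv (update p i (S, l)) (update η r (some (.inr k))) ∧
      sem g (update p i (S, l)) (update η r (some (.inr k))) = sem g p η := by
  have hreach := h.reach i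
  rw [hp] at hreach
  obtain ⟨ht, hc, hr, hrt, hrl, hl⟩ := (hreach.typed hF).nu hF
  have hn : η r = none := h.eq_none hF hrt (hp ▸ hrl)
  refine ⟨effect_map_restr hF hr hn hk,
    h.assign (hreach.step (.nu r S l k)) (h.valid.assign_restr hr hk) (hp ▸ hl), ?_⟩
  -- No live name denotes `g k`: it is not public, and `k` is no value of `η`. Hence neither the
  -- instantiation nor the extrusion captures anything.
  have hval : ∀ x, (∃ j, x ∈ F.live (p j)) → val g η x ≠ g k := by
    rintro x ⟨j, hj⟩ hx
    obtain ⟨a, ha⟩ := h.exists_eq hj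
    rw [val_of_eq ha] at hx
    cases a with
    | inl v => exact hpub k (hx ▸ v.2)
    | inr k' => exact hk x (by rw [ha, hg hx])
  have hk' : g k ∉ (S.fn.erase r).image (val g η) := by
    intro h'
    obtain ⟨x, hx, he⟩ := Finset.mem_image.1 h'
    refine hval x ⟨i, ?_⟩ he
    rw [hp]
    exact Finset.mem_union_left _ hx
  rw [sem, sem, sum_comp_update (h.update_eq hF hrt _), sum_comp_eq i, hp]
  have h₁ : comp g η (.res r S, l) =
      Cls.res (g k) (S.subst (update (val g η) r (g k))).cls := Proc.cls_subst_res hk'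
  have h₂ : comp g (update η r (some (.inr k))) (S, l) =
      (S.subst (update (val g η) r (g k))).cls := by
    rw [comp, hc, val_update]
    rfl
  rw [h₁, h₂, add_comm (Cls.res _ _), ← Cls.res_add, Cls.nu_res_of_mem, add_comm]
  · simp
  · intro h'
    obtain ⟨j, -, hj⟩ := (Cls.fn_sum _ _).1 h'
    rw [comp, Cls.fn_cls, Proc.fn_subst] at hj
    obtain ⟨x, hx, he⟩ := Finset.mem_image.1 hj
    exact hval x ⟨j, Finset.mem_union_left _ hx⟩ he

/-- The reaction serves the simulation of the net by processes. The explicit sum serves the converse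
direction, where a prescribed target class has to be reached. The same holds for `Inv.call₃` and
`Inv.comm`. -/
theorem Inv.tau {m : ℕ} {π : Fin m → Prefix 𝒩} {S : Fin m → Proc 𝒩 PID} {l : List 𝒩}
    (hp : p i = (.choice π S, l)) {k : Fin m} (hk : π k = .tau) :
    F.Inv (update p i (S k, l ++ forgotten (.choice π S) (S k))) η ∧
    (∑ j, comp g η (update p i (S k, l ++ forgotten (.choice π S) (S k)) j) =
      ((S k).subst (val g η)).cls + ∑ j ∈ Finset.univ.erase i, comp g η (p j)) ∧
    F.ReactCls (sem g p η) (sem g (update p i (S k, l ++ forgotten (.choice π S) (S k))) η) := by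
  have hreach := h.reach i
  rw [hp] at hreach
  have ht := hreach.typed hF
  have hsum : ∑ j, comp g η (update p i (S k, l ++ forgotten (.choice π S) (S k)) j) =
      ((S k).subst (val g η)).cls + ∑ j ∈ Finset.univ.erase i, comp g η (p j) := by
    rw [sum_comp_update fun _ _ _ _ => rfl, comp, (ht.choice hF k).2]
  refine ⟨h.control (hreach.step (.tau π S l k hk)) ?_, hsum, ?_⟩
  · rw [hp]
    exact ht.live_choice hF (by simp [hk])
  · rw [sem, sem, hsum, sum_comp_eq i, hp]
    exact ((ReactCls.tau S hk _).add _).nu _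

/-- `complete` puts the formal parameter in the place of the transferred argument. Both have the
same value, so the denoted call does not change. -/
theorem Inv.call₁ {K : PID} {xs l : List 𝒩} {x f : 𝒩} {a : F.pub ⊕ ν}
    (hp : p i = (.call K (xs ++ [x]), l)) (hf : (F.formals K)[xs.length]? = some f)
    (ha : η x = some a) :
    F.Effect η {.test x a, .map f a} (update η f (some a)) ∧
    F.Inv (update p i (.call K xs, if x ∈ l then l else l ++ [x])) (update η f (some a)) ∧
    ∀ j, comp g (update η f (some a))
      (update p i (.call K xs, if x ∈ l then l else l ++ [x]) j) = comp g η (p j) := by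
  have hreach := h.reach i
  rw [hp] at hreach
  obtain ⟨ht, hc, hx, hfF, hft, hfl, hl⟩ := (hreach.typed hF).call₁ hF hf
  have hn : η f = none := h.eq_none hF hft (hp ▸ hfl)
  have hfF' : f ∈ F.inp ∪ F.frm := Finset.mem_union_right _ hfF
  refine ⟨?_, h.assign (hreach.step (.call₁ K xs x f l a hf (h.valid.mem_dom ha)
    fun h' => absurd h' (notMem_restr hF hfF'))) (h.valid.assign hF hfF' a) (hp ▸ hl), ?_⟩
  · rw [Set.pair_comm]
    refine effect_map hF h.valid hfF' hn ?_
    rintro _ rfl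
    exact ⟨x, a, rfl, ha⟩
  · intro j
    by_cases hj : j = i
    · subst hj
      rw [update_self, hp, comp, comp, hc]
      refine congrArg Proc.cls ?_
      simp only [complete, Proc.subst, List.length_append, List.length_singleton, List.map_append,
        List.map_cons, List.append_assoc, List.cons_append, List.nil_append]
      rw [val_update, update_self, val_of_eq ha]
      -- The parameter `f` occurs nowhere else in the call, so assigning it affects one position
      -- only.
      have hne : ∀ z, z ∈ xs ∨ z ∈ (F.formals K).drop (xs.length + 1) → z ≠ f := by
        rintro z hz rfl
        refine hfl (Finset.mem_union_left _ ?_)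
        simp only [complete, Proc.fn, List.length_append, List.length_singleton,
          List.mem_toFinset, List.mem_append]
        tauto
      have h₁ : xs.map (update (val g η) f (Sum.elim Subtype.val g a)) = xs.map (val g η) :=
        List.map_congr_left fun z hz => update_of_ne (hne z (.inl hz)) _ _
      have h₂ : ((F.formals K).drop (xs.length + 1)).map
          (update (val g η) f (Sum.elim Subtype.val g a)) =
          ((F.formals K).drop (xs.length + 1)).map (val g η) :=
        List.map_congr_left fun z hz => update_of_ne (hne z (.inr hz)) _ _
      rw [h₁, h₂]
    · rw [update_of_ne hj]
      exact comp_congr (h.update_eq hF hft _ j hj)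

/-- Once all arguments are transferred, the denoted call mentions only the formal parameters of `K`,
and a name to be forgotten is none of these. -/
theorem Inv.call₂ {K : PID} {l : List 𝒩} {x : 𝒩} {a : F.pub ⊕ ν}
    (hp : p i = (.call K [], x :: l)) (ha : η x = some a) :
    F.Effect η {.unmap x a} (update η x none) ∧
    F.Inv (update p i (.call K [], l)) (update η x none) ∧
    ∀ j, comp g (update η x none) (update p i (.call K [], l) j) = comp g η (p j) := by
  have hreach := h.reach i
  rw [hp] at hreach
  have htyped := hreach.typed hF
  obtain ⟨ht, hx, hxf, hl⟩ := htyped.call₂ hF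
  refine ⟨effect_unmap hF h.valid ha, h.forget hF (hreach.step (.call₂ K x l a
    (h.valid.mem_dom ha))) (h.valid.forget x) (hp ▸ hx) (hp ▸ hl), fun j => ?_⟩
  by_cases hj : j = i
  · subst hj
    rw [update_self, hp, comp, comp]
    refine congrArg Proc.cls (Proc.subst_congr fun y hy => ?_)
    have : y ≠ x := by
      rintro rfl
      exact hxf (by simpa [complete, Proc.fn] using hy)
    rw [val, val, update_of_ne this]
  · rw [update_of_ne hj]
    exact comp_congr (h.update_eq hF (htyped.live_subset hF hx) _ j hj)

theorem listSubst_formals_map {K : PID} {x : 𝒩} (σ : 𝒩 → 𝒩) (hx : x ∈ F.formals K) :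
    listSubst (F.formals K) ((F.formals K).map σ) x = σ x := by
  rw [listSubst_map σ rfl hx]
  congr 1
  generalize F.formals K = xs
  induction xs with
  | nil => rfl
  | cons y xs ih =>
    rw [listSubst]
    by_cases hxy : x = y
    · subst hxy; simp
    · rw [update_of_ne hxy, ih]

theorem Inv.call₃ {K : PID} (hp : p i = (.call K [], [])) :
    F.Inv (update p i (F.body K, [])) η ∧
    (∑ j, comp g η (update p i (F.body K, []) j) =
      ((F.body K).subst (listSubst (F.formals K) ((F.formals K).map (val g η)))).cls +
        ∑ j ∈ Finset.univ.erase i, comp g η (p j)) ∧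
    F.ReactCls (sem g p η) (sem g (update p i (F.body K, [])) η) := by
  have hreach := h.reach i
  rw [hp] at hreach
  obtain ⟨ht, hc, hl⟩ := (hreach.typed hF).call₃ hF
  have hsum : ∑ j, comp g η (update p i (F.body K, []) j) =
      ((F.body K).subst (listSubst (F.formals K) ((F.formals K).map (val g η)))).cls +
        ∑ j ∈ Finset.univ.erase i, comp g η (p j) := by
    rw [sum_comp_update fun _ _ _ _ => rfl, comp, hc]
    congr 2
    refine Proc.subst_congr fun x hx => (listSubst_formals_map hF h _ ?_).symm
    rw [(hF.body_ok K).fn_eq] at hx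
    exact List.mem_toFinset.1 hx
  refine ⟨h.control (hreach.step (.call₃ K)) (hp ▸ hl), hsum, ?_⟩
  rw [sem, sem, hsum, sum_comp_eq i, hp]
  have : comp g η (.call K [], []) = (Proc.call K ((F.formals K).map (val g η))).cls := by
    simp [comp, complete, Proc.subst]
  rw [this]
  exact ((ReactCls.call (by simp)).add _).nu _

theorem Inv.comm {j : Fin n} (hij : i ≠ j) {m m' : ℕ} {π : Fin m → Prefix 𝒩}
    {S : Fin m → Proc 𝒩 PID} {l : List 𝒩} {π' : Fin m' → Prefix 𝒩} {S' : Fin m' → Proc 𝒩 PID}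
    {l' : List 𝒩} (hp : p i = (.choice π S, l)) (hp' : p j = (.choice π' S', l'))
    {k : Fin m} {k' : Fin m'} {x y x' y' : 𝒩} (hk : π k = .out x y) (hk' : π' k' = .inp x' y')
    {a b : F.pub ⊕ ν} (hx : η x = some a) (hy : η y = some b) (hx' : η x' = some a) :
    F.Effect η ({.test x a, .test y b} ∪ {.test x' a, .map y' b}) (update η y' (some b)) ∧
    F.Inv (update (update p i (S k, l ++ forgotten (.choice π S) (S k))) j
      (S' k', l' ++ forgotten (.choice π' S') (S' k'))) (update η y' (some b)) ∧
    (∑ w, comp g (update η y' (some b)) (update (update p i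
      (S k, l ++ forgotten (.choice π S) (S k))) j
      (S' k', l' ++ forgotten (.choice π' S') (S' k')) w) =
      ((S' k').subst (update (val g η) y' (val g η y))).cls + ((S k).subst (val g η)).cls +
        ∑ w ∈ (Finset.univ.erase j).erase i, comp g η (p w)) ∧
    F.ReactCls (sem g p η) (sem g (update (update p i (S k, l ++ forgotten (.choice π S) (S k))) j
      (S' k', l' ++ forgotten (.choice π' S') (S' k'))) (update η y' (some b))) := by
  have hr := h.reach i
  have hr' := h.reach j
  rw [hp] at hr
  rw [hp'] at hr'
  have ht := hr.typed hF
  have ht' := hr'.typed hF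
  obtain ⟨hyi, hyt, hyl, hl'⟩ := ht'.live_inp hF hk'
  have hn : η y' = none := h.eq_none hF hyt (hp' ▸ hyl)
  have hyi' : y' ∈ F.inp ∪ F.frm := Finset.mem_union_left _ hyi
  -- The communication is split for the invariant: the sender moves without changing `η`, then the
  -- receiver moves and assigns its input name.
  have h₁ : F.Inv (update p i (S k, l ++ forgotten (.choice π S) (S k))) η := by
    refine h.control (hr.step (.snd π S l k x y a b hk (h.valid.mem_dom hx) (h.valid.mem_dom hy)))
      ?_
    rw [hp]
    exact ht.live_choice hF (by simp [hk])
  have h₂ := h₁.assign (i := j) (q := (S' k', l' ++ forgotten (.choice π' S') (S' k')))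
    (hr'.step (.rcv π' S' l' k' x' y' a b hk' (h.valid.mem_dom hx')
      fun h' => absurd h' (notMem_restr hF hyi')))
    (h.valid.assign hF hyi' b) (by rw [update_of_ne hij.symm, hp', hl'])
  have hsum : ∑ w, comp g (update η y' (some b)) (update (update p i
      (S k, l ++ forgotten (.choice π S) (S k))) j
      (S' k', l' ++ forgotten (.choice π' S') (S' k')) w) =
      ((S' k').subst (update (val g η) y' (val g η y))).cls + ((S k).subst (val g η)).cls +
        ∑ w ∈ (Finset.univ.erase j).erase i, comp g η (p w) := by
    rw [sum_comp_update (h₁.update_eq hF hyt _), comp, (ht'.choice hF k').2, val_update,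
      ← val_of_eq (g := g) hy, add_assoc,
      ← Finset.add_sum_erase _ _ (Finset.mem_erase.2 ⟨hij, Finset.mem_univ i⟩)]
    congr 2
    · rw [update_self, comp, (ht.choice hF k).2]
    · refine Finset.sum_congr rfl fun w hw => ?_
      rw [update_of_ne (Finset.ne_of_mem_erase hw)]
  refine ⟨?_, h₂, hsum, ?_⟩
  · have hC : ({.test x a, .test y b} ∪ {.test x' a, .map y' b} : Set (Cmd 𝒩 F.pub ν)) =
        insert (.map y' b) {.test x a, .test y b, .test x' a} := by
      ext c
      simp only [Set.mem_union, Set.mem_insert_iff, Set.mem_singleton_iff]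
      tauto
    rw [hC]
    refine effect_map hF h.valid hyi' hn ?_
    rintro _ (rfl | rfl | rfl)
    · exact ⟨x, a, rfl, hx⟩
    · exact ⟨y, b, rfl, hy⟩
    · exact ⟨x', a, rfl, hx'⟩
  · rw [sem, sem, hsum, sum_comp_eq j,
      ← Finset.add_sum_erase _ _ (Finset.mem_erase.2 ⟨hij, Finset.mem_univ i⟩), hp, hp',
      ← add_assoc]
    refine ((ReactCls.comm S' S hk' hk ?_).add _).nu _
    rw [val_of_eq hx, val_of_eq hx']

end Rules

end Spec

end States

/-! # Reachable markings encode states -/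

section Markings

variable {𝒩 PID : Type*} [LinearOrder 𝒩] [Infinite 𝒩] {n : ℕ}

open Function

namespace Spec

variable {ν : Type*} {F : Spec 𝒩 PID n} [Fintype PID] [Fintype ν]

theorem isSubstMarking_substEnc {η : 𝒩 → Option (F.pub ⊕ ν)} (hF : F.NormalForm)
    (h : F.Valid η) : F.IsSubstMarking ν (F.substEnc η) where
  supp s hs := by
    cases s with
    | eq x a =>
      simp only [substEnc]
      rw [if_neg fun hx => hs (h.mem_substPlaces hF hx)]
    | neq x k =>
      simp only [substEnc]
      rw [if_neg fun hx => hs hx.1]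
    | neqRestr k => exact absurd trivial hs
  rest k := by
    classical
    simp only [substEnc]
    split_ifs with hk
    · obtain ⟨r, hr, he⟩ := hk
      rw [Finset.sum_eq_single r]
      · simp [he]
      · intro r' hr' hne
        rw [if_neg]
        exact fun he' => hne (h.inj r' hr' r hr (by simp [he']) (he'.trans he.symm))
      · exact fun hr' => absurd hr hr'
    · rw [Finset.sum_eq_zero, add_zero]
      intro r hr
      rw [if_neg]
      exact fun he => hk ⟨r, hr, he⟩
  bind x hx := by
    classical
    simp only [substEnc]
    cases hηx : η x with
    | none => simp
    | some b => simp
  compl x hx k := by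
    classical
    simp only [substEnc, hx, true_and]
    by_cases hk : η x = some (.inr k) <;> simp [hk]

/-- The equations for substitution markings leave no freedom beyond the tokens on the places
`[x=a]`, at most one for each `x`. So the marking is determined by a partial valuation. -/
theorem IsSubstMarking.exists_eq_substEnc {M : SubstPlace 𝒩 F.pub ν → ℕ} (hF : F.NormalForm)
    (h : F.IsSubstMarking ν M) : ∃ η, F.Valid η ∧ M = F.substEnc η := by
  classical
  have hpos : ∀ {x a}, M (.eq x a) ≠ 0 → x ∈ F.inp ∪ F.frm ∪ F.restr ∧ a ∈ F.dom ν x := by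
    intro x a hx
    by_contra hn
    exact hx (h.supp _ fun h' => hn ((mem_substPlaces_eq hF).1 h'))
  have hle : ∀ x a, M (.eq x a) ≤ 1 := by
    intro x a
    by_cases hx : M (.eq x a) = 0
    · omega
    · exact (Finset.single_le_sum_of_canonicallyOrdered (f := fun a => M (.eq x a))
        (Finset.mem_univ a)).trans (h.bind x (hpos hx).1)
  have huniq : ∀ x a b, M (.eq x a) = 1 → M (.eq x b) = 1 → a = b := by
    intro x a b ha hb
    by_contra hab
    have h₁ := h.bind x (hpos (by omega : M (.eq x a) ≠ 0)).1
    have h₂ : ∑ c ∈ {a, b}, M (.eq x c) ≤ ∑ c, M (.eq x c) :=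
      Finset.sum_le_sum_of_subset (Finset.subset_univ _)
    rw [Finset.sum_pair hab] at h₂
    omega
  let η : 𝒩 → Option (F.pub ⊕ ν) := fun x =>
    if h : ∃ a, M (.eq x a) = 1 then some h.choose else none
  have hη : ∀ x a, η x = some a ↔ M (.eq x a) = 1 := by
    intro x a
    simp only [η]
    split_ifs with hx
    · rw [Option.some.injEq]
      exact ⟨fun e => e ▸ hx.choose_spec, fun e => huniq x _ _ hx.choose_spec e⟩
    · simp only [false_iff]
      exact fun e => hx ⟨a, e⟩
  have hηeq : ∀ x a, M (.eq x a) = if η x = some a then 1 else 0 := by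
    intro x a
    have := hle x a
    split_ifs with hx
    · exact (hη x a).1 hx
    · have := mt (hη x a).2 hx
      omega
  refine ⟨η, ⟨?_, ?_, ?_⟩, ?_⟩
  · intro x hx
    obtain ⟨a, ha⟩ := Option.ne_none_iff_exists'.1 hx
    exact (hpos (by rw [(hη x a).1 ha]; exact one_ne_zero)).1
  · intro x hx a ha
    exact (hpos (a := a) (by rw [(hη x a).1 ha]; exact one_ne_zero)).2 hx
  -- Two restricted names with the same value `k` would put two tokens on the places counted by
  -- `rest`.
  · intro x hx y hy hn he
    by_contra hxy
    obtain ⟨a, ha⟩ := Option.ne_none_iff_exists'.1 hn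
    have hax := (hη x a).1 ha
    have hay := (hη y a).1 (he ▸ ha)
    obtain ⟨k, rfl⟩ := (hpos (x := x) (a := a) (by omega)).2 hx
    have h₁ := h.rest k
    have h₂ : ∑ c ∈ {x, y}, M (.eq c (.inr k)) ≤ ∑ c ∈ F.restr, M (.eq c (.inr k)) := by
      refine Finset.sum_le_sum_of_subset fun z hz => ?_
      rcases Finset.mem_insert.1 hz with rfl | hz
      · exact hx
      · exact Finset.mem_singleton.1 hz ▸ hy
    rw [Finset.sum_pair hxy] at h₂
    omega
  · funext s
    cases s with
    | eq x a => exact hηeq x a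
    | neq x k =>
      simp only [substEnc]
      by_cases hx : x ∈ F.inp ∪ F.frm
      · have := h.compl x hx k
        rw [hηeq] at this
        by_cases hk : η x = some (.inr k)
        · simp only [hk, if_true] at this
          simp only [hk, ne_eq, not_true_eq_false, and_false, if_false]
          omega
        · simp only [hk, if_false] at this
          simp only [hx, hk, ne_eq, not_false_eq_true, and_true, if_true]
          omega
      · rw [if_neg fun h' => hx h'.1]
        exact h.supp _ hx
    | neqRestr k =>
      simp only [substEnc]
      have := h.rest k
      split_ifs with hk
      · obtain ⟨r, hr, he⟩ := hk
        have h₂ := Finset.single_le_sum_of_canonicallyOrdered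
          (f := fun c => M (.eq c (.inr k))) hr
        have := (hη _ _).1 he
        omega
      · rw [Finset.sum_eq_zero] at this
        · omega
        · intro r hr
          rw [hηeq, if_neg fun he => hk ⟨r, hr, he⟩]

variable {M : SubstPlace 𝒩 F.pub ν → ℕ} {hM : F.InitialSubstMarking ν M}

/-- Correspondence gives values to exactly the formal parameters of the initial threads, and these
are the names that are live initially. -/
theorem exists_initial_state (hF : F.NormalForm) (hM : F.InitialSubstMarking ν M) :
    ∃ η, (F.net hM).M₀ = F.enc (fun i => (F.body₀ i, [])) η ∧
      F.Inv (fun i => (F.body₀ i, [])) η := by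
  obtain ⟨η, hv, he⟩ := hM.marking.exists_eq_substEnc hF
  refine ⟨η, ?_, fun i => .init, hv, fun x => ?_⟩
  · funext s
    rcases s with s | ⟨i, q⟩
    · exact congrFun he s
    · rfl
  · have hl : (∃ i, x ∈ F.live (F.body₀ i, [])) ↔ x ∈ ⋃ i, {x | x ∈ F.formals₀ i} := by
      simp only [live, complete_of_arityOK (hF.body₀_ok _).arity, (hF.body₀_ok _).fn_eq]
      simp
    rw [hl]
    constructor
    · intro hx
      by_contra hD
      obtain ⟨a, ha⟩ := Option.ne_none_iff_exists'.1 hx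
      have := hM.not_dom x (hv.supp x hx) hD a
      rw [he] at this
      have h' := substEnc_eq_pos.2 ha
      omega
    · intro hD
      have hpos : ∀ a, M (.eq x a) = 1 → η x ≠ none := by
        intro a ha
        rw [he] at ha
        have hx : η x = some a := substEnc_eq_pos.1 (by omega)
        simp [hx]
      rcases hM.dom_val x hD with h | h
      · exact hpos _ (hM.pub x hD h)
      · obtain ⟨k, hk⟩ := hM.restr x hD h
        exact hpos _ hk

/-! ### Every firing leads from encoded states to encoded states. -/

section Firing

variable {p : Fin n → Aug 𝒩 PID} {η : 𝒩 → Option (F.pub ⊕ ν)} {g : ν → 𝒩}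

omit [Fintype ν] in
theorem Step.isChoice_of_tau {p q : Aug 𝒩 PID} {l C} (h : F.Step ν .tau p l C q) :
    p.1.IsChoice := by
  cases h
  exact ⟨_, _, _, rfl⟩

omit [Fintype ν] in
theorem Step.eq_of_call₃ {p q : Aug 𝒩 PID} {l C} (h : F.Step ν .call₃ p l C q) :
    ∃ K, p = (.call K [], []) := by
  cases h
  exact ⟨_, rfl⟩

omit [Fintype ν] in
theorem not_isReaction {i : Fin n} {t : CTrans 𝒩 PID F.pub ν} (h₁ : ¬ t.src.1.IsChoice)
    (h₂ : ∀ K, t.src ≠ (.call K [], [])) : ¬ F.IsReaction (.single i t) := by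
  rintro (h | h)
  · exact h₁ h.isChoice_of_tau
  · obtain ⟨K, hK⟩ := h.eq_of_call₃
    exact h₂ K hK

/-- Enabledness forces the values in the commands to agree with `η`, so the transition is an
instance of a rule already analysed on states. Determinism of firing then identifies the successor
marking. -/
theorem Inv.of_fires (hF : F.NormalForm) (h : F.Inv p η) (hg : Injective g)
    (hpub : ∀ k, g k ∉ F.pub) {t : F.NTrans ν} {M' : F.NPlace ν → ℕ}
    (hf : (F.net hM).Fires (F.enc p η) t M') :
    ∃ p' η', M' = F.enc p' η' ∧ F.Inv p' η' ∧
      (F.IsReaction t → F.ReactCls (sem g p η) (sem g p' η')) ∧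
      (¬ F.IsReaction t → sem g p' η' = sem g p η) := by
  -- Each control net carries its only token on `p i`, so a marked input place must be that place.
  have hsrc : ∀ i q, (i, q) ∈ (ControlNet.parallel (F.threadNet ν)).pre t → p i = q := by
    intro i q hq
    have := hf.2.1 (.inr (i, q)) (inr_mem_net_pre.2 hq)
    simp only [enc] at this
    split_ifs at this with he
    · exact he.symm
    · exact absurd this (lt_irrefl 0)
  have hen : F.Enabled η ((ControlNet.parallel (F.threadNet ν)).cmd t) := fun s hs =>
    hf.2.1 (.inl s) (inl_mem_net_pre.2 hs)
  cases t with
  | single i t =>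
    obtain ⟨⟨hr, ρ, hs⟩, hl⟩ := hf.1
    have hp := hsrc i t.src (mem_parallel_pre_single.2 ⟨rfl, rfl⟩)
    change t.lab = .tau at hl
    change F.Enabled η t.cmd at hen
    have hres : ∀ η', F.Effect η t.cmd η' → M' = F.enc (update p i t.tgt) η' := fun η' he =>
      hf.unique (fires_single hr ⟨ρ, hs⟩ hl hp he)
    clear hf hsrc
    obtain ⟨src, lab, C, tgt⟩ := t
    simp only at hr hs hl hp hen hres
    cases hs with
    | nu r S l k =>
      have hr' := ((hr.typed hF).nu hF).2.2.1
      have hk := hen.map_restr h.valid rfl hr'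
      obtain ⟨he, hi, hsem⟩ := h.nu hF hp hk hg hpub
      refine ⟨_, _, hres _ he, hi, fun hre => absurd hre (not_isReaction ?_ ?_), fun _ => hsem⟩
      · rintro ⟨_, _, _, h⟩; cases h
      · intro K h; cases h
    | tau π S l k hk =>
      obtain ⟨hi, -, hre⟩ := h.tau (g := g) hF hp hk
      exact ⟨_, _, hres _ effect_empty, hi, fun _ => hre,
        fun hn => absurd (.inl (.tau π S l k hk)) hn⟩
    | snd => cases hl
    | rcv => cases hl
    | call₁ K xs x f l a hf ha haf =>
      have hx := ((hr.typed hF).call₁ hF hf).2.2.1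
      rw [← hp] at hx
      have hxa := hen.test hF (.inl rfl) (h.mem_names hx) ha
      obtain ⟨he, hi, hc⟩ := h.call₁ (g := g) hF hp hf hxa
      refine ⟨_, _, hres _ he, hi, fun hre => absurd hre (not_isReaction ?_ ?_), fun _ => ?_⟩
      · rintro ⟨_, _, _, h⟩; cases h
      · intro K h
        simp at h
      · simp only [sem, hc]
    | call₂ K x l a ha =>
      have hx := ((hr.typed hF).call₂ hF).2.1
      rw [← hp] at hx
      have hxa := hen.unmap hF rfl (h.mem_names hx) ha
      obtain ⟨he, hi, hc⟩ := h.call₂ (g := g) hF hp hxa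
      refine ⟨_, _, hres _ he, hi, fun hre => absurd hre (not_isReaction ?_ ?_), fun _ => ?_⟩
      · rintro ⟨_, _, _, h⟩; cases h
      · intro K h
        simp at h
      · simp only [sem, hc]
    | call₃ K =>
      obtain ⟨hi, -, hre⟩ := h.call₃ (g := g) hF hp
      exact ⟨_, _, hres _ effect_empty, hi, fun _ => hre,
        fun hn => absurd (.inr (.call₃ K)) hn⟩
  | sync i t j t' =>
    obtain ⟨⟨hij, ⟨hr, ρ, hs⟩, ⟨hr', ρ', hs'⟩, a, b, hl, hl'⟩, -⟩ := hf.1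
    have hp := hsrc i t.src (mem_parallel_pre_sync.2 (.inl ⟨rfl, rfl⟩))
    have hp' := hsrc j t'.src (mem_parallel_pre_sync.2 (.inr ⟨rfl, rfl⟩))
    change t.lab = .send a b at hl
    change t'.lab = .rcv a b at hl'
    have hcmd : (ControlNet.parallel (F.threadNet ν)).cmd (.sync i t j t') = t.cmd ∪ t'.cmd := rfl
    rw [hcmd] at hen
    have hres : ∀ η', F.Effect η (t.cmd ∪ t'.cmd) η' →
        M' = F.enc (update (update p i t.tgt) j t'.tgt) η' := fun η' he =>
      hf.unique (fires_sync hij hr hr' ⟨ρ, hs⟩ ⟨ρ', hs'⟩ ⟨a, b, hl, hl'⟩ hp hp' he)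
    clear hf hsrc hcmd
    obtain ⟨src, lab, C, tgt⟩ := t
    obtain ⟨src', lab', C', tgt'⟩ := t'
    simp only at hr hr' hs hs' hl hl' hp hp' hen hres
    subst hl hl'
    cases hs with
    | snd π S l k x y _ _ hk ha hb =>
    cases hs' with
    | rcv π' S' l' k' x' y' _ _ hk' ha' hb' =>
    have hx : x ∈ F.live (p i) := by
      rw [hp]
      exact subset_live_choice k (by simp [hk, Prefix.scopeFn])
    have hy : y ∈ F.live (p i) := by
      rw [hp]
      exact subset_live_choice k (by simp [hk, Prefix.scopeFn])
    have hx' : x' ∈ F.live (p j) := by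
      rw [hp']
      exact subset_live_choice k' (by simp [hk', Prefix.scopeFn])
    have hxa := hen.test hF (.inl (.inl rfl)) (h.mem_names hx) ha
    have hyb := hen.test hF (.inl (.inr rfl)) (h.mem_names hy) hb
    have hxa' := hen.test hF (.inr (.inl rfl)) (h.mem_names hx') ha'
    obtain ⟨he, hi, -, hre⟩ := h.comm (g := g) hF hij hp hp' hk hk' hxa hyb hxa'
    exact ⟨_, _, hres _ he, hi, fun _ => hre, fun hn => absurd trivial hn⟩

theorem Inv.of_firesSeq (hF : F.NormalForm) (h : F.Inv p η) (hg : Injective g)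
    (hpub : ∀ k, g k ∉ F.pub) {ts : List (F.NTrans ν)} {M' : F.NPlace ν → ℕ}
    (hf : (F.net hM).FiresSeq (F.enc p η) ts M') :
    ∃ p' η', M' = F.enc p' η' ∧ F.Inv p' η' ∧
      ((∀ u ∈ ts, ¬ F.IsReaction u) → sem g p' η' = sem g p η) := by
  generalize hM₁ : F.enc p η = M₁ at hf
  induction hf generalizing p η with
  | nil => exact ⟨p, η, hM₁.symm, h, fun _ => rfl⟩
  | cons hf _ ih =>
    subst hM₁
    obtain ⟨p₁, η₁, rfl, hi, -, hsem⟩ := h.of_fires hF hg hpub hf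
    obtain ⟨p₂, η₂, hM₂, hi', hsem'⟩ := ih hi rfl
    refine ⟨p₂, η₂, hM₂, hi', fun hu => ?_⟩
    rw [hsem' fun u hu' => hu u (List.mem_cons_of_mem _ hu'), hsem (hu _ List.mem_cons_self)]

end Firing

end Spec

end Markings

/-! # Runs without reactions -/

section Runs

variable {𝒩 PID : Type*} [LinearOrder 𝒩] [Infinite 𝒩] {n : ℕ}

open Function

namespace Spec

variable {ν : Type*} {F : Spec 𝒩 PID n} [Fintype PID] [Fintype ν]
  {M : SubstPlace 𝒩 F.pub ν → ℕ} {hM : F.InitialSubstMarking ν M}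

/-- A transition sequence without reactions leads from one marking to another one. -/
def SilentRun (hM : F.InitialSubstMarking ν M) (M₁ M₂ : F.NPlace ν → ℕ) : Prop :=
  ∃ ts, (F.net hM).FiresSeq M₁ ts M₂ ∧ ∀ u ∈ ts, ¬ F.IsReaction u

theorem SilentRun.refl (M₁ : F.NPlace ν → ℕ) : SilentRun hM M₁ M₁ := ⟨[], .nil _, by simp⟩

theorem SilentRun.head {M₁ M₂ M₃ : F.NPlace ν → ℕ} {t : F.NTrans ν}
    (h : (F.net hM).Fires M₁ t M₂) (ht : ¬ F.IsReaction t) (h' : SilentRun hM M₂ M₃) :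
    SilentRun hM M₁ M₃ := by
  obtain ⟨ts, h₁, h₂⟩ := h'
  exact ⟨t :: ts, .cons h h₁, by simpa using ⟨ht, h₂⟩⟩

theorem SilentRun.trans {M₁ M₂ M₃ : F.NPlace ν → ℕ} (h : SilentRun hM M₁ M₂)
    (h' : SilentRun hM M₂ M₃) : SilentRun hM M₁ M₃ := by
  obtain ⟨ts, h₁, h₂⟩ := h
  obtain ⟨ts', h₁', h₂'⟩ := h'
  exact ⟨ts ++ ts', h₁.append h₁', fun u hu => (List.mem_append.1 hu).elim (h₂ u) (h₂' u)⟩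

/-- A race free run consists of a reaction between two runs without reactions. -/
theorem stableTS_step_of_silentRun {M₁ M₂ M₃ M₄ : F.NPlace ν → ℕ} {t : F.NTrans ν}
    (h : SilentRun hM M₁ M₂) (hf : (F.net hM).Fires M₂ t M₃) (ht : F.IsReaction t)
    (h' : SilentRun hM M₃ M₄) : (F.stableTS hM).step M₁ M₄ := by
  obtain ⟨ts, h₁, h₂⟩ := h
  obtain ⟨ts', h₁', h₂'⟩ := h'
  exact ⟨ts ++ t :: ts', h₁.append (.cons hf h₁'), ts, t, ts', rfl, ht, h₂, h₂'⟩

variable {p : Fin n → Aug 𝒩 PID} {η : 𝒩 → Option (F.pub ⊕ ν)} {g : ν → 𝒩} {i : Fin n}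

/-- Pigeonhole: each name has at most one value and `r` has none. The values in use are therefore
fewer than the names, and a fresh value is left over. -/
theorem Inv.exists_fresh (h : F.Inv p η)
    (hν : F.restr.card + F.inp.card + F.frm.card ≤ Fintype.card ν) {r : 𝒩} (hr : r ∈ F.restr)
    (hn : η r = none) : ∃ k, ∀ x, η x ≠ some (.inr k) := by
  classical
  by_contra! hcon
  let V := F.inp ∪ F.frm ∪ F.restr
  have hV : V.card ≤ Fintype.card ν := by
    have h₁ := Finset.card_union_le (F.inp ∪ F.frm) F.restr
    have h₂ := Finset.card_union_le F.inp F.frm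
    have : V.card = (F.inp ∪ F.frm ∪ F.restr).card := rfl
    omega
  have hsub : (Finset.univ : Finset ν) ⊆
      (V.erase r).biUnion fun x => Finset.univ.filter fun k => η x = some (.inr k) := by
    intro k _
    obtain ⟨x, hx⟩ := hcon k
    refine Finset.mem_biUnion.2 ⟨x, Finset.mem_erase.2 ⟨?_, h.valid.supp x (by simp [hx])⟩,
      by simp [hx]⟩
    rintro rfl
    simp [hn] at hx
  have hcard := (Finset.card_le_card hsub).trans (Finset.card_biUnion_le_card_mul _ _ 1 fun x _ =>
    Finset.card_le_one.2 fun a ha b hb => by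
      have ha := (Finset.mem_filter.1 ha).2
      have hb := (Finset.mem_filter.1 hb).2
      simpa [ha] using hb)
  have hlt : (V.erase r).card < V.card :=
    Finset.card_erase_lt_of_mem (Finset.mem_union_right _ hr)
  rw [Finset.card_univ, mul_one] at hcard
  omega

/-- Leading restrictions are opened until a choice or a call appears. A restricted name has no value
before its restriction is opened, so `Inv.exists_fresh` applies each time. -/
theorem Inv.nu_run (hF : F.NormalForm)
    (hν : F.restr.card + F.inp.card + F.frm.card ≤ Fintype.card ν) (hg : Injective g)
    (hpub : ∀ k, g k ∉ F.pub) (hM : F.InitialSubstMarking ν M) {S : Proc 𝒩 PID} {l : List 𝒩}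
    (h : F.Inv p η) (hp : p i = (S, l)) (hS : S.IsThread)
    (hA : S.ArityOK fun K => (F.formals K).length) :
    ∃ p' η', SilentRun hM (F.enc p η) (F.enc p' η') ∧ F.Inv p' η' ∧ sem g p' η' = sem g p η ∧
      F.StablePlace (p' i) ∧ ∀ j ≠ i, p' j = p j := by
  induction S generalizing p η with
  | call K args =>
    exact ⟨p, η, .refl _, h, rfl, .inr ⟨K, args, by rw [hp], hA⟩, fun _ _ => rfl⟩
  | choice π S =>
    exact ⟨p, η, .refl _, h, rfl, .inl ⟨_, π, S, by rw [hp]⟩, fun _ _ => rfl⟩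
  | par => exact hS.elim
  | res r S ih =>
    have hreach := h.reach i
    rw [hp] at hreach
    obtain ⟨ht, hc, hr, hrt, hrl, hl⟩ := (hreach.typed hF).nu hF
    obtain ⟨k, hk⟩ := h.exists_fresh hν hr (h.eq_none hF hrt (hp ▸ hrl))
    obtain ⟨he, hi, hsem⟩ := h.nu hF hp hk hg hpub
    obtain ⟨p', η', hrun, hi', hsem', hst, hoth⟩ := ih hi (update_self ..) hS hA
    refine ⟨p', η', .head (fires_single (t := ⟨(.res r S, l), .tau, {.map r (.inr k)}, (S, l)⟩)
      hreach ⟨_, .nu r S l k⟩ rfl hp he) (not_isReaction ?_ ?_) hrun, hi', hsem'.trans hsem, hst,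
      fun j hj => by rw [hoth j hj, update_of_ne hj]⟩
    · rintro ⟨_, _, _, h⟩; cases h
    · intro K h; cases h

/-- All parameters of a call are transferred. -/
theorem Inv.call₁_run (hF : F.NormalForm) (g : ν → 𝒩) (hM : F.InitialSubstMarking ν M) {K : PID}
    {args l : List 𝒩} (h : F.Inv p η) (hp : p i = (.call K args, l)) :
    ∃ l' η', SilentRun hM (F.enc p η) (F.enc (update p i (.call K [], l')) η') ∧
      F.Inv (update p i (.call K [], l')) η' ∧
      ∀ j, comp g η' (update p i (.call K [], l') j) = comp g η (p j) := by
  induction args using List.reverseRecOn generalizing p η l with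
  | nil =>
    exact ⟨l, η, by rw [← hp, update_eq_self]; exact ⟨.refl _, h, fun _ => rfl⟩⟩
  | append_singleton xs x ih =>
    have hreach := h.reach i
    rw [hp] at hreach
    obtain ⟨e, he, hc⟩ := (hreach.typed hF).call
    have hlen := hc.len
    rw [List.length_append, List.length_singleton] at hlen
    have hf : (F.formals K)[xs.length]? = some ((F.formals K)[xs.length]'(by omega)) :=
      List.getElem?_eq_getElem _
    obtain ⟨ht, -, hx, hfF, -⟩ := (hreach.typed hF).call₁ hF hf
    obtain ⟨a, ha⟩ := h.exists_eq (i := i) (x := x) (hp ▸ hx)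
    obtain ⟨he, hi, hcomp⟩ := h.call₁ (g := g) hF hp hf ha
    obtain ⟨l', η', hrun, hi', hcomp'⟩ := ih hi (update_self ..)
    rw [update_idem] at hrun hi' hcomp'
    refine ⟨l', η', .head (fires_single (t := ⟨(.call K (xs ++ [x]), l), .tau, _, (.call K xs, _)⟩)
      hreach ⟨_, .call₁ K xs x _ l a hf (h.valid.mem_dom ha)
        fun h' => absurd h' (notMem_restr hF (Finset.mem_union_right _ hfF))⟩ rfl hp he)
      (not_isReaction ?_ ?_) hrun, hi', fun j => (hcomp' j).trans (hcomp j)⟩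
    · rintro ⟨_, _, _, h⟩; cases h
    · intro K h
      simp at h

/-- All names that are not needed any more are forgotten. -/
theorem Inv.call₂_run (hF : F.NormalForm) (g : ν → 𝒩) (hM : F.InitialSubstMarking ν M) {K : PID}
    {l : List 𝒩} (h : F.Inv p η) (hp : p i = (.call K [], l)) :
    ∃ η', SilentRun hM (F.enc p η) (F.enc (update p i (.call K [], [])) η') ∧
      F.Inv (update p i (.call K [], [])) η' ∧
      ∀ j, comp g η' (update p i (.call K [], []) j) = comp g η (p j) := by
  induction l generalizing p η with
  | nil => exact ⟨η, by rw [← hp, update_eq_self]; exact ⟨.refl _, h, fun _ => rfl⟩⟩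
  | cons x l ih =>
    have hreach := h.reach i
    rw [hp] at hreach
    obtain ⟨ht, hx, -⟩ := (hreach.typed hF).call₂ hF
    obtain ⟨a, ha⟩ := h.exists_eq (i := i) (x := x) (hp ▸ hx)
    obtain ⟨he, hi, hcomp⟩ := h.call₂ (g := g) hF hp ha
    obtain ⟨η', hrun, hi', hcomp'⟩ := ih hi (update_self ..)
    rw [update_idem] at hrun hi' hcomp'
    refine ⟨η', .head (fires_single (t := ⟨(.call K [], x :: l), .tau, _, (.call K [], l)⟩)
      hreach ⟨_, .call₂ K x l a (h.valid.mem_dom ha)⟩ rfl hp he)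
      (not_isReaction ?_ ?_) hrun, hi', fun j => (hcomp' j).trans (hcomp j)⟩
    · rintro ⟨_, _, _, h⟩; cases h
    · intro K h
      simp at h

end Spec

end Runs

/-! # The relation between processes and stable markings -/

section Relation

variable {𝒩 PID : Type*} [LinearOrder 𝒩] [Infinite 𝒩] {n : ℕ}

open Function

theorem Proc.prod_subst (Ps : List (Proc 𝒩 PID)) (σ : 𝒩 → 𝒩) :
    (Proc.prod Ps).subst σ = Proc.prod (Ps.map fun P => P.subst σ) := by
  induction Ps with
  | nil => exact Proc.subst_zero σ
  | cons P Ps ih => rw [Proc.prod, Proc.subst, ih]; rfl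

/-- Simultaneous `α`-conversion of a sequence of restrictions. -/
theorem Proc.cls_resList_subst {rs : List 𝒩} (hrs : rs.Nodup) {θ ρ : 𝒩 → 𝒩}
    (hθ : ∀ r ∈ rs, ∀ s ∈ rs, θ r = θ s → r = s) {P : Proc 𝒩 PID}
    (hd : ∀ r ∈ rs, θ r ∉ (Proc.resList rs P).fn.image ρ) :
    ((Proc.resList rs P).subst ρ).cls = Cls.nu (rs.toFinset.image θ)
      (P.subst fun y => if y ∈ rs then θ y else ρ y).cls := by
  induction rs generalizing ρ with
  | nil => simp [Proc.resList]
  | cons r rs ih =>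
    rw [List.nodup_cons] at hrs
    have hfn : (Proc.resList (r :: rs) P).fn = (Proc.resList rs P).fn.erase r := rfl
    have hr : θ r ∉ rs.toFinset.image θ := by
      intro h
      obtain ⟨s, hs, he⟩ := Finset.mem_image.1 h
      have hs := List.mem_toFinset.1 hs
      exact hrs.1 (hθ s (List.mem_cons_of_mem _ hs) r List.mem_cons_self he ▸ hs)
    rw [List.toFinset_cons, Finset.image_insert, Cls.nu_insert hr]
    change ((Proc.res r (Proc.resList rs P)).subst ρ).cls = _
    have hd' : θ r ∉ ((Proc.resList rs P).fn.erase r).image ρ := hd r List.mem_cons_self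
    rw [Proc.cls_subst_res hd', ih hrs.2 fun s hs t ht =>
      hθ s (List.mem_cons_of_mem _ hs) t (List.mem_cons_of_mem _ ht)]
    · congr 4
      funext y
      by_cases hy : y = r
      · subst hy
        simp [hrs.1]
      · simp [hy]
    · intro s hs h
      obtain ⟨x, hx, he⟩ := Finset.mem_image.1 h
      by_cases hxr : x = r
      · subst hxr
        rw [update_self] at he
        exact hr (Finset.mem_image.2 ⟨s, List.mem_toFinset.2 hs, he.symm⟩)
      · rw [update_of_ne hxr] at he
        refine hd s (List.mem_cons_of_mem _ hs) (Finset.mem_image.2 ⟨x, ?_, he⟩)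
        rw [hfn]
        exact Finset.mem_erase.2 ⟨hxr, hx⟩

namespace Spec

variable {ν : Type*} {F : Spec 𝒩 PID n}

theorem StablePlace.complete_eq {q : Aug 𝒩 PID} (h : F.StablePlace q) :
    F.complete q.1 = q.1 := by
  rcases h with ⟨m, π, S, h⟩ | ⟨K, args, h, hlen⟩
  · rw [h]; rfl
  · rw [h]
    simp [complete, hlen]

theorem StablePlace.mem_live {q : Aug 𝒩 PID} (h : F.StablePlace q) {x : 𝒩} :
    x ∈ F.live q ↔ x ∈ q.1.fn ∨ x ∈ q.2 := by
  simp [live, h.complete_eq]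

theorem StablePlace.comp_eq {q : Aug 𝒩 PID} (h : F.StablePlace q) (g : ν → 𝒩)
    (η : 𝒩 → Option (F.pub ⊕ ν)) : comp g η q = (q.1.subst (val g η)).cls := by
  rw [comp, h.complete_eq]

/-- The equation in question is that of the last executed call, or the initial one if there is none.
-/
theorem CReach.derived [Fintype PID] {i : Fin n} {q : Aug 𝒩 PID} (h : F.CReach ν i q) :
    (∃ j, F.Derived ν (F.body₀ j, []) q) ∨ ∃ K, F.Derived ν (F.body K, []) q := by
  induction h with
  | init => exact .inl ⟨i, .refl⟩
  | @step p q ρ l C _ hs ih =>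
    by_cases hρ : ρ = .call₃
    · subst hρ
      cases hs
      exact .inr ⟨_, .refl⟩
    · exact ih.imp (fun ⟨j, hj⟩ => ⟨j, hj.tail ⟨ρ, l, C, hρ, hs⟩⟩)
        (fun ⟨K, hK⟩ => ⟨K, hK.tail ⟨ρ, l, C, hρ, hs⟩⟩)

variable {p : Fin n → Aug 𝒩 PID} {η : 𝒩 → Option (F.pub ⊕ ν)} {g : ν → 𝒩}

theorem val_mem_or {x : 𝒩} {a : F.pub ⊕ ν} (h : η x = some a) :
    val g η x ∈ F.pub ∨ val g η x ∈ Set.range g := by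
  rw [val_of_eq h]
  cases a with
  | inl v => exact .inl v.2
  | inr k => exact .inr ⟨k, rfl⟩

theorem val_injective (hg : Injective g) (hpub : ∀ k, g k ∉ F.pub) {x y : 𝒩} {a b : F.pub ⊕ ν}
    (hx : η x = some a) (hy : η y = some b) (h : val g η x = val g η y) : a = b := by
  rw [val_of_eq hx, val_of_eq hy] at h
  cases a <;> cases b
  · exact congrArg _ (Subtype.ext h)
  · rename_i v k
    exact absurd (show g k ∈ F.pub from (show v.1 = g k from h) ▸ v.2) (hpub k)
  · rename_i k v
    exact absurd (show g k ∈ F.pub from (show g k = v.1 from h) ▸ v.2) (hpub k)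
  · exact congrArg _ (hg h)

variable [Fintype PID] [Fintype ν]

theorem Inv.corresponds (hF : F.NormalForm) (h : F.Inv p η) (hg : Injective g)
    (hpub : ∀ k, g k ∉ F.pub) {D : Set 𝒩} {σ : 𝒩 → 𝒩} (hD : ∀ x, x ∈ D ↔ η x ≠ none)
    (hσ : ∀ x ∈ D, σ x = val g η x) :
    F.Corresponds ν (Finset.univ.image g).toList D σ (F.substEnc η) := by
  classical
  have hsome : ∀ x ∈ D, ∃ a, η x = some a := fun x hx => Option.ne_none_iff_exists'.1 ((hD x).1 hx)
  have hmem : ∀ y, y ∈ (Finset.univ.image g).toList ↔ y ∈ Set.range g := by simp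
  have hrs : ∀ x ∈ D, σ x ∈ (Finset.univ.image g).toList → ∃ k, η x = some (.inr k) := by
    intro x hx h'
    rw [hmem, hσ x hx] at h'
    obtain ⟨k, hk⟩ := h'
    obtain ⟨a, ha⟩ := hsome x hx
    rw [val_of_eq ha] at hk
    cases a with
    | inl v => exact absurd (hk ▸ v.2) (hpub k)
    | inr k' => exact ⟨k', ha⟩
  refine ⟨isSubstMarking_substEnc hF h.valid, ?_, ?_, ?_, ?_, ?_, ?_, ?_, ?_⟩
  · exact fun x hx => h.valid.supp x ((hD x).1 hx)
  · intro x hx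
    obtain ⟨a, ha⟩ := hsome x hx
    rw [hmem, hσ x hx]
    exact val_mem_or ha
  · intro x hx hr
    obtain ⟨a, ha⟩ := hsome x hx
    obtain ⟨k, rfl⟩ := h.valid.restr x hr a ha
    rw [hmem, hσ x hx, val_of_eq ha]
    exact ⟨k, rfl⟩
  · intro x hx y hy hxr hyr he
    rw [hσ x hx, hσ y hy] at he
    obtain ⟨a, ha⟩ := hsome x hx
    obtain ⟨b, hb⟩ := hsome y hy
    exact h.valid.inj x hxr y hyr ((hD x).1 hx)
      (by rw [ha, hb, val_injective hg hpub ha hb he])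
  · intro x _ hx a
    rw [hD, ne_eq, not_not] at hx
    simp [substEnc, hx]
  · intro x hx hp
    obtain ⟨a, ha⟩ := hsome x hx
    simp only [hσ x hx, val_of_eq ha] at hp ⊢
    cases a with
    | inl v => simp [substEnc, ha]
    | inr k => exact absurd hp (hpub k)
  · intro x hx hr
    obtain ⟨k, hk⟩ := hrs x hx hr
    exact ⟨k, by simp [substEnc, hk]⟩
  · intro x hx y hy hxr hyr
    obtain ⟨k, hk⟩ := hrs x hx hxr
    obtain ⟨k', hk'⟩ := hrs y hy hyr
    rw [hσ x hx, hσ y hy, val_of_eq hk, val_of_eq hk']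
    simp only [substEnc, hk, hk', Option.some.injEq, Sum.inr.injEq, Sum.elim_inr]
    constructor
    · intro he w
      rw [hg he]
    · intro he
      have := he k
      rw [if_pos rfl] at this
      split_ifs at this with h'
      rw [h']

variable {M : SubstPlace 𝒩 F.pub ν → ℕ} {hM : F.InitialSubstMarking ν M}

theorem stableMarking_enc (hst : ∀ i, F.StablePlace (p i)) : F.StableMarking (F.enc p η) :=
  fun i => ⟨p i, hst i, by simp [enc]⟩

theorem stablePlace_of_stableMarking (h : F.StableMarking (F.enc p η)) (i : Fin n) :
    F.StablePlace (p i) := by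
  obtain ⟨q, hq, hpos⟩ := h i
  simp only [enc] at hpos
  split_ifs at hpos with he
  · exact he ▸ hq
  · exact absurd hpos (lt_irrefl 0)

/-- As restricted names of the standard form all names `g k` are taken, whether they are in use or
not. -/
theorem Inv.rel (hF : F.NormalForm) (h : F.Inv p η) (hg : Injective g)
    (hpub : ∀ k, g k ∉ F.pub) (hst : ∀ i, F.StablePlace (p i))
    (hq : sem g p η ∈ F.ts.states) (hM' : F.enc p η ∈ (F.stableTS hM).states) :
    F.Rel hM (sem g p η) (F.enc p η) := by
  classical
  let D : Fin n → Set 𝒩 := fun i => {x | x ∈ (p i).1.fn ∨ x ∈ (p i).2}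
  have hD : ∀ i x, x ∈ D i → x ∈ F.live (p i) := fun i x hx => (hst i).mem_live.2 hx
  let σ : Fin n → 𝒩 → 𝒩 := fun i x => if x ∈ D i then val g η x else x
  have hσ : ∀ i x, x ∈ D i → σ i x = val g η x := fun i x hx => if_pos hx
  refine ⟨hq, hM', (Finset.univ.image g).toList, fun i => (p i).1, fun i => (p i).2, σ,
    Finset.nodup_toList _, ?_, hst, fun i => (h.reach i).derived, ?_, fun i x hx => if_neg hx,
    ?_, ?_, ?_⟩
  · intro r hr
    obtain ⟨k, -, rfl⟩ := Finset.mem_image.1 (Finset.mem_toList.1 hr)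
    exact hpub k
  · intro i x hx
    obtain ⟨a, ha⟩ := h.exists_eq (hD i x hx)
    rw [hσ i x hx, or_comm, Finset.mem_toList]
    refine (val_mem_or ha).imp id ?_
    rintro ⟨k, hk⟩
    exact Finset.mem_image.2 ⟨k, Finset.mem_univ k, hk⟩
  · change _ = (standardForm _ _ _).cls
    rw [Proc.cls_standardForm (Finset.nodup_toList _), Finset.toList_toFinset, sem]
    congr 1
    refine Finset.sum_congr rfl fun i _ => ?_
    rw [(hst i).comp_eq]
    refine congrArg Proc.cls (Proc.subst_congr fun x hx => (hσ i x (.inl hx)).symm)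
  · refine h.corresponds hF hg hpub (fun x => ?_) fun x hx => ?_
    · rw [h.live, Set.mem_iUnion]
      exact exists_congr fun i => (hst i).mem_live.symm
    · have hx' : ∃ i, x ∈ D i := Set.mem_iUnion.1 hx
      rw [unionSubst, dif_pos hx']
      exact hσ _ x hx'.choose_spec
  · intro i
    simp [enc]

/-- Correspondence fixes public values and, for the others, only which names have equal values. So
the names in `rs` that occur are in bijection with the fresh values of the names they are assigned
to, and the standard form differs from that of `sem` by α-conversion and vacuous restrictions. -/
theorem Inv.eq_sem_of_rel (hF : F.NormalForm) (h : F.Inv p η) (hg : Injective g)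
    (hpub : ∀ k, g k ∉ F.pub) {q : Cls 𝒩 PID} (hrel : F.Rel hM q (F.enc p η)) :
    q = sem g p η := by
  classical
  obtain ⟨-, -, rs, S, l, σ, hrs, hrpub, hst, -, hσ, -, rfl, hcor, hctrl⟩ := hrel
  have hp : ∀ i, p i = (S i, l i) := by
    intro i
    have := hctrl i
    simp only [enc] at this
    split_ifs at this with he
    exact he.symm
  have hst' : ∀ i, F.StablePlace (p i) := fun i => hp i ▸ hst i
  set D : Fin n → Set 𝒩 := fun i => {x | x ∈ (S i).fn ∨ x ∈ l i}
  set U := unionSubst D σ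
  have hDlive : ∀ i x, x ∈ D i ↔ x ∈ F.live (p i) := by
    intro i x
    rw [(hst' i).mem_live, hp i]
    rfl
  have hU : ∀ i x, x ∈ D i → U x = σ i x := by
    intro i x hx
    have hx' : ∃ i, x ∈ D i := ⟨i, hx⟩
    have hU : U x = σ hx'.choose x := dif_pos hx'
    -- Threads have no live names in common, so the index chosen by `unionSubst` can only be `i`.
    have : hx'.choose = i := by
      by_contra hne
      exact h.notMem_live hF (((h.reach i).typed hF).live_subset hF ((hDlive i x).1 hx)) hne
        ((hDlive _ x).1 hx'.choose_spec)
    rw [hU, this]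
  have hUval : ∀ i x, x ∈ D i → U x ∈ F.pub ∨ U x ∈ rs := fun i x hx => by
    rw [hU i x hx]
    exact (hσ i x hx).symm
  have hpubval : ∀ i x, x ∈ D i → (hxp : U x ∈ F.pub) → η x = some (.inl ⟨U x, hxp⟩) := by
    intro i x hx hxp
    have : F.substEnc η (.eq x (.inl ⟨U x, hxp⟩)) = 1 :=
      hcor.pub x (Set.mem_iUnion.2 ⟨i, hx⟩) hxp
    exact substEnc_eq_pos.1 (by omega)
  have hrsval : ∀ i x, x ∈ D i → U x ∈ rs → ∃ k, η x = some (.inr k) := by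
    intro i x hx hxr
    obtain ⟨k, hk⟩ := hcor.restr x (Set.mem_iUnion.2 ⟨i, hx⟩) hxr
    have : F.substEnc η (.eq x (.inr k)) = 1 := hk
    exact ⟨k, substEnc_eq_pos.1 (by omega)⟩
  have hηU : ∀ i x j y, x ∈ D i → y ∈ D j → U x ∈ rs → U y ∈ rs → (U x = U y ↔ η x = η y) := by
    intro i x j y hx hy hxr hyr
    obtain ⟨k, hk⟩ := hrsval i x hx hxr
    obtain ⟨k', hk'⟩ := hrsval j y hy hyr
    rw [hcor.eq x (Set.mem_iUnion.2 ⟨i, hx⟩) y (Set.mem_iUnion.2 ⟨j, hy⟩) hxr hyr, hk, hk']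
    simp only [enc, substEnc, hk, hk', Option.some.injEq, Sum.inr.injEq]
    constructor
    · intro he
      have := he k
      rw [if_pos rfl] at this
      split_ifs at this with h'
      rw [h']
    · rintro rfl w
      rfl
  let Ps : List (Proc 𝒩 PID) := List.ofFn fun i => (S i).subst (σ i)
  have hfn : ∀ y, y ∈ (Proc.prod Ps).fn ↔ ∃ i, ∃ x ∈ (S i).fn, U x = y := by
    intro y
    rw [← Cls.fn_cls, Proc.cls_prod, List.map_ofFn, List.sum_ofFn, Cls.fn_sum]
    simp only [Finset.mem_univ, true_and, comp_apply, Cls.fn_cls, Proc.fn_subst, Finset.mem_image]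
    refine exists_congr fun i => exists_congr fun x => and_congr_right fun hx => ?_
    rw [hU i x (.inl hx)]
  -- `θ` renames the values of the live names
  let θ : 𝒩 → 𝒩 := fun y => if h : ∃ i x, x ∈ (S i).fn ∧ U x = y then
    val g η h.choose_spec.choose else y
  have hθ : ∀ i x, x ∈ (S i).fn → U x ∈ rs → θ (U x) = val g η x := by
    intro i x hx hxr
    have hex : ∃ j y, y ∈ (S j).fn ∧ U y = U x := ⟨i, x, hx, rfl⟩
    have hθ : θ (U x) = val g η hex.choose_spec.choose := dif_pos hex
    obtain ⟨hy, he⟩ := hex.choose_spec.choose_spec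
    generalize hex.choose_spec.choose = y at hθ hy he
    have := (hηU _ y i x (.inl hy) (.inl hx) (he ▸ hxr) hxr).1 he
    obtain ⟨k, hk⟩ := hrsval i x (.inl hx) hxr
    rw [hθ, val_of_eq hk, val_of_eq (this.trans hk)]
  -- The renaming is meaningful only on restricted names that occur. The other ones bind nothing and
  -- are dropped before the α-conversion.
  let X := rs.toFinset ∩ (Proc.prod Ps).fn
  have hX : ∀ y ∈ X.toList, y ∈ rs ∧ ∃ i, ∃ x ∈ (S i).fn, U x = y := by
    intro y hy
    rw [Finset.mem_toList, Finset.mem_inter, hfn] at hy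
    exact ⟨List.mem_toFinset.1 hy.1, hy.2⟩
  have hθX : ∀ y ∈ X.toList, ∃ k, θ y = g k := by
    intro y hy
    obtain ⟨hr, i, x, hx, rfl⟩ := hX y hy
    obtain ⟨k, hk⟩ := hrsval i x (.inl hx) hr
    exact ⟨k, by rw [hθ i x hx hr, val_of_eq hk]; rfl⟩
  have h₁ : (standardForm rs S σ).cls = (Proc.resList X.toList (Proc.prod Ps)).cls := by
    rw [standardForm, Proc.cls_resList hrs, Proc.cls_resList (Finset.nodup_toList _),
      Finset.toList_toFinset]
    exact (Cls.nu_inter_fn _ _).symm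
  have hfnX : (Proc.resList X.toList (Proc.prod Ps)).fn = (Proc.prod Ps).fn \ X := by
    rw [← Cls.fn_cls, Proc.cls_resList (Finset.nodup_toList _), Cls.fn_nu, Finset.toList_toFinset]
    rfl
  change (standardForm rs S σ).cls = _
  rw [h₁, ← Proc.cls_subst_id, Proc.cls_resList_subst (θ := θ) (Finset.nodup_toList _)]
  · rw [Finset.toList_toFinset, Proc.prod_subst, Proc.cls_prod, List.map_map, List.map_ofFn,
      List.sum_ofFn]
    have hcomp : ∀ i, (((Proc.cls ∘ fun P => P.subst fun y => if y ∈ X.toList then θ y else id y) ∘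
        fun i => (S i).subst (σ i)) i) = comp g η (p i) := by
      intro i
      rw [(hst' i).comp_eq, hp i]
      change (((S i).subst (σ i)).subst _).cls = ((S i).subst (val g η)).cls
      rw [Proc.cls_subst_comp]
      refine congrArg Proc.cls (Proc.subst_congr fun x hx => ?_)
      change (if σ i x ∈ X.toList then θ (σ i x) else σ i x) = _
      rw [← hU i x (.inl hx)]
      split_ifs with hxX
      · exact hθ i x hx (hX _ hxX).1
      · have hxr : U x ∉ rs := fun hxr => hxX (by
          rw [Finset.mem_toList, Finset.mem_inter, hfn]
          exact ⟨List.mem_toFinset.2 hxr, i, x, hx, rfl⟩)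
        rw [val_of_eq (hpubval i x (.inl hx) ((hUval i x (.inl hx)).resolve_right hxr))]
        rfl
    rw [Finset.sum_congr rfl fun i _ => hcomp i, sem]
    -- The renamed names are only those `g k` that occur, whereas `sem` restricts all of them. On
    -- the free names this makes no difference.
    refine Cls.nu_congr fun a ha => ?_
    obtain ⟨i, -, hi⟩ := (Cls.fn_sum _ _).1 ha
    rw [(hst' i).comp_eq, hp i, Cls.fn_cls, Proc.fn_subst] at hi
    obtain ⟨x, hx, rfl⟩ := Finset.mem_image.1 hi
    constructor
    · intro ha
      obtain ⟨y, hy, he⟩ := Finset.mem_image.1 ha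
      obtain ⟨k, hk⟩ := hθX y (Finset.mem_toList.2 hy)
      exact Finset.mem_image.2 ⟨k, Finset.mem_univ k, hk.symm.trans he⟩
    · intro ha
      obtain ⟨k, -, hk⟩ := Finset.mem_image.1 ha
      have hxr : U x ∈ rs := by
        refine (hUval i x (.inl hx)).resolve_left fun hxp => hpub k ?_
        rw [hk, val_of_eq (hpubval i x (.inl hx) hxp)]
        exact hxp
      refine Finset.mem_image.2 ⟨U x, ?_, hθ i x hx hxr⟩
      rw [Finset.mem_inter, hfn]
      exact ⟨List.mem_toFinset.2 hxr, i, x, hx, rfl⟩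
  · intro y hy z hz he
    obtain ⟨hyr, i, x, hx, rfl⟩ := hX y hy
    obtain ⟨hzr, j, w, hw, rfl⟩ := hX z hz
    rw [hθ i x hx hyr, hθ j w hw hzr] at he
    obtain ⟨k, hk⟩ := hrsval i x (.inl hx) hyr
    obtain ⟨k', hk'⟩ := hrsval j w (.inl hw) hzr
    rw [hηU i x j w (.inl hx) (.inl hw) hyr hzr, hk, hk', val_injective hg hpub hk hk' he]
  -- After restricting `X` only public names remain free, so `g k` captures nothing.
  · intro y hy hy'
    obtain ⟨k, hk⟩ := hθX y hy
    rw [Finset.image_id, hfnX, Finset.mem_sdiff, hk] at hy'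
    obtain ⟨i, x, hx, he⟩ := (hfn _).1 hy'.1
    rcases hUval i x (.inl hx) with hxp | hxr
    · exact hpub k (he ▸ hxp)
    · exact hy'.2 (Finset.mem_inter.2 ⟨List.mem_toFinset.2 (he ▸ hxr), hy'.1⟩)

end Spec

end Relation

/-! # Simulation of reactions by runs -/

section Simulation

variable {𝒩 PID : Type*} [LinearOrder 𝒩] [Infinite 𝒩] {n : ℕ}

open Function

theorem Finset.exists_of_val_map_eq_cons {ι α : Type*} [DecidableEq ι] {s : Finset ι} {f : ι → α}
    {a : α} {R : Multiset α} (h : s.val.map f = a ::ₘ R) :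
    ∃ i ∈ s, f i = a ∧ (s.erase i).val.map f = R := by
  obtain ⟨i, hi, hf⟩ := Multiset.mem_map.1 (h ▸ Multiset.mem_cons_self a R)
  refine ⟨i, hi, hf, ?_⟩
  rw [← Multiset.cons_erase hi, Multiset.map_cons, hf, Multiset.cons_inj_right] at h
  rwa [Finset.erase_val]

theorem Flat.prod {ι : Type*} {ρ : 𝒩 → 𝒩} {P : ι → Proc 𝒩 PID} {f : ι → Cls 𝒩 PID × Redex 𝒩 PID}
    (h : ∀ i, Flat (P i) ρ ∅ {f i}) (s : List ι) :
    Flat (Proc.prod (s.map P)) ρ ∅ (s.map f : Multiset _) := by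
  induction s with
  | nil => exact Flat.zero.2 ⟨rfl, rfl⟩
  | cons i s ih =>
    exact ⟨∅, ∅, {f i}, _, Finset.disjoint_empty_left _, rfl, rfl, h i, ih⟩

theorem Flat.resList {rs : List 𝒩} (hrs : rs.Nodup) {P : Proc 𝒩 PID}
    {M : Multiset (Cls 𝒩 PID × Redex 𝒩 PID)} (h : Flat P id ∅ M) :
    Flat (Proc.resList rs P) id rs.toFinset M := by
  induction rs with
  | nil => exact h
  | cons r rs ih =>
    rw [List.nodup_cons] at hrs
    refine ⟨r, rs.toFinset, by simpa using hrs.1, by simp, ?_⟩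
    have : update (id : 𝒩 → 𝒩) r r = id := update_eq_self r id
    rw [this]
    exact ih hrs.2

/-- A call flattens to its own atom, which records the arguments, and flattenings are invariant
under congruence. -/
theorem Proc.call_args_injective {K : PID} {args args' : List 𝒩}
    (h : (Proc.call K args).cls = (Proc.call K args').cls) : args = args' := by
  obtain ⟨Y, ⟨-, hY⟩, -⟩ := (Proc.cls_eq.1 h).flatLe.1 id ∅ _ ⟨rfl, rfl⟩ ∅
  have := congrArg Prod.snd (Multiset.singleton_inj.1 hY)
  simpa [Proc.atom, Proc.redex] using this

theorem Proc.exists_of_redex_choice {P : Proc 𝒩 PID} {ρ : 𝒩 → 𝒩}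
    {s : Set (Summand 𝒩 (Cls 𝒩 PID))} (h : P.redex ρ = .choice s)
    {u : Summand 𝒩 (Cls 𝒩 PID)} (hu : u ∈ s) :
    ∃ (m : ℕ) (π : Fin m → Prefix 𝒩) (S : Fin m → Proc 𝒩 PID) (k : Fin m),
      P = .choice π S ∧ (π k).summand (S k) ρ = u := by
  cases P with
  | call K args => cases h
  | choice π S =>
    cases h
    obtain ⟨k, hk⟩ := hu
    exact ⟨_, π, S, k, rfl, hk⟩
  | res r P =>
    cases h
    exact hu.elim
  | par P Q =>
    cases h
    exact hu.elim

theorem Proc.exists_of_redex_call {P : Proc 𝒩 PID} {ρ : 𝒩 → 𝒩} {K : PID} {args : List 𝒩}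
    (h : P.redex ρ = .call K args) : ∃ xs, P = .call K xs ∧ xs.map ρ = args := by
  cases P with
  | call K' xs =>
    cases h
    exact ⟨xs, rfl, rfl⟩
  | _ => cases h

theorem Prefix.summand_eq_tau {p : Prefix 𝒩} {S : Proc 𝒩 PID} {ρ : 𝒩 → 𝒩} {q : Cls 𝒩 PID}
    (h : p.summand S ρ = .tau q) : p = .tau ∧ (S.subst ρ).cls = q := by
  cases p <;> cases h
  exact ⟨rfl, rfl⟩

theorem Prefix.summand_eq_out {p : Prefix 𝒩} {S : Proc 𝒩 PID} {ρ : 𝒩 → 𝒩} {a b : 𝒩}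
    {q : Cls 𝒩 PID} (h : p.summand S ρ = .out a b q) :
    ∃ x y, p = .out x y ∧ ρ x = a ∧ ρ y = b ∧ (S.subst ρ).cls = q := by
  cases p <;> cases h
  exact ⟨_, _, rfl, rfl, rfl, rfl⟩

theorem Prefix.summand_eq_inp {p : Prefix 𝒩} {S : Proc 𝒩 PID} {ρ : 𝒩 → 𝒩} {a : 𝒩}
    {f : 𝒩 → Cls 𝒩 PID} (h : p.summand S ρ = .inp a f) :
    ∃ x y, p = .inp x y ∧ ρ x = a ∧ ∀ z, (S.subst (update ρ y z)).cls = f z := by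
  cases p <;> cases h
  exact ⟨_, _, rfl, rfl, fun _ => rfl⟩

theorem PetriNet.FiresSeq.of_append {α β : Type*} {N : PetriNet α β} {M₁ M₃ : α → ℕ}
    {ts ts' : List β} (h : N.FiresSeq M₁ (ts ++ ts') M₃) :
    ∃ M₂, N.FiresSeq M₁ ts M₂ ∧ N.FiresSeq M₂ ts' M₃ := by
  induction ts generalizing M₁ with
  | nil => exact ⟨M₁, .nil _, h⟩
  | cons t ts ih =>
    cases h with
    | cons hf h =>
      obtain ⟨M₂, h₁, h₂⟩ := ih h
      exact ⟨M₂, .cons hf h₁, h₂⟩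

theorem PetriNet.Reachable.of_firesSeq {α β : Type*} {N : PetriNet α β} {M₁ M₂ : α → ℕ}
    {ts : List β} (h : N.Reachable M₁) (h' : N.FiresSeq M₁ ts M₂) : N.Reachable M₂ := by
  obtain ⟨ts₀, h₀⟩ := h
  exact ⟨ts₀ ++ ts, h₀.append h'⟩

namespace Spec

variable {ν : Type*} {F : Spec 𝒩 PID n} [Fintype PID]
  {p : Fin n → Aug 𝒩 PID} {η : 𝒩 → Option (F.pub ⊕ ν)} {g : ν → 𝒩}

/-- A choice counts as a component only if it is non-empty. This is where the absence of the stop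
process is needed. -/
theorem StablePlace.flat (hF : F.NormalForm) {i : Fin n} {q : Aug 𝒩 PID} (hq : F.CReach ν i q)
    (h : F.StablePlace q) (ρ : 𝒩 → 𝒩) : Flat q.1 ρ ∅ {q.1.atom ρ} := by
  obtain ⟨S, l⟩ := q
  rcases h with ⟨m, π, S', rfl⟩ | ⟨K, args, rfl, -⟩
  · obtain ⟨e, -, hb⟩ := (hq.typed hF).inBody (by rintro ⟨_, _, h⟩; cases h)
    refine ⟨rfl, ?_⟩
    rw [if_neg hb.noStop.1]
  · exact ⟨rfl, rfl⟩

theorem Typed.continuation {i : Fin n} {m : ℕ} {π : Fin m → Prefix 𝒩} {S : Fin m → Proc 𝒩 PID}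
    {l : List 𝒩} (h : F.Typed i (.choice π S, l)) (k : Fin m) :
    (S k).IsThread ∧ (S k).ArityOK fun K => (F.formals K).length := by
  obtain ⟨e, -, hb⟩ := h.inBody (by rintro ⟨_, _, h⟩; cases h)
  exact ⟨hb.thread k, hb.arity k⟩

theorem ofFlat_atoms (hst : ∀ i, F.StablePlace (p i)) (s : Finset (Fin n)) :
    Cls.ofFlat (s.val.map fun i => (p i).1.atom (val g η)) = ∑ i ∈ s, comp g η (p i) := by
  rw [Cls.ofFlat, Multiset.map_map]
  exact Finset.sum_congr rfl fun i _ => ((hst i).comp_eq g η).symm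

variable [Fintype ν]

/-- The standard form of a stable state flattens to one atom for each thread, so inversion of the
reaction exhibits the threads that take part. -/
theorem Inv.exists_reduces (hF : F.NormalForm) (h : F.Inv p η) (hst : ∀ i, F.StablePlace (p i))
    {q' : Cls 𝒩 PID} (hr : F.ReactCls (sem g p η) q') :
    ∃ q R, F.Reduces (Finset.univ.val.map fun i => (p i).1.atom (val g η)) q R ∧
      q' = Cls.nu (Finset.univ.image g) (q + Cls.ofFlat R) := by
  have hcls : (standardForm (Finset.univ.image g).toList (fun i => (p i).1)
      fun _ => val g η).cls = sem g p η := by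
    rw [Proc.cls_standardForm (Finset.nodup_toList _), Finset.toList_toFinset, sem]
    exact congrArg _ (Finset.sum_congr rfl fun i _ => ((hst i).comp_eq g η).symm)
  have hfn := congrArg Cls.fn hcls
  rw [← hcls] at hr
  obtain ⟨P', rfl, hP'⟩ := hr.react
  have hflat : Flat (standardForm (Finset.univ.image g).toList (fun i => (p i).1)
      fun _ => val g η) id (Finset.univ.image g)
      (Finset.univ.val.map fun i => (p i).1.atom (val g η)) := by
    have := Flat.resList (Finset.nodup_toList (Finset.univ.image g)) (Flat.prod (ρ := id)
      (P := fun i => (p i).1.subst (val g η)) (f := fun i => (p i).1.atom (val g η))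
      (fun i => by rw [Flat.subst]; exact (hst i).flat hF (h.reach i) _) (List.finRange n))
    rw [Finset.toList_toFinset, ← List.ofFn_eq_map, ← List.ofFn_eq_map, ← Fin.univ_val_map] at this
    exact this
  obtain ⟨q, R, hred, hq⟩ := hP'.flat
    (fun K => (hF.body_ok K).fn_eq.subset) hflat (by
      rw [Finset.image_id, ← Cls.fn_cls, hfn, sem, Cls.fn_nu]
      exact Finset.disjoint_sdiff)
  exact ⟨q, R, hred, by rw [← hq, Proc.cls_subst_id]⟩

variable {M : SubstPlace 𝒩 F.pub ν → ℕ}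

theorem Inv.exists_step (hF : F.NormalForm)
    (hν : F.restr.card + F.inp.card + F.frm.card ≤ Fintype.card ν) (hg : Injective g)
    (hpub : ∀ k, g k ∉ F.pub) (hM : F.InitialSubstMarking ν M) (h : F.Inv p η)
    (hst : ∀ i, F.StablePlace (p i)) {q' : Cls 𝒩 PID} (hr : F.ReactCls (sem g p η) q') :
    ∃ p' η', (F.stableTS hM).step (F.enc p η) (F.enc p' η') ∧ F.Inv p' η' ∧
      (∀ i, F.StablePlace (p' i)) ∧ sem g p' η' = q' := by
  obtain ⟨q, R, hred, rfl⟩ := h.exists_reduces hF hst hr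
  have hpair : ∀ {i S}, (p i).1 = S → p i = (S, (p i).2) := fun h => Prod.ext h rfl
  generalize hatoms : (Finset.univ.val.map fun i => (p i).1.atom (val g η)) = A at hred
  cases hred with
  | tau c s q R hu =>
    obtain ⟨i, -, hi, rfl⟩ := Finset.exists_of_val_map_eq_cons hatoms
    obtain ⟨m, π, S, k, hS, hks⟩ := Proc.exists_of_redex_choice (congrArg Prod.snd hi) hu
    obtain ⟨hk, rfl⟩ := Prefix.summand_eq_tau hks
    have hp := hpair hS
    generalize (p i).2 = l at hp
    have hreach := h.reach i
    rw [hp] at hreach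
    obtain ⟨hi₁, hsum, -⟩ := h.tau (g := g) hF hp hk
    have hc := (hreach.typed hF).continuation k
    obtain ⟨p', η', hrun, hi₂, hsem, hst', hoth⟩ :=
      hi₁.nu_run hF hν hg hpub hM (update_self ..) hc.1 hc.2
    refine ⟨p', η', stableTS_step_of_silentRun (.refl _) (fires_single
      (t := ⟨(.choice π S, l), .tau, ∅, (S k, l ++ forgotten (.choice π S) (S k))⟩) hreach
      ⟨_, .tau π S l k hk⟩ rfl hp effect_empty) (.inl (.tau π S l k hk)) hrun, hi₂, fun j => ?_, ?_⟩
    · by_cases hj : j = i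
      · exact hj ▸ hst'
      · rw [hoth j hj, update_of_ne hj]
        exact hst j
    · rw [hsem, sem, hsum, ofFlat_atoms hst]
  | call c K args R hlen =>
    obtain ⟨i, -, hi, rfl⟩ := Finset.exists_of_val_map_eq_cons hatoms
    obtain ⟨xs, hS, rfl⟩ := Proc.exists_of_redex_call (congrArg Prod.snd hi)
    have hp := hpair hS
    -- Control passes to the body only after all arguments are transferred and the list of forgotten
    -- names is empty.
    obtain ⟨l', η₁, hrun₁, hi₁, hc₁⟩ := h.call₁_run hF g hM hp
    obtain ⟨η₂, hrun₂, hi₂, hc₂⟩ := hi₁.call₂_run hF g hM (update_self ..)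
    rw [update_idem] at hrun₂ hi₂ hc₂
    have hc : ∀ j, comp g η₂ (update p i (.call K [], []) j) = comp g η (p j) :=
      fun j => (hc₂ j).trans (hc₁ j)
    have hp₂ : update p i (.call K [], []) i = (.call K [], []) := update_self ..
    have hreach := hi₂.reach i
    rw [hp₂] at hreach
    obtain ⟨hi₃, hsum, -⟩ := hi₂.call₃ (g := g) hF hp₂
    rw [update_idem] at hi₃ hsum
    obtain ⟨p', η', hrun, hi₄, hsem, hst', hoth⟩ := hi₃.nu_run hF hν hg hpub hM (update_self ..)
      (hF.body_ok K).thread (hF.body_ok K).arity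
    have hf := fires_single (hM := hM)
      (t := ⟨(.call K [], []), .tau, ∅, (F.body K, [])⟩) hreach
      ⟨_, .call₃ K⟩ rfl hp₂ (effect_empty (η := η₂))
    rw [update_idem] at hf
    refine ⟨p', η', stableTS_step_of_silentRun (hrun₁.trans hrun₂) hf (.inr (.call₃ K)) hrun, hi₄,
      fun j => ?_, ?_⟩
    · by_cases hj : j = i
      · exact hj ▸ hst'
      · rw [hoth j hj, update_of_ne hj]
        exact hst j
    -- That the formal parameters now hold the values of the arguments follows from the invariance
    -- of the denoted call under the silent run, since congruent calls have equal arguments.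
    · have hargs : (F.formals K).map (val g η₂) = xs.map (val g η) := by
        have := hc i
        rw [hp₂, (hst i).comp_eq, hS] at this
        exact Proc.call_args_injective (K := K) (by simpa [comp, complete, Proc.subst] using this)
      rw [hsem, sem, hsum, ofFlat_atoms hst, hargs]
      congr 2
      exact Finset.sum_congr rfl fun j _ => hc j
  | comm c₁ s₁ c₂ s₂ a b f q R hu₁ hu₂ =>
    obtain ⟨j, -, hj, hatoms'⟩ := Finset.exists_of_val_map_eq_cons hatoms
    obtain ⟨i, hij, hi, rfl⟩ := Finset.exists_of_val_map_eq_cons hatoms'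
    have hij := Finset.ne_of_mem_erase hij
    obtain ⟨m', π', S', k', hS', hks'⟩ := Proc.exists_of_redex_choice (congrArg Prod.snd hj) hu₁
    obtain ⟨m, π, S, k, hS, hks⟩ := Proc.exists_of_redex_choice (congrArg Prod.snd hi) hu₂
    obtain ⟨x', y', hk', hx', hf⟩ := Prefix.summand_eq_inp hks'
    obtain ⟨x, y, hk, hx, rfl, rfl⟩ := Prefix.summand_eq_out hks
    have hp := hpair hS
    have hp' := hpair hS'
    generalize (p i).2 = l at hp
    generalize (p j).2 = l' at hp'
    have hreach := h.reach i
    rw [hp] at hreach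
    have hreach' := h.reach j
    rw [hp'] at hreach'
    obtain ⟨u, hu⟩ := h.exists_eq (i := i) (x := x)
      (hp ▸ subset_live_choice k (by simp [hk, Prefix.scopeFn]))
    obtain ⟨v, hv⟩ := h.exists_eq (i := i) (x := y)
      (hp ▸ subset_live_choice k (by simp [hk, Prefix.scopeFn]))
    obtain ⟨u', hu'⟩ := h.exists_eq (i := j) (x := x')
      (hp' ▸ subset_live_choice k' (by simp [hk', Prefix.scopeFn]))
    -- Both channel names denote the same name, so they have the same value in the net. Hence the
    -- labels of sender and receiver match.
    obtain rfl := val_injective hg hpub hu hu' (hx.trans hx'.symm)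
    obtain ⟨he, hi₁, hsum, -⟩ := h.comm (g := g) hF hij hp hp' hk hk' hu hv hu'
    have hc := (hreach.typed hF).continuation k
    have hc' := (hreach'.typed hF).continuation k'
    have hfire := fires_sync (hM := hM) hij
      (t := ⟨(.choice π S, l), .send u v, _, (S k, l ++ forgotten (.choice π S) (S k))⟩)
      (t' := ⟨(.choice π' S', l'), .rcv u v, _, (S' k', l' ++ forgotten (.choice π' S') (S' k'))⟩)
      hreach hreach'
      ⟨_, .snd π S l k x y u v hk (h.valid.mem_dom hu) (h.valid.mem_dom hv)⟩
      ⟨_, .rcv π' S' l' k' x' y' u v hk' (h.valid.mem_dom hu') fun h' => absurd h'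
        (notMem_restr hF (Finset.mem_union_left _ ((hreach'.typed hF).live_inp hF hk').1))⟩
      ⟨u, v, rfl, rfl⟩ hp hp' he
    -- Both participants may now start with restrictions. Those of the receiver are opened first,
    -- then those of the sender.
    obtain ⟨p₂, η₂, hrun₂, hi₂, hsem₂, hst₂, hoth₂⟩ :=
      hi₁.nu_run hF hν hg hpub hM (update_self ..) hc'.1 hc'.2
    have hp₂ : p₂ i = (S k, l ++ forgotten (.choice π S) (S k)) := by
      rw [hoth₂ i hij, update_of_ne hij, update_self]
    obtain ⟨p₃, η₃, hrun₃, hi₃, hsem₃, hst₃, hoth₃⟩ :=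
      hi₂.nu_run hF hν hg hpub hM hp₂ hc.1 hc.2
    refine ⟨p₃, η₃, stableTS_step_of_silentRun (.refl _) hfire trivial (hrun₂.trans hrun₃), hi₃,
      fun w => ?_, ?_⟩
    · by_cases hwi : w = i
      · exact hwi ▸ hst₃
      · rw [hoth₃ w hwi]
        by_cases hwj : w = j
        · exact hwj ▸ hst₂
        · rw [hoth₂ w hwj, update_of_ne hwj, update_of_ne hwi]
          exact hst w
    · rw [hsem₃, hsem₂, sem, hsum, ofFlat_atoms hst, hf]

variable {hM : F.InitialSubstMarking ν M}

theorem exists_fresh_names (F : Spec 𝒩 PID n) (ν : Type*) [Fintype ν] :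
    ∃ g : ν → 𝒩, Injective g ∧ ∀ k, g k ∉ F.pub := by
  have : Infinite {x // x ∉ F.pub} := F.pub.finite_toSet.infinite_compl.to_subtype
  let e := Infinite.natEmbedding {x // x ∉ F.pub}
  refine ⟨fun k => (e (Fintype.equivFin ν k)).1, fun a b hab => ?_, fun k => (e _).2⟩
  exact (Fintype.equivFin ν).injective (Fin.val_injective (e.injective (Subtype.ext hab)))

theorem exists_state_of_reachable (hF : F.NormalForm) {M' : F.NPlace ν → ℕ}
    (h : (F.net hM).Reachable M') : ∃ p η, M' = F.enc p η ∧ F.Inv p η := by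
  -- The conclusion does not involve an interpretation of the fresh values, so any one will do.
  obtain ⟨g, hg, hpub⟩ := F.exists_fresh_names ν
  obtain ⟨η, h₀, hi⟩ := exists_initial_state hF hM
  obtain ⟨ts, hts⟩ := h
  rw [h₀] at hts
  obtain ⟨p', η', hM', hi', -⟩ := hi.of_firesSeq hF hg hpub hts
  exact ⟨p', η', hM', hi'⟩

theorem Inv.reactCls_of_step (hF : F.NormalForm) (h : F.Inv p η) (hg : Injective g)
    (hpub : ∀ k, g k ∉ F.pub) {M' : F.NPlace ν → ℕ} (hs : (F.stableTS hM).step (F.enc p η) M') :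
    ∃ p' η', M' = F.enc p' η' ∧ F.Inv p' η' ∧ F.ReactCls (sem g p η) (sem g p' η') := by
  obtain ⟨_, hts, ts₁, t, ts₂, rfl, ht, h₁, h₂⟩ := hs
  obtain ⟨M₁, hts₁, hts⟩ := hts.of_append
  cases hts with
  | cons hf hts₂ =>
    obtain ⟨p₁, η₁, rfl, hi₁, hsem₁⟩ := h.of_firesSeq hF hg hpub hts₁
    obtain ⟨p₂, η₂, rfl, hi₂, hre, -⟩ := hi₁.of_fires hF hg hpub hf
    obtain ⟨p₃, η₃, rfl, hi₃, hsem₃⟩ := hi₂.of_firesSeq hF hg hpub hts₂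
    refine ⟨p₃, η₃, rfl, hi₃, ?_⟩
    rw [hsem₃ h₂, ← hsem₁ h₁]
    exact hre ht

theorem mem_states_of_reactCls {q q' : Cls 𝒩 PID} (hq : q ∈ F.ts.states)
    (h : F.ReactCls q q') : q' ∈ F.ts.states := by
  obtain ⟨P, hP, rfl⟩ := hq
  obtain ⟨P', rfl, hP'⟩ := ReactCls.react (P := P) h
  exact ⟨P', hP.tail hP', rfl⟩

theorem net_safe (hF : F.NormalForm) : (F.net hM).Safe := by
  intro M' hM' s _
  obtain ⟨p, η, rfl, -⟩ := exists_state_of_reachable hF hM'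
  rcases s with s | ⟨i, q⟩
  · cases s <;> simp only [enc, substEnc] <;> split_ifs <;> simp
  · simp only [enc]
    split_ifs <;> simp

theorem stablePlace_body₀ (hF : F.NormalForm) (i : Fin n) : F.StablePlace (F.body₀ i, []) := by
  refine (hF.body₀_stable i).imp id ?_
  rintro ⟨K, args, h⟩
  have := (hF.body₀_ok i).arity
  rw [h] at this
  exact ⟨K, args, h, this⟩

theorem rel_init (hF : F.NormalForm) : F.Rel hM F.ts.init (F.stableTS hM).init := by
  have hD : (fun i => {x | x ∈ (F.body₀ i).fn ∨ x ∈ ([] : List 𝒩)}) =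
      fun i => {x | x ∈ F.formals₀ i} := by
    funext i
    ext x
    simp [(hF.body₀_ok i).fn_eq]
  have hD' : ∀ i x, (x ∈ (F.body₀ i).fn ∨ x ∈ ([] : List 𝒩)) ↔ x ∈ F.formals₀ i :=
    fun i x => Set.ext_iff.1 (congrFun hD i) x
  have hctrl : ∀ i, (F.net hM).M₀ (.inr (i, (F.body₀ i, []))) = 1 := by
    obtain ⟨η, h₀, -⟩ := exists_initial_state hF hM
    intro i
    simp [h₀, enc]
  have hrestr : ∀ r ∈ F.restr₀, r ∈ F.allBound := fun r hr =>
    Multiset.mem_add.2 (.inl (Multiset.mem_add.2 (.inl (Multiset.mem_coe.2 hr))))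
  have hst := stablePlace_body₀ hF
  refine ⟨⟨F.proc, .refl, rfl⟩, ⟨⟨[], .nil _⟩, fun i => ⟨_, hst i, one_pos.trans_eq (hctrl i).symm⟩⟩,
    F.restr₀, F.body₀, fun _ => [], F.subst₀, ?_, fun r hr => hF.bound_free r (hrestr r hr), hst,
    fun i => .inl ⟨i, .refl⟩, ?_, ?_, rfl, ?_, hctrl⟩
  · have := hF.bound_nodup
    rw [allBound, add_assoc] at this
    exact Multiset.coe_nodup.1 (Multiset.nodup_of_le (Multiset.le_add_right _ _) this)
  · exact fun i x hx => hF.subst₀_mem i x ((hD' i x).1 hx)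
  · exact fun i x hx => hF.subst₀_id i x fun h => hx ((hD' i x).2 h)
  · rw [hD]
    exact hM

/-- One interpretation `g` serves for all states. It turns a related pair into a state together with
the class that the state denotes, so both directions become statements about `sem g`. -/
theorem isBisimulation_rel (hF : F.NormalForm)
    (hν : F.restr.card + F.inp.card + F.frm.card ≤ Fintype.card ν) :
    IsBisimulation F.ts (F.stableTS hM) (F.Rel hM) := by
  obtain ⟨g, hg, hpub⟩ := F.exists_fresh_names ν
  refine ⟨fun q M' h => ⟨h.1, h.2.1⟩, rel_init hF, ?_, ?_⟩
  · intro q M' hrel q' hq' hs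
    obtain ⟨p, η, rfl, hi⟩ := exists_state_of_reachable hF hrel.2.1.1
    have hst := stablePlace_of_stableMarking hrel.2.1.2
    obtain rfl := hi.eq_sem_of_rel hF hg hpub hrel
    obtain ⟨p', η', hstep, hi', hst', rfl⟩ := hi.exists_step hF hν hg hpub hM hst hs
    have hmem : F.enc p' η' ∈ (F.stableTS hM).states :=
      ⟨hrel.2.1.1.of_firesSeq hstep.choose_spec.1, stableMarking_enc hst'⟩
    exact ⟨_, hmem, hstep, hi'.rel hF hg hpub hst' hq' hmem⟩
  · intro q M' hrel M'' hM'' hs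
    obtain ⟨p, η, rfl, hi⟩ := exists_state_of_reachable hF hrel.2.1.1
    obtain rfl := hi.eq_sem_of_rel hF hg hpub hrel
    obtain ⟨p', η', rfl, hi', hre⟩ := hi.reactCls_of_step hF hg hpub hs
    have hq := mem_states_of_reactCls hrel.1 hre
    exact ⟨_, hq, hre, hi'.rel hF hg hpub (stablePlace_of_stableMarking hM''.2) hq hM''⟩

end Spec

end Simulation

end FCP

theorem theorem6p2 {𝒩 PID ν : Type*} [LinearOrder 𝒩] [Infinite 𝒩] [Fintype PID] [Fintype ν]
    {n : ℕ} (F : FCP.Spec 𝒩 PID n) (hF : F.NormalForm)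
    (hν : F.restr.card + F.inp.card + F.frm.card ≤ Fintype.card ν)
    (M : FCP.SubstPlace 𝒩 F.pub ν → ℕ) (hM : F.InitialSubstMarking ν M) :
    (F.net hM).Safe ∧ FCP.IsBisimulation F.ts (F.stableTS hM) (F.Rel hM) :=
  ⟨FCP.Spec.net_safe hF, FCP.Spec.isBisimulation_rel hF hν⟩
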